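/- **Setting.** Let $B$ be a commutative complex $*$-algebra with local units and let a group $\Gamma$ (unit $e$) act on $B$ by $*$-automorphisms. $M(R)$ denotes the algebra of (two-sided, algebraic) multipliers of an algebra $R$. A *$(B,\Gamma)^{\mathrm{ev}}$-algebra* is a $*$-algebra $A=\bigoplus_{\gamma,\gamma'\in\Gamma}A_{\gamma,\gamma'}$, graded by $\Gamma\times\Gamma$ (with $A_{g}A_{h}\subseteq A_{gh}$, $A_g^*=A_{g^{-1}}$), with local units in $A_{e,e}$, together with $*$-homomorphisms $r,s\colon B\to M(A)$ with commuting images for which $A$ has local units, that preserve the grading and satisfy $a\,r(b)=r(\gamma(b))a$, $a\,s(b)=s(\gamma'(b))a$ for $a\in A_{\gamma,\gamma'}$. A morphism $A\to C$ is a non-degenerate $*$-homomorphism $A\to M(C)$ compatible with $r$, $s$ and the gradings. The fiber product $A\tilde\otimes C$ is the $(B,\Gamma)^{\mathrm{ev}}$-algebra obtained from $\sum A_{\gamma,\gamma'}\otimes C_{\gamma',\gamma''}\subseteq A\otimes C$ by imposing $s(b)a\otimes c=a\otimes r(b)c$. The crossed product $B\rtimes\Gamma=\bigoplus_\gamma B\gamma$,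 with $b\gamma\, b'\gamma'=b\gamma(b')\gamma\gamma'$, $(b\gamma)^*=\gamma^{-1}b^*$ and degree $(\gamma,\gamma)$ on $B\gamma$, is such an algebra; put $\sharp(\sum b_\gamma\gamma)=\sum b_\gamma=\flat(\sum\gamma b_\gamma)$. A *measured multiplier $(B,\Gamma)$-Hopf $*$-algebroid* $(A,\Delta,\epsilon,S,\mu,\phi,\psi)$ consists of a $(B,\Gamma)^{\mathrm{ev}}$-algebra $A$ and of the following: * a coassociative morphism $\Delta$ from $A$ to $A\tilde\otimes A$ such that all products of $\Delta(a)$, on either side, with $x\tilde\otimes1$ ($x\in A_{\gamma,e}$) or $1\tilde\otimes y$ ($y\in A_{e,\gamma}$) lie in $A\tilde\otimes A$. One writes $\Delta(a)=\sum a_{(1)}\tilde\otimes a_{(2)}$; the products $\Delta(a)(x\otimes1)$, $\Delta(a)(1\otimes y)$ and $(x\otimes 1)\Delta(a)$, $(1\otimes y)\Delta(a)$ for arbitrary $x,y\in A$ are elements of the balanced tensor products ${}_sA\otimes_B{}_rA$ and $A_s\otimes_BA_r$, respectively; * a counit, i.e. a morphism $\epsilon\colon A\to B\rtimes\Gamma$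 (with values in $B\rtimes\Gamma$) with $(\epsilon\tilde\otimes\mathrm{id})\Delta=\mathrm{id}=(\mathrm{id}\tilde\otimes\epsilon)\Delta$ under the identifications $b\gamma\tilde\otimes a\mapsto r(b)a$ and $a\tilde\otimes b\gamma\mapsto s(b)a$; * an antipode, i.e. a linear, antimultiplicative bijection $S\colon A\to A$ with $S(A_{\gamma,\gamma'})\subseteq A_{\gamma'^{-1},\gamma^{-1}}$, $S(r(b)a)=S(a)s(b)$, $S(a\,r(b))=s(b)S(a)$, $S(s(b)a)=S(a)r(b)$, $S(a\,s(b))=r(b)S(a)$, such that $\sum S(x_{(1)})x_{(2)}y=s(\flat(\epsilon(x)))y$, $\sum xy_{(1)}S(y_{(2)})=x\,r(\sharp(\epsilon(y)))$ and $\sum S(x_{(2)})\tilde\otimes S(x_{(1)})=\Delta(S(x))$; * a faithful positive linear functional $\mu\colon B\to\mathbb C$ such that for each $\gamma\in\Gamma$ there is a (unique) $D_\gamma\in M(B)$ with $\mu(\gamma(bD_\gamma))=\mu(b)$ for all $b\in B$; * surjective linear maps $\phi,\psi\colon A\to B$ that are $B$-bimodule maps with respect to $r$ and $s$, respectively, vanish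 on $A_{\gamma,\gamma'}$ if $\gamma\ne e$, respectively $\gamma'\neq e$, and are left and right invariant: $\sum s(\phi(x_{(2)}))x_{(1)}a=r(\phi(x))a$, $\sum ax_{(1)}s(\phi(x_{(2)}))=a\,r(\phi(x))$, $\sum r(\psi(x_{(1)}))x_{(2)}a=s(\psi(x))a$, $\sum ax_{(2)}r(\psi(x_{(1)}))=a\,s(\psi(x))$ for all $a,x\in A$. Moreover $\nu:=\mu\circ\phi=\mu\circ\psi$ is faithful and positive. (A functional $\omega$ on a $*$-algebra $C$ is positive if $\omega(c^*c)\ge0$ for all $c$, and faithful if $\omega(Cc)=0$ implies $c=0$.) Let $H$ be the Hilbert space completion of $A$ with respect to $\langle x|y\rangle=\nu(x^*y)$ and $\Lambda_\nu\colon A\to H$ the canonical map. For $x,a\in A$ let $\hat x:=\nu(S(x)\,\cdot\,)$, a linear functional on $M(A)$, and $a\ast\hat x:=\sum a_{(2)}\,r(\psi(S(x)a_{(1)}))\in A$. The dual algebra is $\hat A=\{\nu(x\,\cdot\,):x\in A\}=\{\hat x:x\in A\}\subseteq M(A)'$ with the product $\hat y\hat x=(x\ast\hat y)^{\wedge}$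 and the involution $(\hat x)^*=(S(x)^*)^{\wedge}$; the map $x\mapsto\hat x$ is bijective. **Theorem.** Let $(A,\Delta,\epsilon,S,\mu,\phi,\psi)$ be a measured multiplier $(B,\Gamma)$-Hopf $*$-algebroid. Assume that 1. for each $b\in B$ there is a $K\ge0$ with $\mu(c^*b^*bc)\le K\mu(c^*c)$ for all $c\in B$; 2. there is a family $(D_\gamma^{1/2})_{\gamma\in\Gamma}$ in $M(B)$ such that for all $\gamma,\gamma'\in\Gamma$ and $c\in B$: $D_e^{1/2}=1$, $(D_\gamma^{1/2})^*=D_\gamma^{1/2}$, $(D_\gamma^{1/2})^2=D_\gamma$, $D^{1/2}_{\gamma\gamma'}=\gamma'^{-1}(D^{1/2}_\gamma)D^{1/2}_{\gamma'}$ and $\mu(c^*D_\gamma^{1/2}c)\ge0$. Then there exist $*$-homomorphisms $\pi_\nu\colon A\to\mathcal L(H)$ and $\rho\colon\hat A\to\mathcal L(H)$ such that $$\pi_\nu(x)\Lambda_\nu(y)=\Lambda_\nu(xy)\quad\text{for all }x,y\in A,\qquad \rho(\omega)\Lambda_\nu(y)=\Lambda_\nu(y\ast\omega)\quad\text{for all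 }\omega\in\hat A,\ y\in A.$$ -/

import Mathlib

noncomputable section

namespace DynQG

open scoped TensorProduct ComplexOrder

set_option linter.unusedVariables false
set_option linter.unusedSectionVars false


section Multipliers

variable (R : Type*) [NonUnitalRing R] [Module ℂ R] [IsScalarTower ℂ R R] [SMulCommClass ℂ R R]

/-- Multipliers of the algebra `R`: pairs of a right module map `x ↦ Tx` and a left module map
`x ↦ xT` with `(xT)y = x(Ty)`; the product is `(TU)x = T(Ux)`, `x(TU) = (xT)U`. -/
def multAlg : Subalgebra ℂ (Module.End ℂ R × (Module.End ℂ R)ᵐᵒᵖ) where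
  carrier := {p | (∀ x y, p.1 (x * y) = p.1 x * y) ∧ (∀ x y, p.2.unop (x * y) = x * p.2.unop y) ∧
    ∀ x y, p.2.unop x * y = x * p.1 y}
  mul_mem' := by
    rintro p q ⟨h1, h2, h3⟩ ⟨k1, k2, k3⟩
    refine ⟨fun x y => ?_, fun x y => ?_, fun x y => ?_⟩ <;> simp [*]
  add_mem' := by
    rintro p q ⟨h1, h2, h3⟩ ⟨k1, k2, k3⟩
    refine ⟨fun x y => ?_, fun x y => ?_, fun x y => ?_⟩ <;> simp [*, add_mul, mul_add]
  algebraMap_mem' := by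
    intro z
    refine ⟨fun x y => ?_, fun x y => ?_, fun x y => ?_⟩ <;>
      simp [Prod.algebraMap_apply, Module.algebraMap_end_apply, MulOpposite.algebraMap_apply,
        smul_mul_assoc, mul_smul_comm]

/-- The multiplier algebra `M(R)`. -/
def Mult : Type _ := multAlg R

instance : Ring (Mult R) := inferInstanceAs (Ring (multAlg R))
instance : Algebra ℂ (Mult R) := inferInstanceAs (Algebra ℂ (multAlg R))

variable {R}

namespace Mult

/-- `T.lft x = Tx`. -/
def lft (T : Mult R) : R →ₗ[ℂ] R := T.1.1
/-- `T.rgt x = xT`. -/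
def rgt (T : Mult R) : R →ₗ[ℂ] R := T.1.2.unop

lemma lft_mul (T : Mult R) (x y : R) : T.lft (x * y) = T.lft x * y := T.2.1 x y
lemma rgt_mul (T : Mult R) (x y : R) : T.rgt (x * y) = x * T.rgt y := T.2.2.1 x y
lemma mid (T : Mult R) (x y : R) : T.rgt x * y = x * T.lft y := T.2.2.2 x y

@[ext] lemma ext {T U : Mult R} (h : ∀ x, T.lft x = U.lft x) (k : ∀ x, T.rgt x = U.rgt x) :
    T = U :=
  Subtype.ext (Prod.ext (LinearMap.ext h) (MulOpposite.unop_injective (LinearMap.ext k)))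

/-- Constructor for multipliers. -/
def mk (L K : R →ₗ[ℂ] R) (h1 : ∀ x y, L (x * y) = L x * y) (h2 : ∀ x y, K (x * y) = x * K y)
    (h3 : ∀ x y, K x * y = x * L y) : Mult R :=
  ⟨(L, MulOpposite.op K), h1, h2, h3⟩

@[simp] lemma lft_mk (L K : R →ₗ[ℂ] R) (h1 : ∀ x y, L (x * y) = L x * y)
    (h2 : ∀ x y, K (x * y) = x * K y) (h3 : ∀ x y, K x * y = x * L y) (x : R) :
    (mk L K h1 h2 h3).lft x = L x := rfl
@[simp] lemma rgt_mk (L K : R →ₗ[ℂ] R) (h1 : ∀ x y, L (x * y) = L x * y)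
    (h2 : ∀ x y, K (x * y) = x * K y) (h3 : ∀ x y, K x * y = x * L y) (x : R) :
    (mk L K h1 h2 h3).rgt x = K x := rfl
@[simp] lemma mul_lft (T U : Mult R) (x : R) : (T * U).lft x = T.lft (U.lft x) := rfl
@[simp] lemma mul_rgt (T U : Mult R) (x : R) : (T * U).rgt x = U.rgt (T.rgt x) := rfl
@[simp] lemma add_lft (T U : Mult R) (x : R) : (T + U).lft x = T.lft x + U.lft x := rfl
@[simp] lemma add_rgt (T U : Mult R) (x : R) : (T + U).rgt x = T.rgt x + U.rgt x := rfl
@[simp] lemma zero_lft (x : R) : (0 : Mult R).lft x = 0 := rfl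
@[simp] lemma zero_rgt (x : R) : (0 : Mult R).rgt x = 0 := rfl
@[simp] lemma one_lft (x : R) : (1 : Mult R).lft x = x := rfl
@[simp] lemma one_rgt (x : R) : (1 : Mult R).rgt x = x := rfl
@[simp] lemma smul_lft (z : ℂ) (T : Mult R) (x : R) : (z • T).lft x = z • T.lft x := rfl
@[simp] lemma smul_rgt (z : ℂ) (T : Mult R) (x : R) : (z • T).rgt x = z • T.rgt x := rfl

/-- The canonical homomorphism `R → M(R)`. -/
def of : R →ₙₐ[ℂ] Mult R where
  toFun a := mk (LinearMap.mulLeft ℂ a) (LinearMap.mulRight ℂ a) (fun x y => by simp [mul_assoc])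
    (fun x y => by simp [mul_assoc]) (fun x y => by simp [mul_assoc])
  map_smul' z a := Mult.ext (fun x => smul_mul_assoc z a x) (fun x => mul_smul_comm z x a)
  map_zero' := Mult.ext (fun x => zero_mul x) (fun x => mul_zero x)
  map_add' a b := Mult.ext (fun x => add_mul a b x) (fun x => mul_add x a b)
  map_mul' a b := Mult.ext (fun x => mul_assoc a b x) (fun x => (mul_assoc x a b).symm)

@[simp] lemma of_lft (a x : R) : (of a).lft x = a * x := rfl
@[simp] lemma of_rgt (a x : R) : (of a).rgt x = x * a := rfl

variable [StarRing R] [StarModule ℂ R]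

/-- The involution of `M(R)`: `T^* x = (x^* T)^*` and `x T^* = (T x^*)^*`. -/
instance : Star (Mult R) where
  star T := mk
    { toFun := fun x => star (T.rgt (star x))
      map_add' := fun x y => by simp
      map_smul' := fun z x => by simp [star_smul] }
    { toFun := fun x => star (T.lft (star x))
      map_add' := fun x y => by simp
      map_smul' := fun z x => by simp [star_smul] }
    (fun x y => by simp [rgt_mul]) (fun x y => by simp [lft_mul])
    (fun x y => by
      change star (T.lft (star x)) * y = x * star (T.rgt (star y))
      rw [← star_inj]; simp [mid])

@[simp] lemma star_lft (T : Mult R) (x : R) : (star T).lft x = star (T.rgt (star x)) := rfl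
@[simp] lemma star_rgt (T : Mult R) (x : R) : (star T).rgt x = star (T.lft (star x)) := rfl

instance : StarRing (Mult R) where
  star_involutive T := by ext x <;> simp
  star_mul T U := by ext x <;> simp
  star_add T U := by ext x <;> simp

end Mult

end Multipliers

section Base

variable {Γ B : Type*} [Group Γ] [NonUnitalCommRing B] [StarRing B] [Module ℂ B]
  [IsScalarTower ℂ B B] [SMulCommClass ℂ B B] [StarModule ℂ B]

/-- A commutative algebra has local units. -/
def HasLocalUnits (B : Type*) [NonUnitalCommRing B] : Prop :=
  ∀ F : Finset B, ∃ u : B, ∀ b ∈ F, u * b = b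

/-- The action of `Γ` on `M(B)` extending the action on `B`: `γ(T) b = γ(T γ⁻¹(b))`. -/
def actMult (act : Γ →* (B ≃⋆ₐ[ℂ] B)) (γ : Γ) (T : Mult B) : Mult B :=
  have hi : ∀ x, act γ ((act γ)⁻¹ x) = x := fun x => (act γ).apply_symm_apply x
  Mult.mk
    { toFun := fun b => act γ (T.lft ((act γ)⁻¹ b))
      map_add' := fun x y => by simp
      map_smul' := fun z x => by simp }
    { toFun := fun b => act γ (T.rgt ((act γ)⁻¹ b))
      map_add' := fun x y => by simp
      map_smul' := fun z x => by simp }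
    (fun x y => by
      change act γ (T.lft ((act γ)⁻¹ (x * y))) = act γ (T.lft ((act γ)⁻¹ x)) * y
      rw [map_mul, Mult.lft_mul, map_mul, hi])
    (fun x y => by
      change act γ (T.rgt ((act γ)⁻¹ (x * y))) = x * act γ (T.rgt ((act γ)⁻¹ y))
      rw [map_mul, Mult.rgt_mul, map_mul, hi])
    (fun x y => by
      change act γ (T.rgt ((act γ)⁻¹ x)) * y = x * act γ (T.lft ((act γ)⁻¹ y))
      have := congrArg (act γ) (T.mid ((act γ)⁻¹ x) ((act γ)⁻¹ y))
      simpa [hi] using this)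

end Base

section EvAlgebras

variable {Γ B : Type*} [Group Γ] [NonUnitalCommRing B] [StarRing B] [Module ℂ B]

/-- The structure of a `(B,Γ)^ev`-algebra on a `*`-algebra `A`, where `Γ` acts on the commutative
`*`-algebra `B` by `act`: a `Γ × Γ`-grading, and the restrictions `r`, `s` to `B ⊗ 1` and `1 ⊗ B` of
a `*`-homomorphism `B ⊗ B → M(A)`. As everything is compatible with the involution, left local
units give right local units. -/
structure EvAlg (act : Γ →* (B ≃⋆ₐ[ℂ] B)) (A : Type*) [NonUnitalRing A] [StarRing A] [Module ℂ A]
    [IsScalarTower ℂ A A] [SMulCommClass ℂ A A] [StarModule ℂ A] where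
  gr : Γ × Γ → Submodule ℂ A
  r : B →⋆ₙₐ[ℂ] Mult A
  s : B →⋆ₙₐ[ℂ] Mult A
  indep : iSupIndep gr
  iSup_gr : ⨆ g, gr g = ⊤
  mul_mem : ∀ {g h a b}, a ∈ gr g → b ∈ gr h → a * b ∈ gr (g * h)
  star_mem : ∀ {g a}, a ∈ gr g → star a ∈ gr g⁻¹
  units : ∀ F : Finset A, ∃ u ∈ gr 1, ∀ a ∈ F, u * a = a
  r_units : ∀ F : Finset A, ∃ b, ∀ a ∈ F, (r b).lft a = a
  s_units : ∀ F : Finset A, ∃ b, ∀ a ∈ F, (s b).lft a = a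
  r_comm_s : ∀ b b', r b * s b' = s b' * r b
  r_mem : ∀ {g a} (b : B), a ∈ gr g → (r b).lft a ∈ gr g
  s_mem : ∀ {g a} (b : B), a ∈ gr g → (s b).lft a ∈ gr g
  /-- `a r(b) = r(γ(b)) a` for `a ∈ A_{γ,γ'}` -/
  twist_r : ∀ {g a} (b : B), a ∈ gr g → (r b).rgt a = (r (act g.1 b)).lft a
  /-- `a s(b) = s(γ'(b)) a` for `a ∈ A_{γ,γ'}` -/
  twist_s : ∀ {g a} (b : B), a ∈ gr g → (s b).rgt a = (s (act g.2 b)).lft a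

variable {act : Γ →* (B ≃⋆ₐ[ℂ] B)}
variable {A : Type*} [NonUnitalRing A] [StarRing A] [Module ℂ A]
    [IsScalarTower ℂ A A] [SMulCommClass ℂ A A] [StarModule ℂ A]
variable {C : Type*} [NonUnitalRing C] [StarRing C] [Module ℂ C]
    [IsScalarTower ℂ C C] [SMulCommClass ℂ C C] [StarModule ℂ C]

namespace EvAlg

section Basic
variable (E : EvAlg act A)

lemma hinduction {p : A → Prop} (h0 : p 0) (hadd : ∀ x y, p x → p y → p (x + y))
    (hg : ∀ g, ∀ a ∈ E.gr g, p a) (a : A) : p a := by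
  have ha : a ∈ ⨆ g, E.gr g := by rw [E.iSup_gr]; trivial
  exact Submodule.iSup_induction E.gr (motive := p) ha hg h0 hadd

lemma hext {V : Type*} [AddCommGroup V] [Module ℂ V] {f f' : A →ₗ[ℂ] V}
    (h : ∀ g, ∀ a ∈ E.gr g, f a = f' a) : f = f' :=
  LinearMap.ext fun a => E.hinduction (p := fun a => f a = f' a) (by simp)
    (fun x y hx hy => by simp [hx, hy]) h a

lemma runits (F : Finset A) : ∃ u ∈ E.gr 1, ∀ a ∈ F, a * u = a := by
  classical
  obtain ⟨u, hu, h⟩ := E.units (F.image star)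
  refine ⟨star u, by simpa using E.star_mem hu, fun a ha => ?_⟩
  have := h (star a) (Finset.mem_image_of_mem _ ha)
  simpa using congrArg star this

lemma unit1 (a : A) : ∃ u ∈ E.gr 1, u * a = a := by
  obtain ⟨u, hu, h⟩ := E.units {a}
  exact ⟨u, hu, h a (by simp)⟩

lemma runit1 (a : A) : ∃ u ∈ E.gr 1, a * u = a := by
  obtain ⟨u, hu, h⟩ := E.runits {a}
  exact ⟨u, hu, h a (by simp)⟩

lemma eq_of_mul_right (E : EvAlg act A) {a a' : A} (h : ∀ y, a * y = a' * y) : a = a' := by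
  classical
  obtain ⟨u, -, hu⟩ := E.runits {a, a'}
  rw [← hu a (by simp), ← hu a' (by simp), h]

lemma eq_of_mul_left (E : EvAlg act A) {a a' : A} (h : ∀ y, y * a = y * a') : a = a' := by
  classical
  obtain ⟨u, -, hu⟩ := E.units {a, a'}
  rw [← hu a (by simp), ← hu a' (by simp), h]

lemma lft_rgt (E : EvAlg act A) (T U : Mult A) (a : A) : T.lft (U.rgt a) = U.rgt (T.lft a) :=
  E.eq_of_mul_right fun y => by
    rw [← Mult.lft_mul, U.mid, Mult.lft_mul, U.mid]

lemma r_rgt_mem {g a} (b : B) (ha : a ∈ E.gr g) : (E.r b).rgt a ∈ E.gr g := by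
  rw [E.twist_r b ha]; exact E.r_mem _ ha

lemma s_rgt_mem {g a} (b : B) (ha : a ∈ E.gr g) : (E.s b).rgt a ∈ E.gr g := by
  rw [E.twist_s b ha]; exact E.s_mem _ ha

lemma r_lft_s_lft (b b' : B) (a : A) : (E.r b).lft ((E.s b').lft a) = (E.s b').lft ((E.r b).lft a) :=
  congrArg (fun T : Mult A => T.lft a) (E.r_comm_s b b')

lemma r_rgt_s_rgt (b b' : B) (a : A) : (E.r b).rgt ((E.s b').rgt a) = (E.s b').rgt ((E.r b).rgt a) :=
  (congrArg (fun T : Mult A => T.rgt a) (E.r_comm_s b b')).symm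

lemma mul_r (a : A) {g c} (b : B) (ha : a ∈ E.gr g) :
    a * (E.r b).lft c = (E.r (act g.1 b)).lft (a * c) := by
  rw [← Mult.mid, E.twist_r b ha, Mult.lft_mul]

lemma mul_s (a : A) {g c} (b : B) (ha : a ∈ E.gr g) :
    a * (E.s b).lft c = (E.s (act g.2 b)).lft (a * c) := by
  rw [← Mult.mid, E.twist_s b ha, Mult.lft_mul]

/-- `M(A)_{γ,γ'}`: the multipliers that shift degrees by `(γ,γ')`. -/
def multGr (g : Γ × Γ) : Submodule ℂ (Mult A) where
  carrier := {T | ∀ h, ∀ a ∈ E.gr h, T.lft a ∈ E.gr (g * h) ∧ T.rgt a ∈ E.gr (h * g)}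
  add_mem' hT hU h a ha := ⟨add_mem (hT h a ha).1 (hU h a ha).1, add_mem (hT h a ha).2 (hU h a ha).2⟩
  zero_mem' h a ha := ⟨zero_mem _, zero_mem _⟩
  smul_mem' z T hT h a ha := ⟨Submodule.smul_mem _ z (hT h a ha).1, Submodule.smul_mem _ z (hT h a ha).2⟩

lemma of_mem {g a} (ha : a ∈ E.gr g) : Mult.of a ∈ E.multGr g :=
  fun _ _ hc => ⟨E.mul_mem ha hc, E.mul_mem hc ha⟩

lemma one_mem : (1 : Mult A) ∈ E.multGr 1 := fun _ _ ha => by simpa using ha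

lemma r_mem_multGr (b : B) : E.r b ∈ E.multGr 1 := fun _ _ ha => by
  simpa using ⟨E.r_mem b ha, E.r_rgt_mem b ha⟩

lemma s_mem_multGr (b : B) : E.s b ∈ E.multGr 1 := fun _ _ ha => by
  simpa using ⟨E.s_mem b ha, E.s_rgt_mem b ha⟩

lemma lft_r {g T} (hT : T ∈ E.multGr g) (b : B) (a : A) :
    T.lft ((E.r b).lft a) = (E.r (act g.1 b)).lft (T.lft a) := by
  obtain ⟨u, hu, h⟩ := E.unit1 a
  have h1 : (E.r b).lft a = u * (E.r b).lft a := by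
    rw [E.mul_r _ b hu, h]; simp
  rw [h1, Mult.lft_mul, E.mul_r _ b (hT _ _ hu).1, ← Mult.lft_mul, h, mul_one]

lemma lft_s {g T} (hT : T ∈ E.multGr g) (b : B) (a : A) :
    T.lft ((E.s b).lft a) = (E.s (act g.2 b)).lft (T.lft a) := by
  obtain ⟨u, hu, h⟩ := E.unit1 a
  have h1 : (E.s b).lft a = u * (E.s b).lft a := by
    rw [E.mul_s _ b hu, h]; simp
  rw [h1, Mult.lft_mul, E.mul_s _ b (hT _ _ hu).1, ← Mult.lft_mul, h, mul_one]

/-- `A` as the direct sum of its homogeneous components. -/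
def decomp : (DirectSum (Γ × Γ) fun g => E.gr g) ≃ₗ[ℂ] A :=
  letI := Classical.decEq (Γ × Γ)
  LinearEquiv.ofBijective (DirectSum.coeLinearMap E.gr)
    ((DirectSum.isInternal_submodule_iff_iSupIndep_and_iSup_eq_top _).2 ⟨E.indep, E.iSup_gr⟩)

/-- The linear map given by `f g` on `A_g`. -/
def glift {V : Type*} [AddCommGroup V] [Module ℂ V] (f : ∀ g, E.gr g →ₗ[ℂ] V) : A →ₗ[ℂ] V :=
  letI := Classical.decEq (Γ × Γ)
  DirectSum.toModule ℂ _ V f ∘ₗ E.decomp.symm.toLinearMap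

lemma glift_apply {V : Type*} [AddCommGroup V] [Module ℂ V] (f : ∀ g, E.gr g →ₗ[ℂ] V) {g a}
    (ha : a ∈ E.gr g) : E.glift f a = f g ⟨a, ha⟩ := by
  classical
  have : E.decomp.symm a = DirectSum.lof ℂ _ (fun g => E.gr g) g ⟨a, ha⟩ := by
    rw [LinearEquiv.symm_apply_eq]
    exact (DirectSum.coeLinearMap_lof E.gr g ⟨a, ha⟩).symm
  simp only [glift, LinearMap.comp_apply, LinearEquiv.coe_coe, this]
  exact DirectSum.toModule_lof ℂ g _

end Basic

end EvAlg

section FiberProduct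

variable (E : EvAlg act A) (F : EvAlg act C)

/-- The subalgebra `∑ A_{γ,γ'} ⊗ C_{γ',γ''}` of `A ⊗ C`. -/
def matched : NonUnitalSubalgebra ℂ (A ⊗[ℂ] C) :=
  { Submodule.span ℂ {x | ∃ g h a c, g.2 = h.1 ∧ a ∈ E.gr g ∧ c ∈ F.gr h ∧ x = a ⊗ₜ[ℂ] c} with
    mul_mem' := by
      intro x y hx hy
      change x * y ∈ Submodule.span ℂ _
      change x ∈ Submodule.span ℂ _ at hx
      change y ∈ Submodule.span ℂ _ at hy
      refine Submodule.span_induction₂ (p := fun x y _ _ => x * y ∈ Submodule.span ℂ _)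
        ?_ ?_ ?_ ?_ ?_ ?_ ?_ hx hy
      · rintro _ _ ⟨g, h, a, c, e, ha, hc, rfl⟩ ⟨g', h', a', c', e', ha', hc', rfl⟩
        exact Submodule.subset_span ⟨g * g', h * h', a * a', c * c', by simp [e, e'],
          E.mul_mem ha ha', F.mul_mem hc hc', by simp⟩
      · intro y _; simp
      · intro y _; simp
      · intro x y z _ _ _ h k; rw [add_mul]; exact add_mem h k
      · intro x y z _ _ _ h k; rw [mul_add]; exact add_mem h k
      · intro z x y _ _ h; rw [smul_mul_assoc]; exact Submodule.smul_mem _ z h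
      · intro z x y _ _ h; rw [mul_smul_comm]; exact Submodule.smul_mem _ z h }

variable {E F} in
lemma tmul_mem {g h a c} (e : g.2 = h.1) (ha : a ∈ E.gr g) (hc : c ∈ F.gr h) :
    a ⊗ₜ[ℂ] c ∈ matched E F :=
  Submodule.subset_span ⟨g, h, a, c, e, ha, hc, rfl⟩

/-- The span of the elements `s(b)a ⊗ c - a ⊗ r(b)c`; as `s(b) ⊗ 1` and `1 ⊗ r(b)` can be moved past
matched tensors, it is the ideal generated by all `s(b) ⊗ 1 - 1 ⊗ r(b)`. -/
def balIdeal : Submodule ℂ (matched E F) :=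
  Submodule.span ℂ {x | ∃ g h a c b, g.2 = h.1 ∧ a ∈ E.gr g ∧ c ∈ F.gr h ∧
    (x : A ⊗[ℂ] C) = (E.s b).lft a ⊗ₜ[ℂ] c - a ⊗ₜ[ℂ] (F.r b).lft c}

variable {E F} in
lemma matched_induction {p : matched E F → Prop} (h0 : p 0) (hadd : ∀ x y, p x → p y → p (x + y))
    (hsmul : ∀ (z : ℂ) x, p x → p (z • x))
    (ht : ∀ g h a c (e : g.2 = h.1) (ha : a ∈ E.gr g) (hc : c ∈ F.gr h),
      p ⟨a ⊗ₜ c, tmul_mem e ha hc⟩) (x : matched E F) : p x := by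
  obtain ⟨x, hx⟩ := x
  refine Submodule.span_induction (p := fun x hx => p ⟨x, hx⟩) ?_ h0 ?_ ?_ hx
  · rintro _ ⟨g, h, a, c, e, ha, hc, rfl⟩; exact ht g h a c e ha hc
  · intro x y hx hy h k; exact hadd _ _ h k
  · intro z x hx h; exact hsmul z _ h

lemma balIdeal_mul_right (x y : matched E F) (hx : x ∈ balIdeal E F) : x * y ∈ balIdeal E F := by
  revert x
  refine matched_induction (p := fun y => ∀ x, x ∈ balIdeal E F → x * y ∈ balIdeal E F)
    ?_ ?_ ?_ ?_ y
  · intro x _; simp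
  · intro y y' h h' x hx; rw [mul_add]; exact add_mem (h x hx) (h' x hx)
  · intro z y h x hx; rw [mul_smul_comm]; exact Submodule.smul_mem _ z (h x hx)
  · intro g h a c e ha hc x hx
    refine Submodule.span_induction ?_ ?_ ?_ ?_ hx
    · rintro x ⟨g', h', a', c', b, e', ha', hc', hx'⟩
      exact Submodule.subset_span ⟨g' * g, h' * h, a' * a, c' * c, b, by simp [e, e'],
        E.mul_mem ha' ha, F.mul_mem hc' hc, by
          simp [hx', sub_mul, Mult.lft_mul]⟩
    · simp
    · intro x y _ _ h k; rw [add_mul]; exact add_mem h k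
    · intro z x _ h; rw [smul_mul_assoc]; exact Submodule.smul_mem _ z h

lemma balIdeal_mul_left (x y : matched E F) (hx : x ∈ balIdeal E F) : y * x ∈ balIdeal E F := by
  revert x
  refine matched_induction (p := fun y => ∀ x, x ∈ balIdeal E F → y * x ∈ balIdeal E F)
    ?_ ?_ ?_ ?_ y
  · intro x _; simp
  · intro y y' h h' x hx; rw [add_mul]; exact add_mem (h x hx) (h' x hx)
  · intro z y h x hx; rw [smul_mul_assoc]; exact Submodule.smul_mem _ z (h x hx)
  · intro g h a c e ha hc x hx
    refine Submodule.span_induction ?_ ?_ ?_ ?_ hx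
    · rintro x ⟨g', h', a', c', b, e', ha', hc', hx'⟩
      exact Submodule.subset_span ⟨g * g', h * h', a * a', c * c', act g.2 b, by simp [e, e'],
        E.mul_mem ha ha', F.mul_mem hc hc', by
          simp [hx', mul_sub, E.mul_s _ b ha, F.mul_r _ b hc, e]⟩
    · simp
    · intro x y _ _ h k; rw [mul_add]; exact add_mem h k
    · intro z x _ h; rw [mul_smul_comm]; exact Submodule.smul_mem _ z h

/-- The fiber product `A ⊗̃ C`. -/
def FP : Type _ := matched E F ⧸ balIdeal E F

namespace FP

instance : AddCommGroup (FP E F) := inferInstanceAs (AddCommGroup (matched E F ⧸ balIdeal E F))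
instance : Module ℂ (FP E F) := inferInstanceAs (Module ℂ (matched E F ⧸ balIdeal E F))

/-- The quotient map. -/
def mkQ : matched E F →ₗ[ℂ] FP E F := (balIdeal E F).mkQ

variable {E F}

lemma mkQ_surjective : Function.Surjective (mkQ E F) := (balIdeal E F).mkQ_surjective

lemma mkQ_eq {x y : matched E F} (h : x - y ∈ balIdeal E F) : mkQ E F x = mkQ E F y :=
  (Submodule.Quotient.eq _).2 h

/-- The multiplication of `A ⊗̃ C`, induced by the one of `A ⊗ C`. -/
instance : Mul (FP E F) where
  mul := Quotient.map₂ (fun x y : matched E F => x * y) (by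
    intro x x' hx y y' hy
    have hx : x - x' ∈ balIdeal E F := (Submodule.quotientRel_def _).1 hx
    have hy : y - y' ∈ balIdeal E F := (Submodule.quotientRel_def _).1 hy
    refine (Submodule.quotientRel_def _).2 ?_
    have : x * y - x' * y' = (x - x') * y + x' * (y - y') := by
      rw [sub_mul, mul_sub]; abel
    rw [this]
    exact add_mem (balIdeal_mul_right E F _ _ hx) (balIdeal_mul_left E F _ _ hy))

lemma mkQ_mul (x y : matched E F) : mkQ E F (x * y) = mkQ E F x * mkQ E F y := rfl

instance : NonUnitalRing (FP E F) :=
  { (inferInstance : AddCommGroup (FP E F)), (inferInstance : Mul (FP E F)) with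
    left_distrib := by
      intro a b c
      obtain ⟨a, rfl⟩ := mkQ_surjective a
      obtain ⟨b, rfl⟩ := mkQ_surjective b
      obtain ⟨c, rfl⟩ := mkQ_surjective c
      rw [← map_add, ← mkQ_mul, mul_add, map_add]; rfl
    right_distrib := by
      intro a b c
      obtain ⟨a, rfl⟩ := mkQ_surjective a
      obtain ⟨b, rfl⟩ := mkQ_surjective b
      obtain ⟨c, rfl⟩ := mkQ_surjective c
      rw [← map_add, ← mkQ_mul, add_mul, map_add]; rfl
    zero_mul := by
      intro a
      obtain ⟨a, rfl⟩ := mkQ_surjective a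
      rw [← map_zero (mkQ E F), ← mkQ_mul, zero_mul]
    mul_zero := by
      intro a
      obtain ⟨a, rfl⟩ := mkQ_surjective a
      rw [← map_zero (mkQ E F), ← mkQ_mul, mul_zero]
    mul_assoc := by
      intro a b c
      obtain ⟨a, rfl⟩ := mkQ_surjective a
      obtain ⟨b, rfl⟩ := mkQ_surjective b
      obtain ⟨c, rfl⟩ := mkQ_surjective c
      rw [← mkQ_mul, ← mkQ_mul, mul_assoc]; rfl }

instance : IsScalarTower ℂ (FP E F) (FP E F) where
  smul_assoc z a b := by
    obtain ⟨a, rfl⟩ := mkQ_surjective a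
    obtain ⟨b, rfl⟩ := mkQ_surjective b
    rw [smul_eq_mul, smul_eq_mul, ← (mkQ E F).map_smul, ← mkQ_mul, smul_mul_assoc,
      (mkQ E F).map_smul, mkQ_mul]

instance : SMulCommClass ℂ (FP E F) (FP E F) where
  smul_comm z a b := by
    obtain ⟨a, rfl⟩ := mkQ_surjective a
    obtain ⟨b, rfl⟩ := mkQ_surjective b
    rw [smul_eq_mul, smul_eq_mul, ← (mkQ E F).map_smul, ← mkQ_mul, ← mkQ_mul, mul_smul_comm,
      (mkQ E F).map_smul]

variable (E F) in
lemma star_mem_matched (x : matched E F) : star (x : A ⊗[ℂ] C) ∈ matched E F := by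
  refine matched_induction (p := fun x => star (x : A ⊗[ℂ] C) ∈ matched E F) ?_ ?_ ?_ ?_ x
  · simp
  · intro x y h k; simpa using add_mem h k
  · intro z x h
    have : star ((z • x : matched E F) : A ⊗[ℂ] C) = star z • star (x : A ⊗[ℂ] C) := by
      simp [star_smul]
    rw [this]; exact Submodule.smul_mem (matched E F).toSubmodule _ h
  · intro g h a c e ha hc
    simpa using tmul_mem (by simp [e]) (E.star_mem ha) (F.star_mem hc)

/-- The involution of the matched part of `A ⊗ C`. -/
def starM (x : matched E F) : matched E F := ⟨star (x : A ⊗[ℂ] C), star_mem_matched E F x⟩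

lemma starM_add (x y : matched E F) : starM (x + y) = starM x + starM y :=
  Subtype.ext (by simp [starM])

lemma starM_smul (z : ℂ) (x : matched E F) : starM (z • x) = star z • starM x :=
  Subtype.ext (by simp [starM, star_smul])

lemma starM_starM (x : matched E F) : starM (starM x) = x := Subtype.ext (by simp [starM])

lemma starM_mul (x y : matched E F) : starM (x * y) = starM y * starM x := by
  have h : ∀ x y : A ⊗[ℂ] C, star (x * y) = star y * star x := by
    intro x y
    induction x using TensorProduct.induction_on with
    | zero => simp
    | add x x' h h' => simp [add_mul, mul_add, h, h']
    | tmul a c =>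
      induction y using TensorProduct.induction_on with
      | zero => simp
      | add y y' h h' => simp [add_mul, mul_add, h, h']
      | tmul a' c' => simp
  exact Subtype.ext (h _ _)

lemma starM_balIdeal {x : matched E F} (hx : x ∈ balIdeal E F) : starM x ∈ balIdeal E F := by
  refine Submodule.span_induction ?_ ?_ ?_ ?_ hx
  · rintro x ⟨g, h, a, c, b, e, ha, hc, hx⟩
    refine Submodule.subset_span ⟨g⁻¹, h⁻¹, star a, star c, act (g⁻¹).2 (star b), by simp [e],
      E.star_mem ha, F.star_mem hc, ?_⟩
    have h1 : star ((E.s b).lft a) = (E.s (act (g⁻¹).2 (star b))).lft (star a) := by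
      rw [← E.twist_s _ (E.star_mem ha), map_star E.s, Mult.star_rgt, star_star]
    have h2 : star ((F.r b).lft c) = (F.r (act (g⁻¹).2 (star b))).lft (star c) := by
      have : (g⁻¹).2 = (h⁻¹).1 := by simp [e]
      rw [this, ← F.twist_r _ (F.star_mem hc), map_star F.r, Mult.star_rgt, star_star]
    simp [starM, hx, h1, h2]
  · rw [show starM (0 : matched E F) = 0 from Subtype.ext (by simp [starM])]; exact zero_mem _
  · intro x y _ _ h k; rw [starM_add]; exact add_mem h k
  · intro z x _ h; rw [starM_smul]; exact Submodule.smul_mem _ _ h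

instance : Star (FP E F) where
  star := Quotient.map starM (by
    intro x x' hx
    have hx : x - x' ∈ balIdeal E F := (Submodule.quotientRel_def _).1 hx
    refine (Submodule.quotientRel_def _).2 ?_
    have := starM_balIdeal hx
    have h : starM (x - x') = starM x - starM x' := Subtype.ext (by simp [starM])
    rwa [h] at this)

lemma star_mkQ (x : matched E F) : star (mkQ E F x) = mkQ E F (starM x) := rfl

/-- The involution of `A ⊗̃ C`, induced by the one of `A ⊗ C`. -/
instance : StarRing (FP E F) where
  star_involutive x := by
    obtain ⟨x, rfl⟩ := mkQ_surjective x
    rw [star_mkQ, star_mkQ, starM_starM]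
  star_mul x y := by
    obtain ⟨x, rfl⟩ := mkQ_surjective x
    obtain ⟨y, rfl⟩ := mkQ_surjective y
    rw [← mkQ_mul, star_mkQ, starM_mul]; rfl
  star_add x y := by
    obtain ⟨x, rfl⟩ := mkQ_surjective x
    obtain ⟨y, rfl⟩ := mkQ_surjective y
    rw [← map_add, star_mkQ, starM_add, map_add]; rfl

instance : StarModule ℂ (FP E F) where
  star_smul z x := by
    obtain ⟨x, rfl⟩ := mkQ_surjective x
    rw [← (mkQ E F).map_smul, star_mkQ, starM_smul, (mkQ E F).map_smul]; rfl

variable {V : Type*} [AddCommGroup V] [Module ℂ V]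

section Lift

/-- The bilinear map on `A × C` that is `f g h` on `A_g × C_h` if `g.2 = h.1` and `0` otherwise. -/
def glift₂ (f : ∀ g h, g.2 = h.1 → E.gr g →ₗ[ℂ] F.gr h →ₗ[ℂ] V) : A →ₗ[ℂ] C →ₗ[ℂ] V :=
  letI := Classical.decEq Γ
  E.glift fun g => LinearMap.flip (F.glift fun h =>
    if e : g.2 = h.1 then (f g h e).flip else 0)

lemma glift₂_apply (f : ∀ g h, g.2 = h.1 → E.gr g →ₗ[ℂ] F.gr h →ₗ[ℂ] V) {g h a c}
    (e : g.2 = h.1) (ha : a ∈ E.gr g) (hc : c ∈ F.gr h) :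
    glift₂ f a c = f g h e ⟨a, ha⟩ ⟨c, hc⟩ := by
  simp [glift₂, E.glift_apply _ ha, F.glift_apply _ hc, e]

lemma glift₂_apply_ne (f : ∀ g h, g.2 = h.1 → E.gr g →ₗ[ℂ] F.gr h →ₗ[ℂ] V) {g h a c}
    (e : g.2 ≠ h.1) (ha : a ∈ E.gr g) (hc : c ∈ F.gr h) :
    glift₂ f a c = 0 := by
  simp [glift₂, E.glift_apply _ ha, F.glift_apply _ hc, e]

/-- The linear map on `A ⊗̃ C` given by a balanced bilinear map. -/
def lift (f : A →ₗ[ℂ] C →ₗ[ℂ] V)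
    (hf : ∀ g h a c b, g.2 = h.1 → a ∈ E.gr g → c ∈ F.gr h →
      f ((E.s b).lft a) c = f a ((F.r b).lft c)) : FP E F →ₗ[ℂ] V :=
  (balIdeal E F).liftQ (TensorProduct.lift f ∘ₗ (matched E F).toSubmodule.subtype) (by
    refine Submodule.span_le.2 ?_
    rintro x ⟨g, h, a, c, b, e, ha, hc, hx⟩
    change TensorProduct.lift f (x : A ⊗[ℂ] C) = 0
    rw [hx, map_sub, TensorProduct.lift.tmul, TensorProduct.lift.tmul, hf g h a c b e ha hc,
      sub_self])

end Lift

/-- `a ⊗̃ c` for matched homogeneous `a` and `c`, extended bilinearly by `0`. -/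
def tm : A →ₗ[ℂ] C →ₗ[ℂ] FP E F :=
  glift₂ fun g h e => LinearMap.mk₂ ℂ
    (fun a c => mkQ E F ⟨(a : A) ⊗ₜ[ℂ] (c : C), tmul_mem e a.2 c.2⟩)
    (fun a a' c => by
      rw [← map_add]; congr 1; exact Subtype.ext (TensorProduct.add_tmul _ _ _))
    (fun z a c => by
      rw [← (mkQ E F).map_smul]; congr 1)
    (fun a c c' => by
      rw [← map_add]; congr 1; exact Subtype.ext (TensorProduct.tmul_add _ _ _))
    (fun z a c => by
      rw [← (mkQ E F).map_smul]; congr 1; exact Subtype.ext (TensorProduct.tmul_smul _ _ _))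

lemma tm_apply {g h a c} (e : g.2 = h.1) (ha : a ∈ E.gr g) (hc : c ∈ F.gr h) :
    tm (E := E) (F := F) a c = mkQ E F ⟨a ⊗ₜ c, tmul_mem e ha hc⟩ := by
  rw [tm, glift₂_apply _ e ha hc]; rfl

lemma tm_apply_ne {g h a c} (e : g.2 ≠ h.1) (ha : a ∈ E.gr g) (hc : c ∈ F.gr h) :
    tm (E := E) (F := F) a c = 0 := by
  rw [tm, glift₂_apply_ne _ e ha hc]

lemma lift_tm (f : A →ₗ[ℂ] C →ₗ[ℂ] V)
    (hf : ∀ g h a c b, g.2 = h.1 → a ∈ E.gr g → c ∈ F.gr h →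
      f ((E.s b).lft a) c = f a ((F.r b).lft c)) {g h a c} (e : g.2 = h.1) (ha : a ∈ E.gr g)
    (hc : c ∈ F.gr h) : lift f hf (tm a c) = f a c := by
  rw [tm_apply e ha hc]; rfl

lemma induction {p : FP E F → Prop} (h0 : p 0) (hadd : ∀ x y, p x → p y → p (x + y))
    (ht : ∀ g h a c, g.2 = h.1 → a ∈ E.gr g → c ∈ F.gr h → p (tm a c)) (x : FP E F) : p x := by
  obtain ⟨x, rfl⟩ := mkQ_surjective x
  suffices h : ∀ z : ℂ, p (mkQ E F (z • x)) by simpa using h 1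
  refine matched_induction (p := fun x => ∀ z : ℂ, p (mkQ E F (z • x))) ?_ ?_ ?_ ?_ x
  · intro z; simpa using h0
  · intro x y h k z; rw [smul_add, map_add]; exact hadd _ _ (h z) (k z)
  · intro z x h z'; rw [smul_smul]; exact h _
  · intro g h a c e ha hc z
    have := ht g h (z • a) c e (Submodule.smul_mem _ z ha) hc
    rw [tm_apply e (Submodule.smul_mem _ z ha) hc] at this
    exact this

lemma hext {f f' : FP E F →ₗ[ℂ] V}
    (h : ∀ g h a c, g.2 = h.1 → a ∈ E.gr g → c ∈ F.gr h → f (tm a c) = f' (tm a c)) : f = f' :=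
  LinearMap.ext fun x => induction (p := fun x => f x = f' x) (by simp)
    (fun x y hx hy => by simp [hx, hy]) h x

lemma tm_mul_tm {g h g' h' a c a' c'} (e : g.2 = h.1) (ha : a ∈ E.gr g) (hc : c ∈ F.gr h)
    (e' : g'.2 = h'.1) (ha' : a' ∈ E.gr g') (hc' : c' ∈ F.gr h') :
    tm (E := E) (F := F) a c * tm a' c' = tm (a * a') (c * c') := by
  rw [tm_apply e ha hc, tm_apply e' ha' hc', tm_apply (g := g * g') (h := h * h') (by simp [e, e'])
    (E.mul_mem ha ha') (F.mul_mem hc hc'), ← mkQ_mul]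
  congr 1
  exact Subtype.ext (Algebra.TensorProduct.tmul_mul_tmul a a' c c')

lemma star_tm {g h a c} (e : g.2 = h.1) (ha : a ∈ E.gr g) (hc : c ∈ F.gr h) :
    star (tm (E := E) (F := F) a c) = tm (star a) (star c) := by
  rw [tm_apply e ha hc, tm_apply (g := g⁻¹) (h := h⁻¹) (by simp [e]) (E.star_mem ha)
    (F.star_mem hc), star_mkQ]
  congr 1

lemma tm_bal (b : B) (a : A) (c : C) :
    tm (E := E) (F := F) ((E.s b).lft a) c = tm a ((F.r b).lft c) := by
  refine E.hinduction (p := fun a => tm (E := E) (F := F) ((E.s b).lft a) c = tm a ((F.r b).lft c))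
    (by simp) (fun x y hx hy => by simp [hx, hy]) (fun g a ha => ?_) a
  refine F.hinduction (p := fun c => tm (E := E) (F := F) ((E.s b).lft a) c = tm a ((F.r b).lft c))
    (by simp) (fun x y hx hy => by simp [hx, hy]) (fun h c hc => ?_) c
  by_cases e : g.2 = h.1
  · rw [tm_apply e (E.s_mem b ha) hc, tm_apply e ha (F.r_mem b hc)]
    exact mkQ_eq (Submodule.subset_span ⟨g, h, a, c, b, e, ha, hc, rfl⟩)
  · rw [tm_apply_ne e (E.s_mem b ha) hc, tm_apply_ne e ha (F.r_mem b hc)]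

lemma tm_bal' (b : B) (a : A) (c : C) :
    tm (E := E) (F := F) ((E.s b).rgt a) c = tm a ((F.r b).rgt c) := by
  refine E.hinduction (p := fun a => tm (E := E) (F := F) ((E.s b).rgt a) c = tm a ((F.r b).rgt c))
    (by simp) (fun x y hx hy => by simp [hx, hy]) (fun g a ha => ?_) a
  refine F.hinduction (p := fun c => tm (E := E) (F := F) ((E.s b).rgt a) c = tm a ((F.r b).rgt c))
    (by simp) (fun x y hx hy => by simp [hx, hy]) (fun h c hc => ?_) c
  by_cases e : g.2 = h.1
  · rw [E.twist_s b ha, F.twist_r b hc, ← e, tm_bal]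
  · rw [tm_apply_ne e (E.s_rgt_mem b ha) hc, tm_apply_ne e ha (F.r_rgt_mem b hc)]

end FP

end FiberProduct

section FiberProductAlgebra

namespace FP

variable {E : EvAlg act A} {F : EvAlg act C}

lemma mult_ext {T U : Mult (FP E F)}
    (h : ∀ g h a c, g.2 = h.1 → a ∈ E.gr g → c ∈ F.gr h → T.lft (tm a c) = U.lft (tm a c))
    (k : ∀ g h a c, g.2 = h.1 → a ∈ E.gr g → c ∈ F.gr h → T.rgt (tm a c) = U.rgt (tm a c)) :
    T = U :=
  Mult.ext (fun x => congrArg (fun f => f x) (hext h)) (fun x => congrArg (fun f => f x) (hext k))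

/-- The multiplier `T ⊗̃ U` of `A ⊗̃ C` for `T ∈ M(A)_{α,β}` and `U ∈ M(C)_{β,γ}`, given by
`(T ⊗̃ U)(a ⊗̃ c) = Ta ⊗̃ Uc` and `(a ⊗̃ c)(T ⊗̃ U) = aT ⊗̃ cU`. -/
def tmul (T : Mult A) (U : Mult C) {g h : Γ × Γ} (e : g.2 = h.1) (hT : T ∈ E.multGr g)
    (hU : U ∈ F.multGr h) : Mult (FP E F) :=
  have hl : ∀ k l a c b, k.2 = l.1 → a ∈ E.gr k → c ∈ F.gr l →
      tm.compl₁₂ T.lft U.lft ((E.s b).lft a) c =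
        tm (E := E) (F := F).compl₁₂ T.lft U.lft a ((F.r b).lft c) := by
    intro k l a c b _ _ _
    simp only [LinearMap.compl₁₂_apply]
    rw [E.lft_s hT, F.lft_r hU, ← e, tm_bal]
  have hr : ∀ k l a c b, k.2 = l.1 → a ∈ E.gr k → c ∈ F.gr l →
      tm.compl₁₂ T.rgt U.rgt ((E.s b).lft a) c =
        tm (E := E) (F := F).compl₁₂ T.rgt U.rgt a ((F.r b).lft c) := by
    intro k l a c b _ _ _
    simp only [LinearMap.compl₁₂_apply]
    rw [← E.lft_rgt, ← F.lft_rgt, tm_bal]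
  Mult.mk (lift (tm.compl₁₂ T.lft U.lft) hl) (lift (tm.compl₁₂ T.rgt U.rgt) hr)
    (fun x y => by
      refine induction (p := fun x => lift _ hl (x * y) = lift _ hl x * y) ?_ ?_ ?_ x
      · simp
      · intro x x' h h'; rw [add_mul, map_add, map_add, add_mul, h, h']
      · intro k l a c ek ha hc
        refine induction (p := fun y => lift _ hl (tm a c * y) = lift _ hl (tm a c) * y) ?_ ?_ ?_ y
        · simp
        · intro x x' h h'; rw [mul_add, map_add, mul_add, h, h']
        · intro k' l' a' c' ek' ha' hc'
          rw [tm_mul_tm ek ha hc ek' ha' hc', lift_tm _ _ (g := k * k') (h := l * l')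
            (by simp [ek, ek']) (E.mul_mem ha ha') (F.mul_mem hc hc'), lift_tm _ _ ek ha hc]
          simp only [LinearMap.compl₁₂_apply]
          rw [tm_mul_tm (g := g * k) (h := h * l) (by simp [e, ek]) (hT _ _ ha).1 (hU _ _ hc).1
            ek' ha' hc', T.lft_mul, U.lft_mul])
    (fun x y => by
      refine induction (p := fun y => lift _ hr (x * y) = x * lift _ hr y) ?_ ?_ ?_ y
      · simp
      · intro y y' h h'; rw [mul_add, map_add, map_add, mul_add, h, h']
      · intro k l a c ek ha hc
        refine induction (p := fun x => lift _ hr (x * tm a c) = x * lift _ hr (tm a c)) ?_ ?_ ?_ x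
        · simp
        · intro x x' h h'; rw [add_mul, map_add, add_mul, h, h']
        · intro k' l' a' c' ek' ha' hc'
          rw [tm_mul_tm ek' ha' hc' ek ha hc, lift_tm _ _ (g := k' * k) (h := l' * l)
            (by simp [ek, ek']) (E.mul_mem ha' ha) (F.mul_mem hc' hc), lift_tm _ _ ek ha hc]
          simp only [LinearMap.compl₁₂_apply]
          rw [tm_mul_tm ek' ha' hc' (g' := k * g) (h' := l * h) (by simp [e, ek]) (hT _ _ ha).2
            (hU _ _ hc).2, T.rgt_mul, U.rgt_mul])
    (fun x y => by
      refine induction (p := fun x => lift _ hr x * y = x * lift _ hl y) ?_ ?_ ?_ x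
      · simp
      · intro x x' h h'; rw [add_mul, map_add, add_mul, h, h']
      · intro k l a c ek ha hc
        refine induction (p := fun y => lift _ hr (tm a c) * y = tm a c * lift _ hl y) ?_ ?_ ?_ y
        · simp
        · intro x x' h h'; rw [mul_add, map_add, mul_add, h, h']
        · intro k' l' a' c' ek' ha' hc'
          rw [lift_tm _ _ ek ha hc, lift_tm _ _ ek' ha' hc']
          simp only [LinearMap.compl₁₂_apply]
          rw [tm_mul_tm (g := k * g) (h := l * h) (by simp [e, ek]) (hT _ _ ha).2
            (hU _ _ hc).2 ek' ha' hc', tm_mul_tm ek ha hc (g' := g * k') (h' := h * l')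
            (by simp [e, ek']) (hT _ _ ha').1 (hU _ _ hc').1, T.mid, U.mid])

lemma tmul_lft {T : Mult A} {U : Mult C} {g h : Γ × Γ} (e : g.2 = h.1) (hT : T ∈ E.multGr g)
    (hU : U ∈ F.multGr h) {k l a c} (e' : k.2 = l.1) (ha : a ∈ E.gr k) (hc : c ∈ F.gr l) :
    (tmul T U e hT hU).lft (tm a c) = tm (T.lft a) (U.lft c) := by
  rw [tmul, Mult.lft_mk, lift_tm _ _ e' ha hc]; rfl

lemma tmul_rgt {T : Mult A} {U : Mult C} {g h : Γ × Γ} (e : g.2 = h.1) (hT : T ∈ E.multGr g)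
    (hU : U ∈ F.multGr h) {k l a c} (e' : k.2 = l.1) (ha : a ∈ E.gr k) (hc : c ∈ F.gr l) :
    (tmul T U e hT hU).rgt (tm a c) = tm (T.rgt a) (U.rgt c) := by
  rw [tmul, Mult.rgt_mk, lift_tm _ _ e' ha hc]; rfl

/-- `T ⊗̃ 1` for `T` of degree `e`. -/
def inlM (T : Mult A) (hT : T ∈ E.multGr 1) : Mult (FP E F) := tmul T 1 rfl hT F.one_mem
/-- `1 ⊗̃ U` for `U` of degree `e`. -/
def inrM (U : Mult C) (hU : U ∈ F.multGr 1) : Mult (FP E F) := tmul 1 U rfl E.one_mem hU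

lemma inlM_lft {T : Mult A} (hT : T ∈ E.multGr 1) {k l a c} (e' : k.2 = l.1) (ha : a ∈ E.gr k)
    (hc : c ∈ F.gr l) : (inlM T hT : Mult (FP E F)).lft (tm a c) = tm (T.lft a) c :=
  tmul_lft _ _ _ e' ha hc
lemma inlM_rgt {T : Mult A} (hT : T ∈ E.multGr 1) {k l a c} (e' : k.2 = l.1) (ha : a ∈ E.gr k)
    (hc : c ∈ F.gr l) : (inlM T hT : Mult (FP E F)).rgt (tm a c) = tm (T.rgt a) c :=
  tmul_rgt _ _ _ e' ha hc
lemma inrM_lft {U : Mult C} (hU : U ∈ F.multGr 1) {k l a c} (e' : k.2 = l.1) (ha : a ∈ E.gr k)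
    (hc : c ∈ F.gr l) : (inrM U hU : Mult (FP E F)).lft (tm a c) = tm a (U.lft c) :=
  tmul_lft _ _ _ e' ha hc
lemma inrM_rgt {U : Mult C} (hU : U ∈ F.multGr 1) {k l a c} (e' : k.2 = l.1) (ha : a ∈ E.gr k)
    (hc : c ∈ F.gr l) : (inrM U hU : Mult (FP E F)).rgt (tm a c) = tm a (U.rgt c) :=
  tmul_rgt _ _ _ e' ha hc

variable (E F)

/-- The map `r` of `A ⊗̃ C`: `r(b)(a ⊗̃ c) = r(b)a ⊗̃ c`. -/
def rHom : B →⋆ₙₐ[ℂ] Mult (FP E F) where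
  toFun b := inlM (E.r b) (E.r_mem_multGr b)
  map_smul' z b := mult_ext
    (fun g h a c e ha hc => by
      rw [Mult.smul_lft, inlM_lft _ e ha hc, inlM_lft _ e ha hc, map_smul, Mult.smul_lft]; simp)
    (fun g h a c e ha hc => by
      rw [Mult.smul_rgt, inlM_rgt _ e ha hc, inlM_rgt _ e ha hc, map_smul, Mult.smul_rgt]; simp)
  map_zero' := mult_ext
    (fun g h a c e ha hc => by rw [inlM_lft _ e ha hc]; simp)
    (fun g h a c e ha hc => by rw [inlM_rgt _ e ha hc]; simp)
  map_add' b b' := mult_ext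
    (fun g h a c e ha hc => by
      rw [Mult.add_lft, inlM_lft _ e ha hc, inlM_lft _ e ha hc, inlM_lft _ e ha hc]; simp)
    (fun g h a c e ha hc => by
      rw [Mult.add_rgt, inlM_rgt _ e ha hc, inlM_rgt _ e ha hc, inlM_rgt _ e ha hc]; simp)
  map_mul' b b' := mult_ext
    (fun g h a c e ha hc => by
      rw [Mult.mul_lft, inlM_lft _ e ha hc, inlM_lft _ e ha hc, inlM_lft _ e (E.r_mem _ ha) hc]
      simp)
    (fun g h a c e ha hc => by
      rw [Mult.mul_rgt, inlM_rgt _ e ha hc, inlM_rgt _ e ha hc, inlM_rgt _ e (E.r_rgt_mem _ ha) hc]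
      simp)
  map_star' b := mult_ext
    (fun g h a c e ha hc => by
      rw [Mult.star_lft, inlM_lft _ e ha hc, star_tm e ha hc, inlM_rgt _ (k := g⁻¹) (l := h⁻¹)
        (by simp [e]) (E.star_mem ha) (F.star_mem hc), star_tm (g := g⁻¹) (h := h⁻¹)
        (by simp [e]) (E.r_rgt_mem _ (E.star_mem ha)) (F.star_mem hc), map_star]
      simp)
    (fun g h a c e ha hc => by
      rw [Mult.star_rgt, inlM_rgt _ e ha hc, star_tm e ha hc, inlM_lft _ (k := g⁻¹) (l := h⁻¹)
        (by simp [e]) (E.star_mem ha) (F.star_mem hc), star_tm (g := g⁻¹) (h := h⁻¹)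
        (by simp [e]) (E.r_mem _ (E.star_mem ha)) (F.star_mem hc), map_star]
      simp)

/-- The map `s` of `A ⊗̃ C`: `s(b)(a ⊗̃ c) = a ⊗̃ s(b)c`. -/
def sHom : B →⋆ₙₐ[ℂ] Mult (FP E F) where
  toFun b := inrM (F.s b) (F.s_mem_multGr b)
  map_smul' z b := mult_ext
    (fun g h a c e ha hc => by
      rw [Mult.smul_lft, inrM_lft _ e ha hc, inrM_lft _ e ha hc, map_smul, Mult.smul_lft]; simp)
    (fun g h a c e ha hc => by
      rw [Mult.smul_rgt, inrM_rgt _ e ha hc, inrM_rgt _ e ha hc, map_smul, Mult.smul_rgt]; simp)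
  map_zero' := mult_ext
    (fun g h a c e ha hc => by rw [inrM_lft _ e ha hc]; simp)
    (fun g h a c e ha hc => by rw [inrM_rgt _ e ha hc]; simp)
  map_add' b b' := mult_ext
    (fun g h a c e ha hc => by
      rw [Mult.add_lft, inrM_lft _ e ha hc, inrM_lft _ e ha hc, inrM_lft _ e ha hc]; simp)
    (fun g h a c e ha hc => by
      rw [Mult.add_rgt, inrM_rgt _ e ha hc, inrM_rgt _ e ha hc, inrM_rgt _ e ha hc]; simp)
  map_mul' b b' := mult_ext
    (fun g h a c e ha hc => by
      rw [Mult.mul_lft, inrM_lft _ e ha hc, inrM_lft _ e ha hc, inrM_lft _ e ha (F.s_mem _ hc)]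
      simp)
    (fun g h a c e ha hc => by
      rw [Mult.mul_rgt, inrM_rgt _ e ha hc, inrM_rgt _ e ha hc, inrM_rgt _ e ha (F.s_rgt_mem _ hc)]
      simp)
  map_star' b := mult_ext
    (fun g h a c e ha hc => by
      rw [Mult.star_lft, inrM_lft _ e ha hc, star_tm e ha hc, inrM_rgt _ (k := g⁻¹) (l := h⁻¹)
        (by simp [e]) (E.star_mem ha) (F.star_mem hc), star_tm (g := g⁻¹) (h := h⁻¹)
        (by simp [e]) (E.star_mem ha) (F.s_rgt_mem _ (F.star_mem hc)), map_star]
      simp)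
    (fun g h a c e ha hc => by
      rw [Mult.star_rgt, inrM_rgt _ e ha hc, star_tm e ha hc, inrM_lft _ (k := g⁻¹) (l := h⁻¹)
        (by simp [e]) (E.star_mem ha) (F.star_mem hc), star_tm (g := g⁻¹) (h := h⁻¹)
        (by simp [e]) (E.star_mem ha) (F.s_mem _ (F.star_mem hc)), map_star]
      simp)

lemma rHom_lft {k l a c} (b : B) (e' : k.2 = l.1) (ha : a ∈ E.gr k) (hc : c ∈ F.gr l) :
    (rHom E F b).lft (tm a c) = tm ((E.r b).lft a) c := inlM_lft (E.r_mem_multGr b) e' ha hc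
lemma rHom_rgt {k l a c} (b : B) (e' : k.2 = l.1) (ha : a ∈ E.gr k) (hc : c ∈ F.gr l) :
    (rHom E F b).rgt (tm a c) = tm ((E.r b).rgt a) c := inlM_rgt (E.r_mem_multGr b) e' ha hc
lemma sHom_lft {k l a c} (b : B) (e' : k.2 = l.1) (ha : a ∈ E.gr k) (hc : c ∈ F.gr l) :
    (sHom E F b).lft (tm a c) = tm a ((F.s b).lft c) := inrM_lft (F.s_mem_multGr b) e' ha hc
lemma sHom_rgt {k l a c} (b : B) (e' : k.2 = l.1) (ha : a ∈ E.gr k) (hc : c ∈ F.gr l) :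
    (sHom E F b).rgt (tm a c) = tm a ((F.s b).rgt c) := inrM_rgt (F.s_mem_multGr b) e' ha hc

/-- `(A ⊗̃ C)_{γ,γ''}` is spanned by all `A_{γ,γ'} ⊗̃ C_{γ',γ''}`. -/
def grade (k : Γ × Γ) : Submodule ℂ (FP E F) :=
  Submodule.span ℂ {x | ∃ g h a c, g.2 = h.1 ∧ a ∈ E.gr g ∧ c ∈ F.gr h ∧ k = (g.1, h.2) ∧ x = tm a c}

variable {E F} in
lemma tm_mem {g h a c} (e : g.2 = h.1) (ha : a ∈ E.gr g) (hc : c ∈ F.gr h) :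
    tm a c ∈ grade E F (g.1, h.2) :=
  Submodule.subset_span ⟨g, h, a, c, e, ha, hc, rfl, rfl⟩

variable {E F} in
lemma grade_induction {k} {p : FP E F → Prop} (h0 : p 0) (hadd : ∀ x y, p x → p y → p (x + y))
    (ht : ∀ g h a c, g.2 = h.1 → a ∈ E.gr g → c ∈ F.gr h → k = (g.1, h.2) → p (tm a c))
    {x : FP E F} (hx : x ∈ grade E F k) : p x := by
  suffices h : ∀ z : ℂ, p (z • x) by simpa using h 1
  refine Submodule.span_induction (p := fun x _ => ∀ z : ℂ, p (z • x)) ?_ ?_ ?_ ?_ hx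
  · rintro _ ⟨g, h, a, c, e, ha, hc, hk, rfl⟩ z
    rw [← LinearMap.smul_apply, ← map_smul]
    exact ht g h (z • a) c e (Submodule.smul_mem _ z ha) hc hk
  · intro z; simpa using h0
  · intro x y _ _ h k z; rw [smul_add]; exact hadd _ _ (h z) (k z)
  · intro z x _ h z'; rw [smul_smul]; exact h _

lemma indep_of_proj {ι V : Type*} [AddCommGroup V] [Module ℂ V] (p : ι → Submodule ℂ V)
    (Q : ι → V →ₗ[ℂ] V) (h1 : ∀ i, ∀ x ∈ p i, Q i x = x)
    (h2 : ∀ i j, j ≠ i → ∀ x ∈ p j, Q i x = 0) : iSupIndep p := by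
  intro i
  rw [Submodule.disjoint_def]
  intro x hx hx'
  have : (⨆ j, ⨆ (_ : j ≠ i), p j) ≤ LinearMap.ker (Q i) :=
    iSup₂_le fun j hj x hx => h2 i j hj x hx
  rw [← h1 i x hx]; exact this hx'

/-- The projection onto `A_{γ,γ'} ` summed over all indices satisfying `P`. -/
def proj (G : EvAlg act A) (P : Γ × Γ → Prop) : A →ₗ[ℂ] A :=
  letI := Classical.decPred P
  G.glift fun g => if P g then (G.gr g).subtype else 0

lemma proj_of {G : EvAlg act A} {P : Γ × Γ → Prop} {g a} (ha : a ∈ G.gr g) (h : P g) :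
    proj G P a = a := by simp [proj, G.glift_apply _ ha, h]

lemma proj_of_not {G : EvAlg act A} {P : Γ × Γ → Prop} {g a} (ha : a ∈ G.gr g) (h : ¬ P g) :
    proj G P a = 0 := by simp [proj, G.glift_apply _ ha, h]

lemma grade_indep : iSupIndep (grade E F) := by
  have hb : ∀ k : Γ × Γ, ∀ g h a c b, g.2 = h.1 → a ∈ E.gr g → c ∈ F.gr h →
      tm.compl₁₂ (proj E fun g => g.1 = k.1) (proj F fun g => g.2 = k.2) ((E.s b).lft a) c =
      tm (E := E) (F := F).compl₁₂ (proj E fun g => g.1 = k.1) (proj F fun g => g.2 = k.2) a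
        ((F.r b).lft c) := by
    intro k g h a c b _ ha hc
    simp only [LinearMap.compl₁₂_apply]
    by_cases h1 : g.1 = k.1
    · by_cases h2 : h.2 = k.2
      · rw [proj_of (E.s_mem b ha) h1, proj_of ha h1, proj_of hc h2, proj_of (F.r_mem b hc) h2,
          tm_bal]
      · rw [proj_of_not (P := fun g => g.2 = k.2) hc h2,
          proj_of_not (P := fun g => g.2 = k.2) (F.r_mem b hc) h2]; simp
    · rw [proj_of_not (P := fun g => g.1 = k.1) ha h1,
        proj_of_not (P := fun g => g.1 = k.1) (E.s_mem b ha) h1]; simp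
  refine indep_of_proj _ (fun k => lift _ (hb k)) ?_ ?_
  · intro k x hx
    refine grade_induction (p := fun x => lift _ (hb k) x = x) ?_ ?_ ?_ hx
    · simp
    · intro x y hx hy; rw [map_add, hx, hy]
    · rintro g h a c e ha hc rfl
      rw [lift_tm _ _ e ha hc, LinearMap.compl₁₂_apply, proj_of (P := fun k => k.1 = g.1) ha rfl,
        proj_of (P := fun k => k.2 = h.2) hc rfl]
  · intro k l hkl x hx
    refine grade_induction (p := fun x => lift _ (hb k) x = 0) ?_ ?_ ?_ hx
    · simp
    · intro x y hx hy; rw [map_add, hx, hy, add_zero]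
    · rintro g h a c e ha hc rfl
      rw [lift_tm _ _ e ha hc, LinearMap.compl₁₂_apply]
      by_cases h1 : g.1 = k.1
      · by_cases h2 : h.2 = k.2
        · exact absurd (show (g.1, h.2) = k from Prod.ext h1 h2) hkl
        · rw [proj_of_not (P := fun g => g.2 = k.2) hc h2]; simp
      · rw [proj_of_not (P := fun g => g.1 = k.1) ha h1]; simp

variable {E F} in
lemma exists_supp (x : FP E F) : ∃ (P : Finset A) (Q : Finset C),
    (∀ u ∈ E.gr 1, (∀ a ∈ P, u * a = a) → ∀ v ∈ F.gr 1, (∀ c ∈ Q, v * c = c) → tm u v * x = x) ∧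
    (∀ b, (∀ a ∈ P, (E.r b).lft a = a) → (rHom E F b).lft x = x) ∧
    (∀ b, (∀ c ∈ Q, (F.s b).lft c = c) → (sHom E F b).lft x = x) := by
  classical
  refine induction (p := fun x => ∃ (P : Finset A) (Q : Finset C),
    (∀ u ∈ E.gr 1, (∀ a ∈ P, u * a = a) → ∀ v ∈ F.gr 1, (∀ c ∈ Q, v * c = c) → tm u v * x = x) ∧
    (∀ b, (∀ a ∈ P, (E.r b).lft a = a) → (rHom E F b).lft x = x) ∧
    (∀ b, (∀ c ∈ Q, (F.s b).lft c = c) → (sHom E F b).lft x = x)) ?_ ?_ ?_ x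
  · exact ⟨∅, ∅, by simp, by simp, by simp⟩
  · rintro x y ⟨P, Q, h1, h2, h3⟩ ⟨P', Q', k1, k2, k3⟩
    refine ⟨P ∪ P', Q ∪ Q', ?_, ?_, ?_⟩
    · intro u hu hP v hv hQ
      rw [mul_add, h1 u hu (fun a ha => hP a (Finset.mem_union_left _ ha)) v hv
        (fun a ha => hQ a (Finset.mem_union_left _ ha)),
        k1 u hu (fun a ha => hP a (Finset.mem_union_right _ ha)) v hv
        (fun a ha => hQ a (Finset.mem_union_right _ ha))]
    · intro b hP
      rw [map_add, h2 b (fun a ha => hP a (Finset.mem_union_left _ ha)),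
        k2 b (fun a ha => hP a (Finset.mem_union_right _ ha))]
    · intro b hP
      rw [map_add, h3 b (fun a ha => hP a (Finset.mem_union_left _ ha)),
        k3 b (fun a ha => hP a (Finset.mem_union_right _ ha))]
  · intro g h a c e ha hc
    refine ⟨{a}, {c}, ?_, ?_, ?_⟩
    · intro u hu hP v hv hQ
      rw [tm_mul_tm (g := 1) (h := 1) rfl hu hv e ha hc, hP a (by simp), hQ c (by simp)]
    · intro b hP
      rw [rHom_lft E F b e ha hc, hP a (by simp)]
    · intro b hP
      rw [sHom_lft E F b e ha hc, hP c (by simp)]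

/-- The `(B,Γ)^ev`-algebra structure of the fiber product. -/
def ev : EvAlg act (FP E F) where
  gr := grade E F
  r := rHom E F
  s := sHom E F
  indep := grade_indep E F
  iSup_gr := by
    rw [eq_top_iff]
    intro x _
    refine induction (p := fun x => x ∈ ⨆ g, grade E F g) ?_ ?_ ?_ x
    · exact zero_mem _
    · intro x y h k; exact add_mem h k
    · intro g h a c e ha hc
      exact Submodule.mem_iSup_of_mem (g.1, h.2) (tm_mem e ha hc)
  mul_mem := by
    intro g h x y hx hy
    refine grade_induction (p := fun x => x * y ∈ grade E F (g * h)) ?_ ?_ ?_ hx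
    · simp
    · intro x x' h k; rw [add_mul]; exact add_mem h k
    · rintro k l a c e ha hc rfl
      refine grade_induction (p := fun y => tm a c * y ∈ grade E F ((k.1, l.2) * h)) ?_ ?_ ?_ hy
      · simp
      · intro x x' h k; rw [mul_add]; exact add_mem h k
      · rintro k' l' a' c' e' ha' hc' rfl
        rw [tm_mul_tm e ha hc e' ha' hc']
        exact tm_mem (g := k * k') (h := l * l') (by simp [e, e']) (E.mul_mem ha ha')
          (F.mul_mem hc hc')
  star_mem := by
    intro g x hx
    refine grade_induction (p := fun x => star x ∈ grade E F g⁻¹) ?_ ?_ ?_ hx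
    · simp
    · intro x y h k; rw [star_add]; exact add_mem h k
    · rintro k l a c e ha hc rfl
      rw [star_tm e ha hc]
      exact tm_mem (g := k⁻¹) (h := l⁻¹) (by simp [e]) (E.star_mem ha) (F.star_mem hc)
  units := by
    classical
    intro S
    choose P Q h1 h2 h3 using exists_supp (E := E) (F := F)
    obtain ⟨u, hu, hP⟩ := E.units (S.biUnion P)
    obtain ⟨v, hv, hQ⟩ := F.units (S.biUnion Q)
    refine ⟨tm u v, tm_mem (g := 1) (h := 1) rfl hu hv, fun x hx => h1 x u hu ?_ v hv ?_⟩
    · exact fun a ha => hP a (Finset.mem_biUnion.2 ⟨x, hx, ha⟩)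
    · exact fun a ha => hQ a (Finset.mem_biUnion.2 ⟨x, hx, ha⟩)
  r_units := by
    classical
    intro S
    choose P Q h1 h2 h3 using exists_supp (E := E) (F := F)
    obtain ⟨b, hb⟩ := E.r_units (S.biUnion P)
    exact ⟨b, fun x hx => h2 x b fun a ha => hb a (Finset.mem_biUnion.2 ⟨x, hx, ha⟩)⟩
  s_units := by
    classical
    intro S
    choose P Q h1 h2 h3 using exists_supp (E := E) (F := F)
    obtain ⟨b, hb⟩ := F.s_units (S.biUnion Q)
    exact ⟨b, fun x hx => h3 x b fun a ha => hb a (Finset.mem_biUnion.2 ⟨x, hx, ha⟩)⟩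
  r_comm_s b b' := mult_ext
    (fun g h a c e ha hc => by
      rw [Mult.mul_lft, Mult.mul_lft, sHom_lft E F _ e ha hc, rHom_lft E F _ e ha hc,
        sHom_lft E F _ e (E.r_mem _ ha) hc, rHom_lft E F _ e ha (F.s_mem _ hc)])
    (fun g h a c e ha hc => by
      rw [Mult.mul_rgt, Mult.mul_rgt, sHom_rgt E F _ e ha hc, rHom_rgt E F _ e ha hc,
        sHom_rgt E F _ e (E.r_rgt_mem _ ha) hc, rHom_rgt E F _ e ha (F.s_rgt_mem _ hc)])
  r_mem := by
    intro g x b hx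
    refine grade_induction (p := fun x => (rHom E F b).lft x ∈ grade E F g) ?_ ?_ ?_ hx
    · simp
    · intro x y h k; rw [map_add]; exact add_mem h k
    · rintro k l a c e ha hc rfl
      rw [rHom_lft E F b e ha hc]; exact tm_mem e (E.r_mem b ha) hc
  s_mem := by
    intro g x b hx
    refine grade_induction (p := fun x => (sHom E F b).lft x ∈ grade E F g) ?_ ?_ ?_ hx
    · simp
    · intro x y h k; rw [map_add]; exact add_mem h k
    · rintro k l a c e ha hc rfl
      rw [sHom_lft E F b e ha hc]; exact tm_mem e ha (F.s_mem b hc)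
  twist_r := by
    intro g x b hx
    refine grade_induction
      (p := fun x => (rHom E F b).rgt x = (rHom E F (act g.1 b)).lft x) ?_ ?_ ?_ hx
    · simp
    · intro x y h k; rw [map_add, map_add, h, k]
    · rintro k l a c e ha hc rfl
      rw [rHom_lft E F _ e ha hc, rHom_rgt E F _ e ha hc, E.twist_r b ha]
  twist_s := by
    intro g x b hx
    refine grade_induction
      (p := fun x => (sHom E F b).rgt x = (sHom E F (act g.2 b)).lft x) ?_ ?_ ?_ hx
    · simp
    · intro x y h k; rw [map_add, map_add, h, k]
    · rintro k l a c e ha hc rfl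
      rw [sHom_lft E F _ e ha hc, sHom_rgt E F _ e ha hc, F.twist_s b hc]

end FP

end FiberProductAlgebra

section Morphisms

variable {A' : Type*} [NonUnitalRing A'] [StarRing A'] [Module ℂ A']
    [IsScalarTower ℂ A' A'] [SMulCommClass ℂ A' A'] [StarModule ℂ A']
variable {C' : Type*} [NonUnitalRing C'] [StarRing C'] [Module ℂ C']
    [IsScalarTower ℂ C' C'] [SMulCommClass ℂ C' C'] [StarModule ℂ C']

/-- Morphisms of `(B,Γ)^ev`-algebras: non-degenerate `B ⊗ B`-linear `*`-homomorphisms `A → M(C)` that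
preserve the grading. -/
structure EvHom (E : EvAlg act A) (F : EvAlg act C) where
  toHom : A →⋆ₙₐ[ℂ] Mult C
  span_lft : Submodule.span ℂ {x | ∃ a c, x = (toHom a).lft c} = ⊤
  span_rgt : Submodule.span ℂ {x | ∃ a c, x = (toHom a).rgt c} = ⊤
  map_r_lft : ∀ b a, toHom ((E.r b).lft a) = F.r b * toHom a
  map_r_rgt : ∀ b a, toHom ((E.r b).rgt a) = toHom a * F.r b
  map_s_lft : ∀ b a, toHom ((E.s b).lft a) = F.s b * toHom a
  map_s_rgt : ∀ b a, toHom ((E.s b).rgt a) = toHom a * F.s b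
  map_gr : ∀ {g a}, a ∈ E.gr g → toHom a ∈ F.multGr g

lemma of_lft_eq (T : Mult A) (a : A) : Mult.of (T.lft a) = T * Mult.of a :=
  Mult.ext (fun x => (T.lft_mul a x).symm) (fun x => (T.mid x a).symm)

lemma of_rgt_eq (T : Mult A) (a : A) : Mult.of (T.rgt a) = Mult.of a * T :=
  Mult.ext (fun x => T.mid a x) (fun x => (T.rgt_mul x a).symm)

/-- The identity morphism. -/
def EvHom.id (E : EvAlg act A) : EvHom E E where
  toHom := { Mult.of with
    map_star' := fun a => Mult.ext (fun x => by
      change star a * x = star (star x * a); simp) (fun x => by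
      change x * star a = star (a * star x); simp) }
  span_lft := by
    rw [eq_top_iff]; intro x _
    obtain ⟨u, -, hu⟩ := E.unit1 x
    exact Submodule.subset_span ⟨u, x, hu.symm⟩
  span_rgt := by
    rw [eq_top_iff]; intro x _
    obtain ⟨u, -, hu⟩ := E.runit1 x
    exact Submodule.subset_span ⟨u, x, hu.symm⟩
  map_r_lft b a := of_lft_eq (E.r b) a
  map_r_rgt b a := of_rgt_eq (E.r b) a
  map_s_lft b a := of_lft_eq (E.s b) a
  map_s_rgt b a := of_rgt_eq (E.s b) a
  map_gr ha := E.of_mem ha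

/-- `U` is the image of the multiplier `T` under the extension of the non-degenerate (anti-)
multiplicative map `Φ : R → M(S)` to multipliers. -/
def Extends {R S : Type*} [NonUnitalRing R] [Module ℂ R] [IsScalarTower ℂ R R]
    [SMulCommClass ℂ R R] [NonUnitalRing S] [Module ℂ S] [IsScalarTower ℂ S S]
    [SMulCommClass ℂ S S] (Φ : R → Mult S) (T : Mult R) (U : Mult S) : Prop :=
  ∀ z, U * Φ z = Φ (T.lft z) ∧ Φ z * U = Φ (T.rgt z)

namespace FP

variable {E : EvAlg act A} {F : EvAlg act C} {E' : EvAlg act A'} {F' : EvAlg act C'}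

/-- The morphism `π ⊗̃ ρ : A ⊗̃ C → M(A' ⊗̃ C')`, `a ⊗̃ c ↦ π(a) ⊗̃ ρ(c)`. -/
def map (π : EvHom E E') (ρ : EvHom F F') : FP E F →ₗ[ℂ] Mult (FP E' F') :=
  lift (glift₂ fun g h e => LinearMap.mk₂ ℂ
    (fun a c => tmul (π.toHom a) (ρ.toHom c) e (π.map_gr a.2) (ρ.map_gr c.2))
    (fun a a' c => mult_ext
      (fun k l x y e' hx hy => by
        rw [Mult.add_lft, tmul_lft _ _ _ e' hx hy, tmul_lft _ _ _ e' hx hy,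
          tmul_lft _ _ _ e' hx hy]; simp)
      (fun k l x y e' hx hy => by
        rw [Mult.add_rgt, tmul_rgt _ _ _ e' hx hy, tmul_rgt _ _ _ e' hx hy,
          tmul_rgt _ _ _ e' hx hy]; simp))
    (fun z a c => mult_ext
      (fun k l x y e' hx hy => by
        rw [Mult.smul_lft, tmul_lft _ _ _ e' hx hy, tmul_lft _ _ _ e' hx hy]; simp)
      (fun k l x y e' hx hy => by
        rw [Mult.smul_rgt, tmul_rgt _ _ _ e' hx hy, tmul_rgt _ _ _ e' hx hy]; simp))
    (fun a c c' => mult_ext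
      (fun k l x y e' hx hy => by
        rw [Mult.add_lft, tmul_lft _ _ _ e' hx hy, tmul_lft _ _ _ e' hx hy,
          tmul_lft _ _ _ e' hx hy]; simp)
      (fun k l x y e' hx hy => by
        rw [Mult.add_rgt, tmul_rgt _ _ _ e' hx hy, tmul_rgt _ _ _ e' hx hy,
          tmul_rgt _ _ _ e' hx hy]; simp))
    (fun z a c => mult_ext
      (fun k l x y e' hx hy => by
        rw [Mult.smul_lft, tmul_lft _ _ _ e' hx hy, tmul_lft _ _ _ e' hx hy]; simp)
      (fun k l x y e' hx hy => by
        rw [Mult.smul_rgt, tmul_rgt _ _ _ e' hx hy, tmul_rgt _ _ _ e' hx hy]; simp)))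
    (by
      intro g h a c b e ha hc
      rw [glift₂_apply _ e (E.s_mem b ha) hc, glift₂_apply _ e ha (F.r_mem b hc)]
      refine mult_ext (fun k l x y e' hx hy => ?_) (fun k l x y e' hx hy => ?_)
      · simp only [LinearMap.mk₂_apply]
        rw [tmul_lft _ _ _ e' hx hy, tmul_lft _ _ _ e' hx hy, π.map_s_lft, ρ.map_r_lft,
          Mult.mul_lft, Mult.mul_lft, tm_bal]
      · simp only [LinearMap.mk₂_apply]
        rw [tmul_rgt _ _ _ e' hx hy, tmul_rgt _ _ _ e' hx hy, π.map_s_lft, ρ.map_r_lft,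
          Mult.mul_rgt, Mult.mul_rgt, E'.twist_s b hx, F'.twist_r b hy]
        rw [← E'.lft_rgt, ← F'.lft_rgt, ← e', tm_bal])

variable {D : Type*} [NonUnitalRing D] [StarRing D] [Module ℂ D]
    [IsScalarTower ℂ D D] [SMulCommClass ℂ D D] [StarModule ℂ D] {G : EvAlg act D}

/-- The bilinear map `(a ⊗̃ c, d) ↦ a ⊗̃ (c ⊗̃ d)`. -/
def assocAux : FP E F →ₗ[ℂ] D →ₗ[ℂ] FP E (ev F G) :=
  lift (LinearMap.mk₂ ℂ (fun (a : A) (c : C) =>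
      (tm (E := E) (F := ev F G) a) ∘ₗ (tm (E := F) (F := G) c))
      (fun a a' c => by ext d; simp) (fun z a c => by ext d; simp)
      (fun a c c' => by ext d; simp) (fun z a c => by ext d; simp))
    (by
      intro g h a c b e ha hc
      refine G.hext fun k d hd => ?_
      simp only [LinearMap.mk₂_apply, LinearMap.comp_apply]
      rw [tm_bal]
      by_cases ek : h.2 = k.1
      · rw [show ((ev F G).r b).lft (tm c d) = tm ((F.r b).lft c) d from rHom_lft F G b ek hc hd]
      · rw [tm_apply_ne ek hc hd, tm_apply_ne ek (F.r_mem b hc) hd]; simp)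

lemma assocAux_tm {k l a c} (e : k.2 = l.1) (ha : a ∈ E.gr k) (hc : c ∈ F.gr l) (d : D) :
    assocAux (G := G) (tm (E := E) (F := F) a c) d = tm a (tm c d) := by
  rw [assocAux, lift_tm _ _ e ha hc]; rfl

/-- The associativity isomorphism `(a ⊗̃ c) ⊗̃ d ↦ a ⊗̃ (c ⊗̃ d)`. -/
def assoc : FP (ev E F) G →ₗ[ℂ] FP E (ev F G) :=
  lift assocAux (by
    intro g h x d b e hx hd
    refine grade_induction (k := g) (p := fun x => assocAux (((ev E F).s b).lft x) d =
      assocAux (G := G) x ((G.r b).lft d)) ?_ ?_ ?_ hx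
    · simp
    · intro x y hx hy; simp [hx, hy]
    · rintro k l a c ek ha hc rfl
      rw [show ((ev E F).s b).lft (tm a c) = tm a ((F.s b).lft c) from sHom_lft E F b ek ha hc,
        assocAux_tm ek ha (F.s_mem b hc), assocAux_tm ek ha hc, tm_bal])

end FP

/-- A comultiplication on `A`. -/
structure Comul (E : EvAlg act A) extends EvHom E (FP.ev E E) where
  /-- all `Δ(a)(x ⊗ 1)` and `(x ⊗ 1)Δ(a)` with `x ∈ A_{γ,e}` lie in `A ⊗̃ A` -/
  mul_inl : ∀ a γ x (hx : x ∈ E.gr (γ, 1)), ∃ w, Mult.of w = toHom a *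
    FP.tmul (Mult.of x) 1 (h := 1) rfl (E.of_mem hx) E.one_mem
  inl_mul : ∀ a γ x (hx : x ∈ E.gr (γ, 1)), ∃ w, Mult.of w =
    FP.tmul (Mult.of x) 1 (h := 1) rfl (E.of_mem hx) E.one_mem * toHom a
  /-- all `Δ(a)(1 ⊗ y)` and `(1 ⊗ y)Δ(a)` with `y ∈ A_{e,γ}` lie in `A ⊗̃ A` -/
  mul_inr : ∀ a γ y (hy : y ∈ E.gr (1, γ)), ∃ w, Mult.of w = toHom a *
    FP.tmul 1 (Mult.of y) (g := 1) rfl E.one_mem (E.of_mem hy)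
  inr_mul : ∀ a γ y (hy : y ∈ E.gr (1, γ)), ∃ w, Mult.of w =
    FP.tmul 1 (Mult.of y) (g := 1) rfl E.one_mem (E.of_mem hy) * toHom a
  /-- `(Δ ⊗̃ id)(Δ(a)) = (id ⊗̃ Δ)(Δ(a))` up to the associativity isomorphism -/
  coassoc : ∀ a, ∃ (U : Mult (FP (FP.ev E E) E)) (V : Mult (FP E (FP.ev E E))),
    Extends (FP.map toEvHom (EvHom.id E)) (toHom a) U ∧
    Extends (FP.map (EvHom.id E) toEvHom) (toHom a) V ∧
    ∀ w, FP.assoc (U.lft w) = V.lft (FP.assoc w) ∧ FP.assoc (U.rgt w) = V.rgt (FP.assoc w)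

end Morphisms

section Balanced

namespace EvAlg

variable (E : EvAlg act A)

/-- The bilinear map `(b, a) ↦ r(b)a`. -/
def rL : B →ₗ[ℂ] A →ₗ[ℂ] A := LinearMap.mk₂ ℂ (fun b a => (E.r b).lft a)
  (fun b b' a => by simp) (fun z b a => by simp) (fun b a a' => by simp) (fun z b a => by simp)
/-- The bilinear map `(b, a) ↦ a r(b)`. -/
def rR : B →ₗ[ℂ] A →ₗ[ℂ] A := LinearMap.mk₂ ℂ (fun b a => (E.r b).rgt a)
  (fun b b' a => by simp) (fun z b a => by simp) (fun b a a' => by simp) (fun z b a => by simp)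
/-- The bilinear map `(b, a) ↦ s(b)a`. -/
def sL : B →ₗ[ℂ] A →ₗ[ℂ] A := LinearMap.mk₂ ℂ (fun b a => (E.s b).lft a)
  (fun b b' a => by simp) (fun z b a => by simp) (fun b a a' => by simp) (fun z b a => by simp)
/-- The bilinear map `(b, a) ↦ a s(b)`. -/
def sR : B →ₗ[ℂ] A →ₗ[ℂ] A := LinearMap.mk₂ ℂ (fun b a => (E.s b).rgt a)
  (fun b b' a => by simp) (fun z b a => by simp) (fun b a a' => by simp) (fun z b a => by simp)

@[simp] lemma rL_apply (b : B) (a : A) : E.rL b a = (E.r b).lft a := rfl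
@[simp] lemma rR_apply (b : B) (a : A) : E.rR b a = (E.r b).rgt a := rfl
@[simp] lemma sL_apply (b : B) (a : A) : E.sL b a = (E.s b).lft a := rfl
@[simp] lemma sR_apply (b : B) (a : A) : E.sR b a = (E.s b).rgt a := rfl

/-- The relations `s(b)a ⊗ c = a ⊗ r(b)c`. -/
def lrel : Submodule ℂ (A ⊗[ℂ] A) :=
  Submodule.span ℂ {x | ∃ a c b, x = (E.s b).lft a ⊗ₜ[ℂ] c - a ⊗ₜ[ℂ] (E.r b).lft c}

/-- The relations `a s(b) ⊗ c = a ⊗ c r(b)`. -/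
def rrel : Submodule ℂ (A ⊗[ℂ] A) :=
  Submodule.span ℂ {x | ∃ a c b, x = (E.s b).rgt a ⊗ₜ[ℂ] c - a ⊗ₜ[ℂ] (E.r b).rgt c}

/-- The balanced tensor product `_sA ⊗_B _rA`. -/
abbrev LBal : Type _ := (A ⊗[ℂ] A) ⧸ E.lrel

/-- The balanced tensor product `A_s ⊗_B A_r`. -/
abbrev RBal : Type _ := (A ⊗[ℂ] A) ⧸ E.rrel

/-- Linear maps on `_sA ⊗_B _rA` from balanced bilinear maps. -/
def liftL {V : Type*} [AddCommGroup V] [Module ℂ V] (f : A →ₗ[ℂ] A →ₗ[ℂ] V)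
    (hf : ∀ a c b, f ((E.s b).lft a) c = f a ((E.r b).lft c)) : E.LBal →ₗ[ℂ] V :=
  E.lrel.liftQ (TensorProduct.lift f) (by
    refine Submodule.span_le.2 ?_
    rintro x ⟨a, c, b, rfl⟩
    change TensorProduct.lift f _ = 0
    rw [map_sub, TensorProduct.lift.tmul, TensorProduct.lift.tmul, hf, sub_self])

/-- Linear maps on `A_s ⊗_B A_r` from balanced bilinear maps. -/
def liftR {V : Type*} [AddCommGroup V] [Module ℂ V] (f : A →ₗ[ℂ] A →ₗ[ℂ] V)
    (hf : ∀ a c b, f ((E.s b).rgt a) c = f a ((E.r b).rgt c)) : E.RBal →ₗ[ℂ] V :=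
  E.rrel.liftQ (TensorProduct.lift f) (by
    refine Submodule.span_le.2 ?_
    rintro x ⟨a, c, b, rfl⟩
    change TensorProduct.lift f _ = 0
    rw [map_sub, TensorProduct.lift.tmul, TensorProduct.lift.tmul, hf, sub_self])

/-- The class of `a ⊗ c` in `_sA ⊗_B _rA`. -/
def tmL : A →ₗ[ℂ] A →ₗ[ℂ] E.LBal := (TensorProduct.mk ℂ A A).compr₂ E.lrel.mkQ

/-- The class of `a ⊗ c` in `A_s ⊗_B A_r`. -/
def tmR : A →ₗ[ℂ] A →ₗ[ℂ] E.RBal := (TensorProduct.mk ℂ A A).compr₂ E.rrel.mkQ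

lemma tmL_bal (a c : A) (b : B) : E.tmL ((E.s b).lft a) c = E.tmL a ((E.r b).lft c) :=
  (Submodule.Quotient.eq _).2 (Submodule.subset_span ⟨a, c, b, rfl⟩)

lemma tmR_bal (a c : A) (b : B) : E.tmR ((E.s b).rgt a) c = E.tmR a ((E.r b).rgt c) :=
  (Submodule.Quotient.eq _).2 (Submodule.subset_span ⟨a, c, b, rfl⟩)

/-- The canonical map `A ⊗̃ A → _sA ⊗_B _rA`. -/
def toL : FP E E →ₗ[ℂ] E.LBal := FP.lift E.tmL fun _ _ a c b _ _ _ => E.tmL_bal a c b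

/-- The canonical map `A ⊗̃ A → A_s ⊗_B A_r`. -/
def toR : FP E E →ₗ[ℂ] E.RBal := FP.lift E.tmR fun g h a c b e ha hc => by
  have h1 : ∀ a, act g.2 (act (g.2)⁻¹ a) = a := fun a => by
    rw [map_inv]; exact (act g.2).apply_symm_apply a
  have h2 := E.twist_s (act (g.2)⁻¹ b) ha
  have h3 := E.twist_r (act (g.2)⁻¹ b) hc
  rw [← e, h1] at h3
  rw [h1] at h2
  rw [← h2, ← h3, E.tmR_bal]

/-- `(u ⊗ v)(x ⊗ 1) = ux ⊗ v` on `_sA ⊗_B _rA`. -/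
def mulFst (x : A) : E.LBal →ₗ[ℂ] E.LBal :=
  E.liftL (E.tmL ∘ₗ LinearMap.mulRight ℂ x) fun a c b => by
    simp only [LinearMap.comp_apply, LinearMap.mulRight_apply]
    rw [← Mult.lft_mul, tmL_bal]

/-- `(u ⊗ v)(1 ⊗ y) = u ⊗ vy` on `_sA ⊗_B _rA`. -/
def mulSnd (y : A) : E.LBal →ₗ[ℂ] E.LBal :=
  E.liftL (E.tmL.compl₂ (LinearMap.mulRight ℂ y)) fun a c b => by
    simp only [LinearMap.compl₂_apply, LinearMap.mulRight_apply]
    rw [← Mult.lft_mul, tmL_bal]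

/-- `(x ⊗ 1)(u ⊗ v) = xu ⊗ v` on `A_s ⊗_B A_r`. -/
def fstMul (x : A) : E.RBal →ₗ[ℂ] E.RBal :=
  E.liftR (E.tmR ∘ₗ LinearMap.mulLeft ℂ x) fun a c b => by
    simp only [LinearMap.comp_apply, LinearMap.mulLeft_apply]
    rw [← Mult.rgt_mul, tmR_bal]

/-- `(1 ⊗ y)(u ⊗ v) = u ⊗ yv` on `A_s ⊗_B A_r`. -/
def sndMul (y : A) : E.RBal →ₗ[ℂ] E.RBal :=
  E.liftR (E.tmR.compl₂ (LinearMap.mulLeft ℂ y)) fun a c b => by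
    simp only [LinearMap.compl₂_apply, LinearMap.mulLeft_apply]
    rw [← Mult.rgt_mul, tmR_bal]

/-- A left unit for `y` in `A_{e,e}`. -/
def lunit (y : A) : A := Classical.choose (E.unit1 y)
/-- A right unit for `x` in `A_{e,e}`. -/
def runit (x : A) : A := Classical.choose (E.runit1 x)

lemma lunit_mem (y : A) : E.lunit y ∈ E.gr 1 := (Classical.choose_spec (E.unit1 y)).1
lemma runit_mem (x : A) : E.runit x ∈ E.gr 1 := (Classical.choose_spec (E.runit1 x)).1
lemma lunit_mul (y : A) : E.lunit y * y = y := (Classical.choose_spec (E.unit1 y)).2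
lemma mul_runit (x : A) : x * E.runit x = x := (Classical.choose_spec (E.runit1 x)).2

end EvAlg

/-- The element of `R` that is equal to the given multiplier (if there is one). -/
def Mult.elt {R : Type*} [NonUnitalRing R] [Module ℂ R] [IsScalarTower ℂ R R]
    [SMulCommClass ℂ R R] (T : Mult R) : R := Function.invFun (Mult.of (R := R)) T

namespace Comul

variable {E : EvAlg act A} (Δ : Comul E)

/-- `Δ(a)(x ⊗ 1)` as an element of `_sA ⊗_B _rA`: for any `u ∈ A_{e,e}` with `ux = x`, the product
`Δ(a)(u ⊗ 1)` lies in `A ⊗̃ A`, and is multiplied with `x ⊗ 1` on the right. -/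
def mulInl (a x : A) : E.LBal := E.mulFst x (E.toL (Mult.elt
  (Δ.toHom a * FP.inlM (Mult.of (E.lunit x)) (E.of_mem (E.lunit_mem x)))))

/-- `Δ(a)(1 ⊗ y)` as an element of `_sA ⊗_B _rA`; this is `T₁(a ⊗ y)`. -/
def mulInr (a y : A) : E.LBal := E.mulSnd y (E.toL (Mult.elt
  (Δ.toHom a * FP.inrM (Mult.of (E.lunit y)) (E.of_mem (E.lunit_mem y)))))

/-- `(x ⊗ 1)Δ(a)` as an element of `A_s ⊗_B A_r`; this is `T₂(x ⊗ a)`. -/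
def inlMul (x a : A) : E.RBal := E.fstMul x (E.toR (Mult.elt
  (FP.inlM (Mult.of (E.runit x)) (E.of_mem (E.runit_mem x)) * Δ.toHom a)))

/-- `(1 ⊗ y)Δ(a)` as an element of `A_s ⊗_B A_r`. -/
def inrMul (y a : A) : E.RBal := E.sndMul y (E.toR (Mult.elt
  (FP.inrM (Mult.of (E.runit y)) (E.of_mem (E.runit_mem y)) * Δ.toHom a)))

end Comul

end Balanced

section Counit

/-- The product `bγ · b'γ' = b γ(b') γγ'` of the crossed product `B ⋊ Γ = ⨁ Bγ`. -/
def crossedMul (act : Γ →* (B ≃⋆ₐ[ℂ] B)) (f g : Γ →₀ B) : Γ →₀ B :=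
  f.sum fun γ b => g.sum fun γ' b' => Finsupp.single (γ * γ') (b * act γ b')

/-- The involution `(bγ)^* = γ⁻¹ b^* = γ⁻¹(b^*) γ⁻¹` of the crossed product. -/
def crossedStar (act : Γ →* (B ≃⋆ₐ[ℂ] B)) (f : Γ →₀ B) : Γ →₀ B :=
  f.sum fun γ b => Finsupp.single γ⁻¹ (act γ⁻¹ (star b))

/-- Morphisms of `(B,Γ)^ev`-algebras from `A` into the crossed product `B ⋊ Γ` which map `A` into
`B ⋊ Γ` (rather than into its multipliers). Here `b(b'γ) = bb'γ`, `(b'γ)b = b'γ(b)γ` for `r(b)` and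
`s(b)` alike, and `B ⋊ Γ` is graded by `(B ⋊ Γ)_{γ,γ} = Bγ`. -/
structure CrossedHom (E : EvAlg act A) where
  toFun : A →ₗ[ℂ] Γ →₀ B
  map_mul : ∀ a a', toFun (a * a') = crossedMul act (toFun a) (toFun a')
  map_star : ∀ a, toFun (star a) = crossedStar act (toFun a)
  span_lft : Submodule.span ℂ {x | ∃ a f, x = crossedMul act (toFun a) f} = ⊤
  span_rgt : Submodule.span ℂ {x | ∃ a f, x = crossedMul act f (toFun a)} = ⊤
  map_r_lft : ∀ b a γ, toFun ((E.r b).lft a) γ = b * toFun a γ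
  map_r_rgt : ∀ b a γ, toFun ((E.r b).rgt a) γ = toFun a γ * act γ b
  map_s_lft : ∀ b a γ, toFun ((E.s b).lft a) γ = b * toFun a γ
  map_s_rgt : ∀ b a γ, toFun ((E.s b).rgt a) γ = toFun a γ * act γ b
  map_gr : ∀ {g a}, a ∈ E.gr g → ∀ γ, g ≠ (γ, γ) → toFun a γ = 0

namespace CrossedHom

variable {E : EvAlg act A} (ε : CrossedHom E)

/-- `ε^♯`, where `♯(∑ b_γ γ) = ∑ b_γ`. -/
def sharp : A →ₗ[ℂ] B := (Finsupp.lsum ℂ fun _ => LinearMap.id) ∘ₗ ε.toFun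

/-- `ε^♭`, where `♭(∑ γ b_γ) = ∑ b_γ`, so that `♭(bγ) = γ⁻¹(b)`. -/
def flat (a : A) : B := (ε.toFun a).sum fun γ b => act γ⁻¹ b

lemma sharp_apply (a : A) : ε.sharp a = (ε.toFun a).sum fun _ b => b := rfl

lemma sharp_r (b : B) (a : A) : ε.sharp ((E.r b).lft a) = b * ε.sharp a := by
  have : ε.toFun ((E.r b).lft a) = (ε.toFun a).mapRange (b * ·) (mul_zero b) :=
    Finsupp.ext fun γ => by simp [ε.map_r_lft]
  rw [sharp_apply, sharp_apply, this, Finsupp.sum_mapRange_index (fun _ => rfl), Finsupp.mul_sum]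

lemma sharp_s (b : B) (a : A) : ε.sharp ((E.s b).lft a) = b * ε.sharp a := by
  have : ε.toFun ((E.s b).lft a) = (ε.toFun a).mapRange (b * ·) (mul_zero b) :=
    Finsupp.ext fun γ => by simp [ε.map_s_lft]
  rw [sharp_apply, sharp_apply, this, Finsupp.sum_mapRange_index (fun _ => rfl), Finsupp.mul_sum]

/-- `ε ⊗̃ id : A ⊗̃ A → (B ⋊ Γ) ⊗̃ A ≅ A`, where the isomorphism is `bγ ⊗̃ a ↦ r(b)a`. -/
def epsId : FP E E →ₗ[ℂ] A := FP.lift (E.rL ∘ₗ ε.sharp) fun _ _ a c b _ _ _ => by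
  simp only [LinearMap.comp_apply, EvAlg.rL_apply, sharp_s]
  rw [mul_comm, _root_.map_mul, Mult.mul_lft]

/-- `id ⊗̃ ε : A ⊗̃ A → A ⊗̃ (B ⋊ Γ) ≅ A`, where the isomorphism is `a ⊗̃ bγ ↦ s(b)a`. -/
def idEps : FP E E →ₗ[ℂ] A := FP.lift (E.sL ∘ₗ ε.sharp).flip fun _ _ a c b _ _ _ => by
  simp only [LinearMap.flip_apply, LinearMap.comp_apply, EvAlg.sL_apply, sharp_r]
  rw [mul_comm, _root_.map_mul, Mult.mul_lft]

end CrossedHom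

/-- `ε` is a counit: `(ε ⊗̃ id) ∘ Δ = id = (id ⊗̃ ε) ∘ Δ`. -/
structure IsCounit {E : EvAlg act A} (Δ : Comul E) (ε : CrossedHom E) : Prop where
  epsId : ∀ a, Extends (fun z => Mult.of (ε.epsId z)) (Δ.toHom a) (Mult.of a)
  idEps : ∀ a, Extends (fun z => Mult.of (ε.idEps z)) (Δ.toHom a) (Mult.of a)

end Counit

section Antipode

/-- Isomorphisms `S : A → A^{co,op}`, that is, antimultiplicative bijections with
`S(A_{γ,γ'}) ⊆ A_{γ'⁻¹,γ⁻¹}` that exchange left multiplication by `r(b)` and right multiplication by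
`s(b)` etc. -/
structure AntiIso (E : EvAlg act A) where
  toEquiv : A ≃ₗ[ℂ] A
  map_mul : ∀ a a', toEquiv (a * a') = toEquiv a' * toEquiv a
  map_gr : ∀ {γ γ' a}, a ∈ E.gr (γ, γ') → toEquiv a ∈ E.gr (γ'⁻¹, γ⁻¹)
  map_r_lft : ∀ b a, toEquiv ((E.r b).lft a) = (E.s b).rgt (toEquiv a)
  map_r_rgt : ∀ b a, toEquiv ((E.r b).rgt a) = (E.s b).lft (toEquiv a)
  map_s_lft : ∀ b a, toEquiv ((E.s b).lft a) = (E.r b).rgt (toEquiv a)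
  map_s_rgt : ∀ b a, toEquiv ((E.s b).rgt a) = (E.r b).lft (toEquiv a)

namespace AntiIso

variable {E : EvAlg act A} (S : AntiIso E)

/-- `x ⊗̃ y ↦ S(y) ⊗̃ S(x)`. -/
def flipMap : FP E E →ₗ[ℂ] FP E E :=
  FP.lift (LinearMap.mk₂ ℂ (fun x y => FP.tm (E := E) (F := E) (S.toEquiv y) (S.toEquiv x))
    (fun x x' y => by simp) (fun z x y => by simp) (fun x y y' => by simp) (fun z x y => by simp))
    fun g h a c b e ha hc => by
      simp only [LinearMap.mk₂_apply]
      rw [S.map_s_lft, S.map_r_lft, FP.tm_bal']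

/-- `m ∘ (S ⊗ id) : _sA ⊗_B _rA → A`, `x ⊗ y ↦ S(x)y`. -/
def mulS_id : E.LBal →ₗ[ℂ] A :=
  E.liftL (LinearMap.mul ℂ A ∘ₗ S.toEquiv.toLinearMap) fun a c b => by
    simp only [LinearMap.comp_apply, LinearEquiv.coe_coe, LinearMap.mul_apply']
    rw [S.map_s_lft, Mult.mid]

/-- `m ∘ (id ⊗ S) : A_s ⊗_B A_r → A`, `x ⊗ y ↦ xS(y)`. -/
def mul_idS : E.RBal →ₗ[ℂ] A :=
  E.liftR ((LinearMap.mul ℂ A).compl₂ S.toEquiv.toLinearMap) fun a c b => by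
    simp only [LinearMap.compl₂_apply, LinearEquiv.coe_coe, LinearMap.mul_apply']
    rw [S.map_r_rgt, Mult.mid]

end AntiIso

/-- `S` is an antipode: `∑ S(x₁)x₂y = s(ε^♭(x))y`, `∑ xy₁S(y₂) = x r(ε^♯(y))`, and
`∑ S(x₂) ⊗̃ S(x₁) = Δ(S(x))`. -/
structure IsAntipode {E : EvAlg act A} (Δ : Comul E) (ε : CrossedHom E) (S : AntiIso E) : Prop where
  left : ∀ x y, S.mulS_id (Δ.mulInr x y) = (E.s (ε.flat x)).lft y
  right : ∀ x y, S.mul_idS (Δ.inlMul x y) = (E.r (ε.sharp y)).rgt x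
  comul : ∀ x z, S.flipMap ((Δ.toHom x).lft z) = (Δ.toHom (S.toEquiv x)).rgt (S.flipMap z) ∧
    S.flipMap ((Δ.toHom x).rgt z) = (Δ.toHom (S.toEquiv x)).lft (S.flipMap z)

end Antipode

section Integrals

/-- Morphisms of `(B,Γ)`-modules `(A,r) → B`, where `B` is trivially graded. -/
structure RModHom (E : EvAlg act A) where
  toFun : A →ₗ[ℂ] B
  map_lft : ∀ b a, toFun ((E.r b).lft a) = b * toFun a
  map_rgt : ∀ b a, toFun ((E.r b).rgt a) = toFun a * b
  map_gr : ∀ {g a}, a ∈ E.gr g → g.1 ≠ 1 → toFun a = 0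

/-- Morphisms of `(B,Γ)`-modules `(A,s) → B`, where `B` is trivially graded. -/
structure SModHom (E : EvAlg act A) where
  toFun : A →ₗ[ℂ] B
  map_lft : ∀ b a, toFun ((E.s b).lft a) = b * toFun a
  map_rgt : ∀ b a, toFun ((E.s b).rgt a) = toFun a * b
  map_gr : ∀ {g a}, a ∈ E.gr g → g.2 ≠ 1 → toFun a = 0

variable {E : EvAlg act A}

/-- `id ⊗ φ : _sA ⊗_B _rA → A`, `x ⊗ y ↦ s(φ(y))x`. -/
def RModHom.sliceL (φ : RModHom E) : E.LBal →ₗ[ℂ] A :=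
  E.liftL (E.sL ∘ₗ φ.toFun).flip fun a c b => by
    simp only [LinearMap.flip_apply, LinearMap.comp_apply, EvAlg.sL_apply]
    rw [φ.map_lft, mul_comm, map_mul, Mult.mul_lft]

/-- `id ⊗ φ : A_s ⊗_B A_r → A`, `x ⊗ y ↦ x s(φ(y))`. -/
def RModHom.sliceR (φ : RModHom E) : E.RBal →ₗ[ℂ] A :=
  E.liftR (E.sR ∘ₗ φ.toFun).flip fun a c b => by
    simp only [LinearMap.flip_apply, LinearMap.comp_apply, EvAlg.sR_apply]
    rw [φ.map_rgt, mul_comm, map_mul, Mult.mul_rgt]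

/-- `ψ ⊗ id : _sA ⊗_B _rA → A`, `x ⊗ y ↦ r(ψ(x))y`. -/
def SModHom.sliceL (ψ : SModHom E) : E.LBal →ₗ[ℂ] A :=
  E.liftL (E.rL ∘ₗ ψ.toFun) fun a c b => by
    simp only [LinearMap.comp_apply, EvAlg.rL_apply]
    rw [ψ.map_lft, mul_comm, map_mul, Mult.mul_lft]

/-- `ψ ⊗ id : A_s ⊗_B A_r → A`, `x ⊗ y ↦ y r(ψ(x))`. -/
def SModHom.sliceR (ψ : SModHom E) : E.RBal →ₗ[ℂ] A :=
  E.liftR (E.rR ∘ₗ ψ.toFun) fun a c b => by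
    simp only [LinearMap.comp_apply, EvAlg.rR_apply]
    rw [ψ.map_rgt, mul_comm, map_mul, Mult.mul_rgt]

/-- `φ` is a left integral: `(id ⊗̃ φ)(Δ(x)) = r(φ(x))` as multipliers of `A`. -/
def IsLeftIntegral (Δ : Comul E) (φ : RModHom E) : Prop :=
  ∀ x a, φ.sliceL (Δ.mulInl x a) = (E.r (φ.toFun x)).lft a ∧
    φ.sliceR (Δ.inlMul a x) = (E.r (φ.toFun x)).rgt a

/-- `ψ` is a right integral: `(ψ ⊗̃ id)(Δ(x)) = s(ψ(x))` as multipliers of `A`. -/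
def IsRightIntegral (Δ : Comul E) (ψ : SModHom E) : Prop :=
  ∀ x a, ψ.sliceL (Δ.mulInr x a) = (E.s (ψ.toFun x)).lft a ∧
    ψ.sliceR (Δ.inrMul a x) = (E.s (ψ.toFun x)).rgt a

end Integrals

section GNS

/-- A positive functional is hermitian (this needs no unit). -/
lemma herm_of_pos (ω : A →ₗ[ℂ] ℂ) (h : ∀ a, 0 ≤ ω (star a * a)) (x y : A) :
    star (ω (star y * x)) = ω (star x * y) := by
  have im0 : ∀ a, (ω (star a * a)).im = 0 := fun a => ((Complex.nonneg_iff.1 (h a)).2).symm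
  have h1 := im0 (x + y)
  have h2 := im0 (x + Complex.I • y)
  simp only [star_add, star_smul, add_mul, mul_add, map_add, smul_mul_assoc, mul_smul_comm, map_smul,
    Complex.add_im, im0, smul_eq_mul, Complex.mul_im, Complex.star_def, Complex.conj_I,
    Complex.neg_re, Complex.neg_im, Complex.I_re, Complex.I_im, Complex.mul_re] at h1 h2
  apply Complex.ext
  · simp only [Complex.star_def, Complex.conj_re]; linarith
  · simp only [Complex.star_def, Complex.conj_im]; linarith

/-- `A` with the inner product `⟨x|y⟩ = ω(x^* y)` of a positive functional `ω`. -/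
def PreGNS (ω : A →ₗ[ℂ] ℂ) (h : ∀ a, 0 ≤ ω (star a * a)) : Type _ := A

variable (ω : A →ₗ[ℂ] ℂ) (h : ∀ a, 0 ≤ ω (star a * a))

instance : AddCommGroup (PreGNS ω h) := inferInstanceAs (AddCommGroup A)
instance : Module ℂ (PreGNS ω h) := inferInstanceAs (Module ℂ A)

/-- The identity map of `A`. -/
def toPreGNS : A ≃ₗ[ℂ] PreGNS ω h := LinearEquiv.refl ℂ A

/-- The inner product `⟨x|y⟩ = ω(x^* y)`. -/
abbrev preGNSCore : PreInnerProductSpace.Core ℂ (PreGNS ω h) where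
  inner x y := ω (star ((toPreGNS ω h).symm x) * (toPreGNS ω h).symm y)
  conj_inner_symm x y := herm_of_pos ω h _ _
  re_inner_nonneg x := (Complex.nonneg_iff.1 (h ((toPreGNS ω h).symm x))).1
  add_left x y z := by rw [map_add, star_add, add_mul, map_add]
  smul_left x y z := by
    rw [map_smul, star_smul, smul_mul_assoc, map_smul]; rfl

instance : SeminormedAddCommGroup (PreGNS ω h) :=
  InnerProductSpace.Core.toSeminormedAddCommGroup (c := preGNSCore ω h)
instance : InnerProductSpace ℂ (PreGNS ω h) := InnerProductSpace.ofCore (preGNSCore ω h)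

/-- The (separated) Hilbert space completion. -/
abbrev GNS : Type _ := UniformSpace.Completion (PreGNS ω h)

/-- The canonical map `A → H`. -/
def GNS.lam : A →ₗ[ℂ] GNS ω h :=
  (UniformSpace.Completion.toComplL : PreGNS ω h →L[ℂ] GNS ω h).toLinearMap ∘ₗ
    (toPreGNS ω h).toLinearMap

lemma GNS.inner_lam (x y : A) : inner ℂ (GNS.lam ω h x) (GNS.lam ω h y) = ω (star x * y) :=
  UniformSpace.Completion.inner_coe _ _

end GNS

section Measured

variable [IsScalarTower ℂ B B] [SMulCommClass ℂ B B] [StarModule ℂ B]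

/-- Weights for `(B,Γ)`: faithful positive linear functionals `μ` on `B` such that for each `γ`
there exists some `D ∈ M(B)` with `μ(γ(bD)) = μ(b)` for all `b`. -/
structure Weight (act : Γ →* (B ≃⋆ₐ[ℂ] B)) where
  toFun : B →ₗ[ℂ] ℂ
  faithful : ∀ c, (∀ b, toFun (b * c) = 0) → c = 0
  nonneg : ∀ c, 0 ≤ toFun (star c * c)
  quasi : ∀ γ, ∃ D : Mult B, ∀ b, toFun (act γ (D.rgt b)) = toFun b

/-- The multiplier `D_γ` with `μ(γ(bD_γ)) = μ(b)` (it is unique as `μ` is faithful). -/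
def Weight.D (μ : Weight act) (γ : Γ) : Mult B := Classical.choose (μ.quasi γ)

lemma Weight.D_spec (μ : Weight act) (γ : Γ) (b : B) :
    μ.toFun (act γ ((μ.D γ).rgt b)) = μ.toFun b := Classical.choose_spec (μ.quasi γ) b

/-- Left multiplication by elements of `B` is bounded with respect to `⟨b|c⟩ = μ(b^* c)`. -/
def Weight.IsBounded (μ : Weight act) : Prop :=
  ∀ b : B, ∃ K : ℝ, 0 ≤ K ∧
    ∀ c : B, μ.toFun (star c * star b * b * c) ≤ (K : ℂ) * μ.toFun (star c * c)

/-- `(D_γ)` has a positive square root that is again a cocycle. -/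
def Weight.HasModularRoot (μ : Weight act) : Prop :=
  ∃ R : Γ → Mult B, R 1 = 1 ∧ (∀ γ, star (R γ) = R γ) ∧ (∀ γ, R γ * R γ = μ.D γ) ∧
    (∀ γ γ', R (γ * γ') = actMult act γ'⁻¹ (R γ) * R γ') ∧
    ∀ γ c, 0 ≤ μ.toFun (star c * (R γ).lft c)

/-- Measured multiplier `(B,Γ)`-Hopf `*`-algebroids. -/
structure MeasuredHopf (E : EvAlg act A) where
  Δ : Comul E
  ε : CrossedHom E
  S : AntiIso E
  φ : RModHom E
  ψ : SModHom E
  μ : Weight act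
  counit : IsCounit Δ ε
  antipode : IsAntipode Δ ε S
  left_integral : IsLeftIntegral Δ φ
  right_integral : IsRightIntegral Δ ψ
  φ_surjective : Function.Surjective φ.toFun
  ψ_surjective : Function.Surjective ψ.toFun
  coincide : μ.toFun ∘ₗ φ.toFun = μ.toFun ∘ₗ ψ.toFun
  faithful : ∀ a, (∀ x, μ.toFun (φ.toFun (x * a)) = 0) → a = 0
  nonneg : ∀ a, 0 ≤ μ.toFun (φ.toFun (star a * a))

namespace MeasuredHopf

variable {E : EvAlg act A} (𝒢 : MeasuredHopf E)

/-- `ν = μ ∘ φ = μ ∘ ψ`. -/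
def nu : A →ₗ[ℂ] ℂ := 𝒢.μ.toFun ∘ₗ 𝒢.φ.toFun

lemma nu_nonneg (a : A) : 0 ≤ 𝒢.nu (star a * a) := 𝒢.nonneg a

/-- The Hilbert space `H` obtained from `A` with the inner product `⟨x|y⟩ = ν(x^* y)`. -/
abbrev H : Type _ := GNS 𝒢.nu 𝒢.nu_nonneg

/-- The canonical map `Λ_ν : A → H`. -/
def Lam : A →ₗ[ℂ] 𝒢.H := GNS.lam 𝒢.nu 𝒢.nu_nonneg

/-- `x ↦ ν(x-) ∈ M(A)'`. -/
def nuMul : A →ₗ[ℂ] Module.Dual ℂ (Mult A) :=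
  LinearMap.mk₂ ℂ (fun x T => 𝒢.nu (T.rgt x)) (fun x x' T => by simp) (fun z x T => by simp)
    (fun x T U => by simp) (fun z x T => by simp)

@[simp] lemma nuMul_apply (x : A) (T : Mult A) : 𝒢.nuMul x T = 𝒢.nu (T.rgt x) := rfl

lemma nuMul_injective : Function.Injective 𝒢.nuMul := by
  rw [← LinearMap.ker_eq_bot, LinearMap.ker_eq_bot']
  intro x hx
  refine star_eq_zero.1 (𝒢.faithful (star x) fun y => ?_)
  have h1 : 𝒢.nu (x * star y) = 0 := LinearMap.congr_fun hx (Mult.of (star y))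
  have h2 := herm_of_pos 𝒢.nu 𝒢.nonneg (star y) (star x)
  rw [star_star, h1, star_zero, star_star] at h2
  exact h2.symm

/-- `Â = {ν(x-) : x ∈ A} ⊆ M(A)'`. -/
def Dual : Type _ := LinearMap.range 𝒢.nuMul

instance : AddCommGroup 𝒢.Dual := inferInstanceAs (AddCommGroup (LinearMap.range 𝒢.nuMul))
instance : Module ℂ 𝒢.Dual := inferInstanceAs (Module ℂ (LinearMap.range 𝒢.nuMul))

/-- The Fourier transform `x ↦ x̂ = ν(S(x)-)`, which is bijective. -/
def fourier : A ≃ₗ[ℂ] 𝒢.Dual :=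
  𝒢.S.toEquiv.trans (LinearEquiv.ofInjective 𝒢.nuMul 𝒢.nuMul_injective)

/-- `a ∗ x̂ = ∑ a₂ r(ψ(S(x)a₁))`. -/
def convHat (a x : A) : A := 𝒢.ψ.sliceR (𝒢.Δ.inlMul (𝒢.S.toEquiv x) a)

/-- The right convolution `a ∗ ω` for `ω ∈ Â`. -/
def conv (a : A) (ω : 𝒢.Dual) : A := 𝒢.convHat a (𝒢.fourier.symm ω)

/-- `ŷx̂ = (x ∗ ŷ)^`. -/
instance : Mul 𝒢.Dual := ⟨fun ω υ => 𝒢.fourier (𝒢.conv (𝒢.fourier.symm υ) ω)⟩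

/-- `(x̂)^* = (S(x)^*)^`. -/
instance : Star 𝒢.Dual := ⟨fun ω => 𝒢.fourier (star (𝒢.S.toEquiv (𝒢.fourier.symm ω)))⟩

end MeasuredHopf

end Measured

end EvAlgebras

end DynQG

end

noncomputable section

namespace DynQG

open scoped TensorProduct ComplexOrder

set_option linter.unusedSectionVars false


/-! ### Elements among multipliers, partial tensors u ⊗̃ 1 and 1 ⊗̃ u, and the balanced tensor
products. -/

section Elements

variable {Γ B : Type*} [Group Γ] [NonUnitalCommRing B] [StarRing B] [Module ℂ B]
variable {act : Γ →* (B ≃⋆ₐ[ℂ] B)}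
variable {A : Type*} [NonUnitalRing A] [StarRing A] [Module ℂ A]
    [IsScalarTower ℂ A A] [SMulCommClass ℂ A A] [StarModule ℂ A]
variable {E : EvAlg act A}

/-! Everything is expressed through four slices of the comultiplication: `phiR c b` = ∑ b₁ s(φ(c
b₂)), `phiL a b` = ∑ s(φ(a₂ b)) a₁, `psiR w t` = ∑ t₂ r(ψ(w t₁)) and `psiL w t` = ∑ r(ψ(w₁ t)) w₂.
Convolution is one of them: y ∗ x̂ = `psiR (S x) y`.

The algebraic half shows that convolution is multiplicative and compatible with the involution.
Coassociativity, the antipode and counit axioms and left invariance give strong invariance S(`phiL a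
b`) = `phiR a b` (`S_phiL`). Comparison with right invariance yields φ ∘ S = ψ and ψ ∘ S = φ
(`phi_S`, `psi_S`), so that ν ∘ S = ν and S(`psiR w t`) = `psiL w t` (`S_psiR`). The slices span A
(`span_psiR`), so S(S(x)^*) = x^* need only be checked on slices (`S_star_S`). Evaluating (ψ ⊗ φ)((w
⊗ c)Δ(b)) in two ways (`nu_mul_phiR`) then gives the adjoint of a convolution operator
(`nu_star_mul_psiR`); as slices in the first and in the last leg commute, it also gives the product
rule (`psiR_psiR`).

The analytic half shows that left multiplication and convolution are bounded. By the first
assumption B acts on L²(μ) by commuting bounded operators, and the Schur product of commuting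
positive operator matrices is positive (`schur_nonneg`). The roots of D_γ show that the action of Γ
preserves positive matrices over B. Hence x ⊗ q ↦ μ(δ(φ(q))ψ(x)) is positive on A ⊗ A for every δ ∈
Γ (`nuTensor_nonneg`). The Cauchy-Schwarz inequality for the vectors e ⊗ c and Δ(b)(a ⊗ 1), where
left invariance evaluates the square of the second one, is `norm_nu_phiR_sq_le`: for a of degree g,
|ν(e^* `phiR (c^*) b` a)|² ≤ μ(g₂⁻¹(φ(c^*c)) ψ(e^*e)) · μ(g₁⁻¹(φ(b^*b)) φ(a^*a)). Here the elements
γ(φ(c^*c)) and γ(φ(b^*b)) can be replaced by constants that do not depend on γ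
(`exists_twist_bound`).

For left multiplication take e = `phiR (c^*) b` a: the estimate bounds ‖e‖ by a multiple of ‖a‖,
uniformly in the degree of a. Components of different degree are orthogonal and the slices span A,
so left multiplication by each element is bounded. For convolution put e = `psiR w y`; then ν(e^*e)
= ν(w `phiR (e^*) y`), and a factor a on the right is missing. If uw = w, a modular partner b of u,
that is ν(u t) = ν(t b) for all t (`exists_nu_mul_comm`), supplies it, and the same inequality
applies with a = b. -/

lemma EvAlg.of_injective (E : EvAlg act A) : Function.Injective (Mult.of : A → Mult A) :=
  fun _ _ h => E.eq_of_mul_right fun y => congrArg (fun T : Mult A => T.lft y) h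

lemma EvAlg.of_elt (E : EvAlg act A) {T : Mult A} (h : ∃ w, Mult.of w = T) :
    Mult.of T.elt = T := Function.invFun_eq h

lemma EvAlg.mem_of_of_mem_multGr (E : EvAlg act A) {g : Γ × Γ} {w : A}
    (h : Mult.of w ∈ E.multGr g) : w ∈ E.gr g := by
  obtain ⟨u, hu, hw⟩ := E.runit1 w
  have := (h 1 u hu).1
  rwa [Mult.of_lft, hw, mul_one] at this

/-- Makes the degree of products such as Δ(a)(u ⊗ 1) computable: with u of degree e it is the degree
of a. -/
lemma EvAlg.multGr_mul (E : EvAlg act A) {g h : Γ × Γ} {T U : Mult A} (hT : T ∈ E.multGr g)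
    (hU : U ∈ E.multGr h) : T * U ∈ E.multGr (g * h) := fun k a ha =>
  ⟨by rw [mul_assoc]; exact (hT _ _ (hU k a ha).1).1,
    by rw [← mul_assoc]; exact (hU _ _ (hT k a ha).2).2⟩

lemma act_act_inv (γ : Γ) (b : B) : act γ (act γ⁻¹ b) = b := by
  rw [map_inv]; exact (act γ).apply_symm_apply b

lemma act_one_apply (b : B) : act 1 b = b := by rw [_root_.map_one]; rfl

namespace FP

lemma inlM_mul {u v : A} (hu : u ∈ E.gr 1) (hv : v ∈ E.gr 1) :
    (inlM (Mult.of u) (E.of_mem hu) : Mult (FP E E)) * inlM (Mult.of v) (E.of_mem hv) =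
      inlM (Mult.of (u * v)) (E.of_mem (by simpa using E.mul_mem hu hv)) := by
  refine mult_ext (fun k l a c e ha hc => ?_) fun k l a c e ha hc => ?_
  · have h1 : v * a ∈ E.gr k := by simpa using E.mul_mem hv ha
    rw [Mult.mul_lft, inlM_lft _ e ha hc, inlM_lft _ e ha hc, Mult.of_lft, inlM_lft _ e h1 hc,
      Mult.of_lft, Mult.of_lft, mul_assoc]
  · have h1 : a * u ∈ E.gr k := by simpa using E.mul_mem ha hu
    rw [Mult.mul_rgt, inlM_rgt _ e ha hc, inlM_rgt _ e ha hc, Mult.of_rgt, inlM_rgt _ e h1 hc,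
      Mult.of_rgt, Mult.of_rgt, mul_assoc]

lemma inrM_mul {u v : A} (hu : u ∈ E.gr 1) (hv : v ∈ E.gr 1) :
    (inrM (Mult.of u) (E.of_mem hu) : Mult (FP E E)) * inrM (Mult.of v) (E.of_mem hv) =
      inrM (Mult.of (u * v)) (E.of_mem (by simpa using E.mul_mem hu hv)) := by
  refine mult_ext (fun k l a c e ha hc => ?_) fun k l a c e ha hc => ?_
  · have h1 : v * c ∈ E.gr l := by simpa using E.mul_mem hv hc
    rw [Mult.mul_lft, inrM_lft _ e ha hc, inrM_lft _ e ha hc, Mult.of_lft, inrM_lft _ e ha h1,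
      Mult.of_lft, Mult.of_lft, mul_assoc]
  · have h1 : c * u ∈ E.gr l := by simpa using E.mul_mem hc hu
    rw [Mult.mul_rgt, inrM_rgt _ e ha hc, inrM_rgt _ e ha hc, Mult.of_rgt, inrM_rgt _ e ha h1,
      Mult.of_rgt, Mult.of_rgt, mul_assoc]

lemma inlM_mul_inrM {u v : A} (hu : u ∈ E.gr 1) (hv : v ∈ E.gr 1) :
    (inlM (Mult.of u) (E.of_mem hu) : Mult (FP E E)) * inrM (Mult.of v) (E.of_mem hv) =
      Mult.of (tm u v) := by
  refine mult_ext (fun k l a c e ha hc => ?_) fun k l a c e ha hc => ?_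
  · have h1 : v * c ∈ E.gr l := by simpa using E.mul_mem hv hc
    rw [Mult.mul_lft, inrM_lft _ e ha hc, Mult.of_lft, inlM_lft _ e ha h1, Mult.of_lft,
      Mult.of_lft, tm_mul_tm (g := 1) (h := 1) rfl hu hv e ha hc]
  · have h1 : a * u ∈ E.gr k := by simpa using E.mul_mem ha hu
    rw [Mult.mul_rgt, inlM_rgt _ e ha hc, Mult.of_rgt, inrM_rgt _ e h1 hc, Mult.of_rgt,
      Mult.of_rgt, tm_mul_tm e ha hc (g' := 1) (h' := 1) rfl hu hv]

/-- The partial tensors commute, so that the cut-offs (u ⊗ 1)Δ(a) and (1 ⊗ v)Δ(a) have the common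
refinement (u ⊗ v)Δ(a). -/
lemma inrM_mul_inlM {u v : A} (hu : u ∈ E.gr 1) (hv : v ∈ E.gr 1) :
    (inrM (Mult.of v) (E.of_mem hv) : Mult (FP E E)) * inlM (Mult.of u) (E.of_mem hu) =
      Mult.of (tm u v) := by
  rw [← inlM_mul_inrM hu hv]
  refine mult_ext (fun k l a c e ha hc => ?_) fun k l a c e ha hc => ?_
  · have h1 : v * c ∈ E.gr l := by simpa using E.mul_mem hv hc
    have h2 : u * a ∈ E.gr k := by simpa using E.mul_mem hu ha
    rw [Mult.mul_lft, inlM_lft _ e ha hc, Mult.mul_lft, inrM_lft _ e ha hc, Mult.of_lft,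
      Mult.of_lft, inlM_lft _ e ha h1, inrM_lft _ e h2 hc, Mult.of_lft, Mult.of_lft]
  · have h1 : c * v ∈ E.gr l := by simpa using E.mul_mem hc hv
    have h2 : a * u ∈ E.gr k := by simpa using E.mul_mem ha hu
    rw [Mult.mul_rgt, inrM_rgt _ e ha hc, Mult.mul_rgt, inlM_rgt _ e ha hc, Mult.of_rgt,
      Mult.of_rgt, inrM_rgt _ e h2 hc, inlM_rgt _ e ha h1, Mult.of_rgt, Mult.of_rgt]

lemma star_inlM {u : A} (hu : u ∈ E.gr 1) :
    star (inlM (Mult.of u) (E.of_mem hu) : Mult (FP E E)) =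
      inlM (Mult.of (star u)) (E.of_mem (by simpa using E.star_mem hu)) := by
  refine mult_ext (fun k l a c e ha hc => ?_) fun k l a c e ha hc => ?_
  · have h1 : star a * u ∈ E.gr k⁻¹ := by simpa using E.mul_mem (E.star_mem ha) hu
    have h2 : k⁻¹.2 = l⁻¹.1 := by simp [e]
    rw [Mult.star_lft, star_tm e ha hc, inlM_rgt _ h2 (E.star_mem ha) (E.star_mem hc),
      Mult.of_rgt, star_tm h2 h1 (E.star_mem hc), inlM_lft _ e ha hc]
    simp
  · have h1 : u * star a ∈ E.gr k⁻¹ := by simpa using E.mul_mem hu (E.star_mem ha)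
    have h2 : k⁻¹.2 = l⁻¹.1 := by simp [e]
    rw [Mult.star_rgt, star_tm e ha hc, inlM_lft _ h2 (E.star_mem ha) (E.star_mem hc),
      Mult.of_lft, star_tm h2 h1 (E.star_mem hc), inlM_rgt _ e ha hc]
    simp

lemma star_inrM {u : A} (hu : u ∈ E.gr 1) :
    star (inrM (Mult.of u) (E.of_mem hu) : Mult (FP E E)) =
      inrM (Mult.of (star u)) (E.of_mem (by simpa using E.star_mem hu)) := by
  refine mult_ext (fun k l a c e ha hc => ?_) fun k l a c e ha hc => ?_
  · have h1 : star c * u ∈ E.gr l⁻¹ := by simpa using E.mul_mem (E.star_mem hc) hu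
    have h2 : k⁻¹.2 = l⁻¹.1 := by simp [e]
    rw [Mult.star_lft, star_tm e ha hc, inrM_rgt _ h2 (E.star_mem ha) (E.star_mem hc),
      Mult.of_rgt, star_tm h2 (E.star_mem ha) h1, inrM_lft _ e ha hc]
    simp
  · have h1 : u * star c ∈ E.gr l⁻¹ := by simpa using E.mul_mem hu (E.star_mem hc)
    have h2 : k⁻¹.2 = l⁻¹.1 := by simp [e]
    rw [Mult.star_rgt, star_tm e ha hc, inrM_lft _ h2 (E.star_mem ha) (E.star_mem hc),
      Mult.of_lft, star_tm h2 (E.star_mem ha) h1, inrM_rgt _ e ha hc]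
    simp

lemma of_star (w : FP E E) : Mult.of (star w) = star (Mult.of w) :=
  Mult.ext (fun x => by simp) fun x => by simp

lemma inlM_mem {u : A} (hu : u ∈ E.gr 1) :
    (inlM (Mult.of u) (E.of_mem hu) : Mult (FP E E)) ∈ (ev E E).multGr 1 := by
  intro k x hx
  refine grade_induction (p := fun x => _ ∈ grade E E (1 * k) ∧ _ ∈ grade E E (k * 1)) ?_ ?_ ?_ hx
  · simp
  · intro x y hx hy; simp only [map_add]; exact ⟨add_mem hx.1 hy.1, add_mem hx.2 hy.2⟩
  · rintro g h a c e ha hc rfl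
    rw [inlM_lft _ e ha hc, inlM_rgt _ e ha hc, one_mul, mul_one]
    exact ⟨tm_mem e (by simpa using E.mul_mem hu ha) hc, tm_mem e (by simpa using E.mul_mem ha hu) hc⟩

lemma inrM_mem {u : A} (hu : u ∈ E.gr 1) :
    (inrM (Mult.of u) (E.of_mem hu) : Mult (FP E E)) ∈ (ev E E).multGr 1 := by
  intro k x hx
  refine grade_induction (p := fun x => _ ∈ grade E E (1 * k) ∧ _ ∈ grade E E (k * 1)) ?_ ?_ ?_ hx
  · simp
  · intro x y hx hy; simp only [map_add]; exact ⟨add_mem hx.1 hy.1, add_mem hx.2 hy.2⟩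
  · rintro g h a c e ha hc rfl
    rw [inrM_lft _ e ha hc, inrM_rgt _ e ha hc, one_mul, mul_one]
    exact ⟨tm_mem e ha (by simpa using E.mul_mem hu hc), tm_mem e ha (by simpa using E.mul_mem hc hu)⟩

end FP

namespace EvAlg

lemma toL_tm {g h : Γ × Γ} {a c : A} (e : g.2 = h.1) (ha : a ∈ E.gr g) (hc : c ∈ E.gr h) :
    E.toL (FP.tm a c) = E.tmL a c := FP.lift_tm _ _ e ha hc

lemma toR_tm {g h : Γ × Γ} {a c : A} (e : g.2 = h.1) (ha : a ∈ E.gr g) (hc : c ∈ E.gr h) :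
    E.toR (FP.tm a c) = E.tmR a c := FP.lift_tm _ _ e ha hc

lemma mulFst_tmL (x a c : A) : E.mulFst x (E.tmL a c) = E.tmL (a * x) c := rfl
lemma mulSnd_tmL (y a c : A) : E.mulSnd y (E.tmL a c) = E.tmL a (c * y) := rfl
lemma fstMul_tmR (x a c : A) : E.fstMul x (E.tmR a c) = E.tmR (x * a) c := rfl
lemma sndMul_tmR (y a c : A) : E.sndMul y (E.tmR a c) = E.tmR a (y * c) := rfl

lemma LBal_hext {V : Type*} [AddCommGroup V] [Module ℂ V] {f f' : E.LBal →ₗ[ℂ] V}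
    (h : ∀ a c, f (E.tmL a c) = f' (E.tmL a c)) : f = f' :=
  Submodule.linearMap_qext _ (TensorProduct.ext' h)

lemma RBal_hext {V : Type*} [AddCommGroup V] [Module ℂ V] {f f' : E.RBal →ₗ[ℂ] V}
    (h : ∀ a c, f (E.tmR a c) = f' (E.tmR a c)) : f = f' :=
  Submodule.linearMap_qext _ (TensorProduct.ext' h)

lemma mulFst_mulFst (x y : A) (T : E.LBal) :
    E.mulFst y (E.mulFst x T) = E.mulFst (x * y) T :=
  LinearMap.congr_fun (f := E.mulFst y ∘ₗ E.mulFst x)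
    (LBal_hext fun a c => by simp only [LinearMap.comp_apply, mulFst_tmL, mul_assoc]) T

lemma mulSnd_mulSnd (x y : A) (T : E.LBal) :
    E.mulSnd y (E.mulSnd x T) = E.mulSnd (x * y) T :=
  LinearMap.congr_fun (f := E.mulSnd y ∘ₗ E.mulSnd x)
    (LBal_hext fun a c => by simp only [LinearMap.comp_apply, mulSnd_tmL, mul_assoc]) T

lemma fstMul_fstMul (x y : A) (T : E.RBal) :
    E.fstMul x (E.fstMul y T) = E.fstMul (x * y) T :=
  LinearMap.congr_fun (f := E.fstMul x ∘ₗ E.fstMul y)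
    (RBal_hext fun a c => by simp only [LinearMap.comp_apply, fstMul_tmR, mul_assoc]) T

lemma sndMul_sndMul (x y : A) (T : E.RBal) :
    E.sndMul x (E.sndMul y T) = E.sndMul (x * y) T :=
  LinearMap.congr_fun (f := E.sndMul x ∘ₗ E.sndMul y)
    (RBal_hext fun a c => by simp only [LinearMap.comp_apply, sndMul_tmR, mul_assoc]) T

lemma mulFst_add (x y : A) (T : E.LBal) : E.mulFst (x + y) T = E.mulFst x T + E.mulFst y T :=
  LinearMap.congr_fun (f := E.mulFst (x + y)) (g := E.mulFst x + E.mulFst y)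
    (LBal_hext fun a c => by simp only [LinearMap.add_apply, mulFst_tmL, mul_add, map_add]) T

lemma mulSnd_add (x y : A) (T : E.LBal) : E.mulSnd (x + y) T = E.mulSnd x T + E.mulSnd y T :=
  LinearMap.congr_fun (f := E.mulSnd (x + y)) (g := E.mulSnd x + E.mulSnd y)
    (LBal_hext fun a c => by simp only [LinearMap.add_apply, mulSnd_tmL, mul_add, map_add]) T

lemma fstMul_add (x y : A) (T : E.RBal) : E.fstMul (x + y) T = E.fstMul x T + E.fstMul y T :=
  LinearMap.congr_fun (f := E.fstMul (x + y)) (g := E.fstMul x + E.fstMul y)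
    (RBal_hext fun a c => by simp only [LinearMap.add_apply, fstMul_tmR, add_mul, map_add]) T

lemma sndMul_add (x y : A) (T : E.RBal) : E.sndMul (x + y) T = E.sndMul x T + E.sndMul y T :=
  LinearMap.congr_fun (f := E.sndMul (x + y)) (g := E.sndMul x + E.sndMul y)
    (RBal_hext fun a c => by simp only [LinearMap.add_apply, sndMul_tmR, add_mul, map_add]) T

lemma mulFst_smul (z : ℂ) (x : A) (T : E.LBal) : E.mulFst (z • x) T = z • E.mulFst x T :=
  LinearMap.congr_fun (f := E.mulFst (z • x)) (g := z • E.mulFst x)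
    (LBal_hext fun a c => by simp only [LinearMap.smul_apply, mulFst_tmL, mul_smul_comm, map_smul]) T

lemma mulSnd_smul (z : ℂ) (x : A) (T : E.LBal) : E.mulSnd (z • x) T = z • E.mulSnd x T :=
  LinearMap.congr_fun (f := E.mulSnd (z • x)) (g := z • E.mulSnd x)
    (LBal_hext fun a c => by simp only [LinearMap.smul_apply, mulSnd_tmL, mul_smul_comm, map_smul]) T

lemma fstMul_smul (z : ℂ) (x : A) (T : E.RBal) : E.fstMul (z • x) T = z • E.fstMul x T :=
  LinearMap.congr_fun (f := E.fstMul (z • x)) (g := z • E.fstMul x)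
    (RBal_hext fun a c => by simp only [LinearMap.smul_apply, fstMul_tmR, smul_mul_assoc, map_smul]) T

lemma sndMul_smul (z : ℂ) (x : A) (T : E.RBal) : E.sndMul (z • x) T = z • E.sndMul x T :=
  LinearMap.congr_fun (f := E.sndMul (z • x)) (g := z • E.sndMul x)
    (RBal_hext fun a c => by simp only [LinearMap.smul_apply, sndMul_tmR, smul_mul_assoc, map_smul]) T

lemma toL_inlM_rgt {u : A} (hu : u ∈ E.gr 1) (W : FP E E) :
    E.toL ((FP.inlM (Mult.of u) (E.of_mem hu)).rgt W) = E.mulFst u (E.toL W) :=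
  LinearMap.congr_fun (f := E.toL ∘ₗ (FP.inlM (Mult.of u) (E.of_mem hu)).rgt)
    (g := E.mulFst u ∘ₗ E.toL) (FP.hext fun g h a c e ha hc => by
      simp only [LinearMap.comp_apply]
      rw [FP.inlM_rgt _ e ha hc, toL_tm e ha hc, Mult.of_rgt,
        toL_tm e (by simpa using E.mul_mem ha hu) hc, mulFst_tmL]) W

lemma toL_inrM_rgt {u : A} (hu : u ∈ E.gr 1) (W : FP E E) :
    E.toL ((FP.inrM (Mult.of u) (E.of_mem hu)).rgt W) = E.mulSnd u (E.toL W) :=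
  LinearMap.congr_fun (f := E.toL ∘ₗ (FP.inrM (Mult.of u) (E.of_mem hu)).rgt)
    (g := E.mulSnd u ∘ₗ E.toL) (FP.hext fun g h a c e ha hc => by
      simp only [LinearMap.comp_apply]
      rw [FP.inrM_rgt _ e ha hc, toL_tm e ha hc, Mult.of_rgt,
        toL_tm e ha (by simpa using E.mul_mem hc hu), mulSnd_tmL]) W

lemma toR_inlM_lft {u : A} (hu : u ∈ E.gr 1) (W : FP E E) :
    E.toR ((FP.inlM (Mult.of u) (E.of_mem hu)).lft W) = E.fstMul u (E.toR W) :=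
  LinearMap.congr_fun (f := E.toR ∘ₗ (FP.inlM (Mult.of u) (E.of_mem hu)).lft)
    (g := E.fstMul u ∘ₗ E.toR) (FP.hext fun g h a c e ha hc => by
      simp only [LinearMap.comp_apply]
      rw [FP.inlM_lft _ e ha hc, toR_tm e ha hc, Mult.of_lft,
        toR_tm e (by simpa using E.mul_mem hu ha) hc, fstMul_tmR]) W

lemma toR_inrM_lft {u : A} (hu : u ∈ E.gr 1) (W : FP E E) :
    E.toR ((FP.inrM (Mult.of u) (E.of_mem hu)).lft W) = E.sndMul u (E.toR W) :=
  LinearMap.congr_fun (f := E.toR ∘ₗ (FP.inrM (Mult.of u) (E.of_mem hu)).lft)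
    (g := E.sndMul u ∘ₗ E.toR) (FP.hext fun g h a c e ha hc => by
      simp only [LinearMap.comp_apply]
      rw [FP.inrM_lft _ e ha hc, toR_tm e ha hc, Mult.of_lft,
        toR_tm e ha (by simpa using E.mul_mem hu hc), sndMul_tmR]) W

end EvAlg

end Elements

/-! ### Partial products of the comultiplication and coassociativity on elements. -/

section Comultiplication

variable {Γ B : Type*} [Group Γ] [NonUnitalCommRing B] [StarRing B] [Module ℂ B]
variable {act : Γ →* (B ≃⋆ₐ[ℂ] B)}
variable {A : Type*} [NonUnitalRing A] [StarRing A] [Module ℂ A]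
    [IsScalarTower ℂ A A] [SMulCommClass ℂ A A] [StarModule ℂ A]
variable {E : EvAlg act A}

namespace Comul

variable (Δ : Comul E)

open DynQG.FP

lemma exists_mul_inlM (a : A) {u : A} (hu : u ∈ E.gr 1) :
    ∃ W, Mult.of W = Δ.toHom a * inlM (Mult.of u) (E.of_mem hu) := Δ.mul_inl a 1 u hu

lemma exists_inlM_mul (a : A) {u : A} (hu : u ∈ E.gr 1) :
    ∃ W, Mult.of W = inlM (Mult.of u) (E.of_mem hu) * Δ.toHom a := Δ.inl_mul a 1 u hu

lemma exists_mul_inrM (a : A) {u : A} (hu : u ∈ E.gr 1) :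
    ∃ W, Mult.of W = Δ.toHom a * inrM (Mult.of u) (E.of_mem hu) := Δ.mul_inr a 1 u hu

lemma exists_inrM_mul (a : A) {u : A} (hu : u ∈ E.gr 1) :
    ∃ W, Mult.of W = inrM (Mult.of u) (E.of_mem hu) * Δ.toHom a := Δ.inr_mul a 1 u hu

/-- The definition of `mulInl` uses one chosen local unit of x. Any two such units have a common
left unit v, and passing from v to u only multiplies by u on the right, which x absorbs. This
freedom in u gives bilinearity and all later computations. -/
lemma mulInl_eq {a x u : A} (hu : u ∈ E.gr 1) (hx : u * x = x) {W : FP E E}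
    (hW : Mult.of W = Δ.toHom a * inlM (Mult.of u) (E.of_mem hu)) :
    Δ.mulInl a x = E.mulFst x (E.toL W) := by
  classical
  suffices key : ∀ {u v : A} (hu : u ∈ E.gr 1) (hv : v ∈ E.gr 1), u * x = x → v * u = u →
      ∀ {W V : FP E E}, Mult.of W = Δ.toHom a * inlM (Mult.of u) (E.of_mem hu) →
      Mult.of V = Δ.toHom a * inlM (Mult.of v) (E.of_mem hv) →
      E.mulFst x (E.toL W) = E.mulFst x (E.toL V) by
    obtain ⟨v, hv, h⟩ := E.units {u, E.lunit x}
    obtain ⟨V, hV⟩ := Δ.exists_mul_inlM a hv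
    rw [mulInl, key hu hv hx (h _ (by simp)) hW hV]
    exact key (E.lunit_mem x) hv (E.lunit_mul x) (h _ (by simp))
      ((ev E E).of_elt (Δ.exists_mul_inlM a (E.lunit_mem x))) hV
  intro u v hu hv hx h W V hW hV
  have : W = (inlM (Mult.of u) (E.of_mem hu)).rgt V := by
    apply (ev E E).of_injective
    rw [of_rgt_eq, hV, hW, mul_assoc, inlM_mul hv hu]
    simp only [h]
  rw [this, E.toL_inlM_rgt hu, E.mulFst_mulFst, hx]

lemma mulInr_eq {a x u : A} (hu : u ∈ E.gr 1) (hx : u * x = x) {W : FP E E}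
    (hW : Mult.of W = Δ.toHom a * inrM (Mult.of u) (E.of_mem hu)) :
    Δ.mulInr a x = E.mulSnd x (E.toL W) := by
  classical
  suffices key : ∀ {u v : A} (hu : u ∈ E.gr 1) (hv : v ∈ E.gr 1), u * x = x → v * u = u →
      ∀ {W V : FP E E}, Mult.of W = Δ.toHom a * inrM (Mult.of u) (E.of_mem hu) →
      Mult.of V = Δ.toHom a * inrM (Mult.of v) (E.of_mem hv) →
      E.mulSnd x (E.toL W) = E.mulSnd x (E.toL V) by
    obtain ⟨v, hv, h⟩ := E.units {u, E.lunit x}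
    obtain ⟨V, hV⟩ := Δ.exists_mul_inrM a hv
    rw [mulInr, key hu hv hx (h _ (by simp)) hW hV]
    exact key (E.lunit_mem x) hv (E.lunit_mul x) (h _ (by simp))
      ((ev E E).of_elt (Δ.exists_mul_inrM a (E.lunit_mem x))) hV
  intro u v hu hv hx h W V hW hV
  have : W = (inrM (Mult.of u) (E.of_mem hu)).rgt V := by
    apply (ev E E).of_injective
    rw [of_rgt_eq, hV, hW, mul_assoc, inrM_mul hv hu]
    simp only [h]
  rw [this, E.toL_inrM_rgt hu, E.mulSnd_mulSnd, hx]

lemma inlMul_eq {a x u : A} (hu : u ∈ E.gr 1) (hx : x * u = x) {W : FP E E}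
    (hW : Mult.of W = inlM (Mult.of u) (E.of_mem hu) * Δ.toHom a) :
    Δ.inlMul x a = E.fstMul x (E.toR W) := by
  classical
  suffices key : ∀ {u v : A} (hu : u ∈ E.gr 1) (hv : v ∈ E.gr 1), x * u = x → u * v = u →
      ∀ {W V : FP E E}, Mult.of W = inlM (Mult.of u) (E.of_mem hu) * Δ.toHom a →
      Mult.of V = inlM (Mult.of v) (E.of_mem hv) * Δ.toHom a →
      E.fstMul x (E.toR W) = E.fstMul x (E.toR V) by
    obtain ⟨v, hv, h⟩ := E.runits {u, E.runit x}
    obtain ⟨V, hV⟩ := Δ.exists_inlM_mul a hv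
    rw [inlMul, key hu hv hx (h _ (by simp)) hW hV]
    exact key (E.runit_mem x) hv (E.mul_runit x) (h _ (by simp))
      ((ev E E).of_elt (Δ.exists_inlM_mul a (E.runit_mem x))) hV
  intro u v hu hv hx h W V hW hV
  have : W = (inlM (Mult.of u) (E.of_mem hu)).lft V := by
    apply (ev E E).of_injective
    rw [of_lft_eq, hV, hW, ← mul_assoc, inlM_mul hu hv]
    simp only [h]
  rw [this, E.toR_inlM_lft hu, E.fstMul_fstMul, hx]

lemma inrMul_eq {a x u : A} (hu : u ∈ E.gr 1) (hx : x * u = x) {W : FP E E}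
    (hW : Mult.of W = inrM (Mult.of u) (E.of_mem hu) * Δ.toHom a) :
    Δ.inrMul x a = E.sndMul x (E.toR W) := by
  classical
  suffices key : ∀ {u v : A} (hu : u ∈ E.gr 1) (hv : v ∈ E.gr 1), x * u = x → u * v = u →
      ∀ {W V : FP E E}, Mult.of W = inrM (Mult.of u) (E.of_mem hu) * Δ.toHom a →
      Mult.of V = inrM (Mult.of v) (E.of_mem hv) * Δ.toHom a →
      E.sndMul x (E.toR W) = E.sndMul x (E.toR V) by
    obtain ⟨v, hv, h⟩ := E.runits {u, E.runit x}
    obtain ⟨V, hV⟩ := Δ.exists_inrM_mul a hv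
    rw [inrMul, key hu hv hx (h _ (by simp)) hW hV]
    exact key (E.runit_mem x) hv (E.mul_runit x) (h _ (by simp))
      ((ev E E).of_elt (Δ.exists_inrM_mul a (E.runit_mem x))) hV
  intro u v hu hv hx h W V hW hV
  have : W = (inrM (Mult.of u) (E.of_mem hu)).lft V := by
    apply (ev E E).of_injective
    rw [of_lft_eq, hV, hW, ← mul_assoc, inrM_mul hu hv]
    simp only [h]
  rw [this, E.toR_inrM_lft hu, E.sndMul_sndMul, hx]

lemma of_add_eq {T U V : Mult (FP E E)} {W W' : FP E E} (h : Mult.of W = T) (h' : Mult.of W' = U)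
    (hV : V = T + U) : Mult.of (W + W') = V := by rw [map_add, h, h', hV]

/-- `Δ(a)(x ⊗ 1)` as a bilinear map. -/
def mulInlB : A →ₗ[ℂ] A →ₗ[ℂ] E.LBal := LinearMap.mk₂ ℂ Δ.mulInl
  (fun a a' x => by
    obtain ⟨u, hu, hx⟩ := E.unit1 x
    obtain ⟨W, hW⟩ := Δ.exists_mul_inlM a hu
    obtain ⟨W', hW'⟩ := Δ.exists_mul_inlM a' hu
    rw [Δ.mulInl_eq hu hx hW, Δ.mulInl_eq hu hx hW', Δ.mulInl_eq hu hx (W := W + W')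
      (of_add_eq hW hW' (by rw [map_add, add_mul])), map_add, map_add])
  (fun z a x => by
    obtain ⟨u, hu, hx⟩ := E.unit1 x
    obtain ⟨W, hW⟩ := Δ.exists_mul_inlM a hu
    rw [Δ.mulInl_eq hu hx hW, Δ.mulInl_eq hu hx (W := z • W)
      (by rw [map_smul, map_smul, smul_mul_assoc, hW]), map_smul, map_smul])
  (fun a x y => by
    classical
    obtain ⟨u, hu, h⟩ := E.units {x, y}
    have hx := h x (by simp)
    have hy := h y (by simp)
    obtain ⟨W, hW⟩ := Δ.exists_mul_inlM a hu
    rw [Δ.mulInl_eq hu hx hW, Δ.mulInl_eq hu hy hW, Δ.mulInl_eq hu (by rw [mul_add, hx, hy]) hW,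
      E.mulFst_add])
  (fun z a x => by
    obtain ⟨u, hu, hx⟩ := E.unit1 x
    obtain ⟨W, hW⟩ := Δ.exists_mul_inlM a hu
    rw [Δ.mulInl_eq hu hx hW, Δ.mulInl_eq hu (by rw [mul_smul_comm, hx]) hW, E.mulFst_smul])

/-- `Δ(a)(1 ⊗ x)` as a bilinear map. -/
def mulInrB : A →ₗ[ℂ] A →ₗ[ℂ] E.LBal := LinearMap.mk₂ ℂ Δ.mulInr
  (fun a a' x => by
    obtain ⟨u, hu, hx⟩ := E.unit1 x
    obtain ⟨W, hW⟩ := Δ.exists_mul_inrM a hu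
    obtain ⟨W', hW'⟩ := Δ.exists_mul_inrM a' hu
    rw [Δ.mulInr_eq hu hx hW, Δ.mulInr_eq hu hx hW', Δ.mulInr_eq hu hx (W := W + W')
      (of_add_eq hW hW' (by rw [map_add, add_mul])), map_add, map_add])
  (fun z a x => by
    obtain ⟨u, hu, hx⟩ := E.unit1 x
    obtain ⟨W, hW⟩ := Δ.exists_mul_inrM a hu
    rw [Δ.mulInr_eq hu hx hW, Δ.mulInr_eq hu hx (W := z • W)
      (by rw [map_smul, map_smul, smul_mul_assoc, hW]), map_smul, map_smul])
  (fun a x y => by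
    classical
    obtain ⟨u, hu, h⟩ := E.units {x, y}
    have hx := h x (by simp)
    have hy := h y (by simp)
    obtain ⟨W, hW⟩ := Δ.exists_mul_inrM a hu
    rw [Δ.mulInr_eq hu hx hW, Δ.mulInr_eq hu hy hW, Δ.mulInr_eq hu (by rw [mul_add, hx, hy]) hW,
      E.mulSnd_add])
  (fun z a x => by
    obtain ⟨u, hu, hx⟩ := E.unit1 x
    obtain ⟨W, hW⟩ := Δ.exists_mul_inrM a hu
    rw [Δ.mulInr_eq hu hx hW, Δ.mulInr_eq hu (by rw [mul_smul_comm, hx]) hW, E.mulSnd_smul])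

/-- `(x ⊗ 1)Δ(a)` as a bilinear map. -/
def inlMulB : A →ₗ[ℂ] A →ₗ[ℂ] E.RBal := LinearMap.mk₂ ℂ Δ.inlMul
  (fun x y a => by
    classical
    obtain ⟨u, hu, h⟩ := E.runits {x, y}
    have hx := h x (by simp)
    have hy := h y (by simp)
    obtain ⟨W, hW⟩ := Δ.exists_inlM_mul a hu
    rw [Δ.inlMul_eq hu hx hW, Δ.inlMul_eq hu hy hW, Δ.inlMul_eq hu (by rw [add_mul, hx, hy]) hW,
      E.fstMul_add])
  (fun z x a => by
    obtain ⟨u, hu, hx⟩ := E.runit1 x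
    obtain ⟨W, hW⟩ := Δ.exists_inlM_mul a hu
    rw [Δ.inlMul_eq hu hx hW, Δ.inlMul_eq hu (by rw [smul_mul_assoc, hx]) hW, E.fstMul_smul])
  (fun x a a' => by
    obtain ⟨u, hu, hx⟩ := E.runit1 x
    obtain ⟨W, hW⟩ := Δ.exists_inlM_mul a hu
    obtain ⟨W', hW'⟩ := Δ.exists_inlM_mul a' hu
    rw [Δ.inlMul_eq hu hx hW, Δ.inlMul_eq hu hx hW', Δ.inlMul_eq hu hx (W := W + W')
      (of_add_eq hW hW' (by rw [map_add, mul_add])), map_add, map_add])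
  (fun z x a => by
    obtain ⟨u, hu, hx⟩ := E.runit1 x
    obtain ⟨W, hW⟩ := Δ.exists_inlM_mul a hu
    rw [Δ.inlMul_eq hu hx hW, Δ.inlMul_eq hu hx (W := z • W)
      (by rw [map_smul, map_smul, mul_smul_comm, hW]), map_smul, map_smul])

/-- `(1 ⊗ x)Δ(a)` as a bilinear map. -/
def inrMulB : A →ₗ[ℂ] A →ₗ[ℂ] E.RBal := LinearMap.mk₂ ℂ Δ.inrMul
  (fun x y a => by
    classical
    obtain ⟨u, hu, h⟩ := E.runits {x, y}
    have hx := h x (by simp)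
    have hy := h y (by simp)
    obtain ⟨W, hW⟩ := Δ.exists_inrM_mul a hu
    rw [Δ.inrMul_eq hu hx hW, Δ.inrMul_eq hu hy hW, Δ.inrMul_eq hu (by rw [add_mul, hx, hy]) hW,
      E.sndMul_add])
  (fun z x a => by
    obtain ⟨u, hu, hx⟩ := E.runit1 x
    obtain ⟨W, hW⟩ := Δ.exists_inrM_mul a hu
    rw [Δ.inrMul_eq hu hx hW, Δ.inrMul_eq hu (by rw [smul_mul_assoc, hx]) hW, E.sndMul_smul])
  (fun x a a' => by
    obtain ⟨u, hu, hx⟩ := E.runit1 x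
    obtain ⟨W, hW⟩ := Δ.exists_inrM_mul a hu
    obtain ⟨W', hW'⟩ := Δ.exists_inrM_mul a' hu
    rw [Δ.inrMul_eq hu hx hW, Δ.inrMul_eq hu hx hW', Δ.inrMul_eq hu hx (W := W + W')
      (of_add_eq hW hW' (by rw [map_add, mul_add])), map_add, map_add])
  (fun z x a => by
    obtain ⟨u, hu, hx⟩ := E.runit1 x
    obtain ⟨W, hW⟩ := Δ.exists_inrM_mul a hu
    rw [Δ.inrMul_eq hu hx hW, Δ.inrMul_eq hu hx (W := z • W)
      (by rw [map_smul, map_smul, mul_smul_comm, hW]), map_smul, map_smul])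

/-- By non-degeneracy X is a finite sum of elements Δ(a)c, and a common left unit of the finitely
many a works. -/
lemma exists_unit (X : FP E E) : ∃ u ∈ E.gr 1, (Δ.toHom u).lft X = X := by
  classical
  suffices h : ∃ S : Finset A, ∀ u, (∀ a ∈ S, u * a = a) → (Δ.toHom u).lft X = X by
    obtain ⟨S, hS⟩ := h
    obtain ⟨u, hu, h⟩ := E.units S
    exact ⟨u, hu, hS u h⟩
  have hX : X ∈ Submodule.span ℂ {x | ∃ a c, x = (Δ.toHom a).lft c} := by
    rw [Δ.span_lft]; trivial
  refine Submodule.span_induction ?_ ⟨∅, by simp⟩ ?_ ?_ hX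
  · rintro _ ⟨a, c, rfl⟩
    refine ⟨{a}, fun u hu => ?_⟩
    rw [← Mult.mul_lft, ← map_mul, hu a (by simp)]
  · rintro x y - - ⟨S, hS⟩ ⟨T, hT⟩
    refine ⟨S ∪ T, fun u hu => ?_⟩
    rw [map_add, hS u fun a ha => hu a (Finset.mem_union_left _ ha),
      hT u fun a ha => hu a (Finset.mem_union_right _ ha)]
  · rintro z x - ⟨S, hS⟩
    exact ⟨S, fun u hu => by rw [map_smul, hS u hu]⟩

lemma map_toHom_id_tm {g h : Γ × Γ} {f c : A} (e : g.2 = h.1) (hf : f ∈ E.gr g) (hc : c ∈ E.gr h)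
    {k l : Γ × Γ} {X : FP E E} {d : A} (e' : k.2 = l.1) (hX : X ∈ (ev E E).gr k) (hd : d ∈ E.gr l) :
    (FP.map Δ.toEvHom (EvHom.id E) (tm f c)).lft (tm X d) = tm ((Δ.toHom f).lft X) (c * d) := by
  rw [FP.map, lift_tm _ _ e hf hc, glift₂_apply _ e hf hc]
  exact tmul_lft e (Δ.map_gr hf) ((EvHom.id E).map_gr hc) e' hX hd

lemma map_id_toHom_tm {g h : Γ × Γ} {f c : A} (e : g.2 = h.1) (hf : f ∈ E.gr g) (hc : c ∈ E.gr h)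
    {k l : Γ × Γ} {x : A} {Y : FP E E} (e' : k.2 = l.1) (hx : x ∈ E.gr k) (hY : Y ∈ (ev E E).gr l) :
    (FP.map (EvHom.id E) Δ.toEvHom (tm f c)).lft (tm x Y) = tm (f * x) ((Δ.toHom c).lft Y) := by
  rw [FP.map, lift_tm _ _ e hf hc, glift₂_apply _ e hf hc]
  exact tmul_lft e ((EvHom.id E).map_gr hf) (Δ.map_gr hc) e' hx hY

lemma map_toHom_id_inlM {u : A} (hu : u ∈ E.gr 1) (W : FP E E) {k l : Γ × Γ} {X : FP E E} {d : A}
    (e' : k.2 = l.1) (hX : X ∈ (ev E E).gr k) (hd : d ∈ E.gr l) (h : (Δ.toHom u).lft X = X) :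
    (FP.map Δ.toEvHom (EvHom.id E) ((inlM (Mult.of u) (E.of_mem hu)).rgt W)).lft (tm X d) =
      (FP.map Δ.toEvHom (EvHom.id E) W).lft (tm X d) := by
  refine FP.induction (p := fun W => (FP.map Δ.toEvHom (EvHom.id E)
    ((inlM (Mult.of u) (E.of_mem hu)).rgt W)).lft (tm X d) =
      (FP.map Δ.toEvHom (EvHom.id E) W).lft (tm X d)) (by simp)
    (fun x y hx hy => by simp only [map_add, Mult.add_lft, hx, hy]) ?_ W
  intro g h' f c e hf hc
  have h1 : f * u ∈ E.gr g := by simpa using E.mul_mem hf hu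
  rw [inlM_rgt _ e hf hc, Mult.of_rgt, Δ.map_toHom_id_tm e h1 hc e' hX hd,
    Δ.map_toHom_id_tm e hf hc e' hX hd, map_mul Δ.toHom, Mult.mul_lft, h]

lemma map_id_toHom_inrM {v : A} (hv : v ∈ E.gr 1) (W : FP E E) {k l : Γ × Γ} {x : A} {Y : FP E E}
    (e' : k.2 = l.1) (hx : x ∈ E.gr k) (hY : Y ∈ (ev E E).gr l) (h : (Δ.toHom v).lft Y = Y) :
    (FP.map (EvHom.id E) Δ.toEvHom ((inrM (Mult.of v) (E.of_mem hv)).rgt W)).lft (tm x Y) =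
      (FP.map (EvHom.id E) Δ.toEvHom W).lft (tm x Y) := by
  refine FP.induction (p := fun W => (FP.map (EvHom.id E) Δ.toEvHom
    ((inrM (Mult.of v) (E.of_mem hv)).rgt W)).lft (tm x Y) =
      (FP.map (EvHom.id E) Δ.toEvHom W).lft (tm x Y)) (by simp)
    (fun x y hx hy => by simp only [map_add, Mult.add_lft, hx, hy]) ?_ W
  intro g h' f c e hf hc
  have h1 : c * v ∈ E.gr h' := by simpa using E.mul_mem hc hv
  rw [inrM_rgt _ e hf hc, Mult.of_rgt, Δ.map_id_toHom_tm e hf h1 e' hx hY,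
    Δ.map_id_toHom_tm e hf hc e' hx hY, map_mul Δ.toHom, Mult.mul_lft, h]

lemma map_id_toHom_inlM {u : A} (hu : u ∈ E.gr 1) (W : FP E E) {k l : Γ × Γ} {x : A} {Y : FP E E}
    (e' : k.2 = l.1) (hx : x ∈ E.gr k) (hY : Y ∈ (ev E E).gr l) (h : u * x = x) :
    (FP.map (EvHom.id E) Δ.toEvHom ((inlM (Mult.of u) (E.of_mem hu)).rgt W)).lft (tm x Y) =
      (FP.map (EvHom.id E) Δ.toEvHom W).lft (tm x Y) := by
  refine FP.induction (p := fun W => (FP.map (EvHom.id E) Δ.toEvHom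
    ((inlM (Mult.of u) (E.of_mem hu)).rgt W)).lft (tm x Y) =
      (FP.map (EvHom.id E) Δ.toEvHom W).lft (tm x Y)) (by simp)
    (fun x y hx hy => by simp only [map_add, Mult.add_lft, hx, hy]) ?_ W
  intro g h' f c e hf hc
  have h1 : f * u ∈ E.gr g := by simpa using E.mul_mem hf hu
  rw [inlM_rgt _ e hf hc, Mult.of_rgt, Δ.map_id_toHom_tm e h1 hc e' hx hY,
    Δ.map_id_toHom_tm e hf hc e' hx hY, mul_assoc, h]

lemma lft_tm_eq_of_inrM {a u v : A} (hu : u ∈ E.gr 1) (hv : v ∈ E.gr 1) {W : FP E E}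
    (hW : Mult.of W = Δ.toHom a * inrM (Mult.of v) (E.of_mem hv)) :
    (Δ.toHom a).lft (tm u v) = (inlM (Mult.of u) (E.of_mem hu)).rgt W := by
  apply (ev E E).of_injective
  rw [of_lft_eq, of_rgt_eq, hW, mul_assoc, inrM_mul_inlM hu hv]

lemma lft_tm_eq_of_inlM {a u v : A} (hu : u ∈ E.gr 1) (hv : v ∈ E.gr 1) {W : FP E E}
    (hW : Mult.of W = Δ.toHom a * inlM (Mult.of u) (E.of_mem hu)) :
    (Δ.toHom a).lft (tm u v) = (inrM (Mult.of v) (E.of_mem hv)).rgt W := by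
  apply (ev E E).of_injective
  rw [of_lft_eq, of_rgt_eq, hW, mul_assoc, inlM_mul_inrM hu hv]

/-- Replaces the multiplier (Δ ⊗ id)(Δ(a)) by an honest sum. With Δ(u)X = X, the tensor X ⊗ d is
fixed by (Δ ⊗ id)(u ⊗ v), so U acts on it through Δ(a)(u ⊗ v), which is W cut down by u; afterwards
X absorbs u again. -/
lemma extends_toHom_id {a : A} {U : Mult (FP (ev E E) E)}
    (hU : Extends (FP.map Δ.toEvHom (EvHom.id E)) (Δ.toHom a) U) {v : A} (hv : v ∈ E.gr 1)
    {W : FP E E} (hW : Mult.of W = Δ.toHom a * inrM (Mult.of v) (E.of_mem hv))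
    {k l : Γ × Γ} {X : FP E E} {d : A} (e : k.2 = l.1) (hX : X ∈ (ev E E).gr k)
    (hd : d ∈ E.gr l) (h : v * d = d) :
    U.lft (tm X d) = (FP.map Δ.toEvHom (EvHom.id E) W).lft (tm X d) := by
  obtain ⟨u, hu, hX'⟩ := Δ.exists_unit X
  have h1 : tm X d = (FP.map Δ.toEvHom (EvHom.id E) (tm u v)).lft (tm X d) := by
    rw [Δ.map_toHom_id_tm (g := 1) (h := 1) rfl hu hv e hX hd, hX', h]
  rw [h1, ← Mult.mul_lft, (hU _).1, Δ.lft_tm_eq_of_inrM hu hv hW, ← h1,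
    Δ.map_toHom_id_inlM hu W e hX hd hX']

lemma extends_id_toHom_of_inrM {a : A} {V : Mult (FP E (ev E E))}
    (hV : Extends (FP.map (EvHom.id E) Δ.toEvHom) (Δ.toHom a) V) {v : A} (hv : v ∈ E.gr 1)
    {W : FP E E} (hW : Mult.of W = Δ.toHom a * inrM (Mult.of v) (E.of_mem hv))
    {k l : Γ × Γ} {x : A} {Y : FP E E} (e : k.2 = l.1) (hx : x ∈ E.gr k)
    (hY : Y ∈ (ev E E).gr l) (h : (Δ.toHom v).lft Y = Y) :
    V.lft (tm x Y) = (FP.map (EvHom.id E) Δ.toEvHom W).lft (tm x Y) := by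
  obtain ⟨u, hu, hx'⟩ := E.unit1 x
  have h1 : tm x Y = (FP.map (EvHom.id E) Δ.toEvHom (tm u v)).lft (tm x Y) := by
    rw [Δ.map_id_toHom_tm (g := 1) (h := 1) rfl hu hv e hx hY, hx', h]
  rw [h1, ← Mult.mul_lft, (hV _).1, Δ.lft_tm_eq_of_inrM hu hv hW, ← h1,
    Δ.map_id_toHom_inlM hu W e hx hY hx']

/-- Here Δ(a) is cut down in its first leg instead of the second. This variant is the one that fits
functionals applied to the first leg. -/
lemma extends_id_toHom_of_inlM {a : A} {V : Mult (FP E (ev E E))}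
    (hV : Extends (FP.map (EvHom.id E) Δ.toEvHom) (Δ.toHom a) V) {u : A} (hu : u ∈ E.gr 1)
    {W : FP E E} (hW : Mult.of W = Δ.toHom a * inlM (Mult.of u) (E.of_mem hu))
    {k l : Γ × Γ} {x : A} {Y : FP E E} (e : k.2 = l.1) (hx : x ∈ E.gr k)
    (hY : Y ∈ (ev E E).gr l) (h : u * x = x) :
    V.lft (tm x Y) = (FP.map (EvHom.id E) Δ.toEvHom W).lft (tm x Y) := by
  obtain ⟨v, hv, hY'⟩ := Δ.exists_unit Y
  have h1 : tm x Y = (FP.map (EvHom.id E) Δ.toEvHom (tm u v)).lft (tm x Y) := by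
    rw [Δ.map_id_toHom_tm (g := 1) (h := 1) rfl hu hv e hx hY, hY', h]
  rw [h1, ← Mult.mul_lft, (hV _).1, Δ.lft_tm_eq_of_inlM hu hv hW, ← h1,
    Δ.map_id_toHom_inrM hv W e hx hY hY']

lemma coassoc_lft (a : A) : ∃ (U : Mult (FP (FP.ev E E) E)) (V : Mult (FP E (FP.ev E E))),
    Extends (FP.map Δ.toEvHom (EvHom.id E)) (Δ.toHom a) U ∧
    Extends (FP.map (EvHom.id E) Δ.toEvHom) (Δ.toHom a) V ∧
    ∀ {k l m : Γ × Γ} {x c d : A}, k.2 = l.1 → l.2 = m.1 → x ∈ E.gr k → c ∈ E.gr l → d ∈ E.gr m →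
      FP.assoc (U.lft (tm (tm x c) d)) = V.lft (tm x (tm c d)) := by
  obtain ⟨U, V, hU, hV, h⟩ := Δ.coassoc a
  refine ⟨U, V, hU, hV, fun {k l m x c d} e e' hx hc hd => ?_⟩
  rw [(h _).1, FP.assoc, lift_tm _ _ (g := (k.1, l.2)) e' (tm_mem e hx hc) hd,
    assocAux_tm e hx hc]

end Comul

end Comultiplication

/-! ### Elementary properties of μ, ν, φ, ψ and of the slices of Δ. -/

section Functionals

variable {Γ B : Type*} [Group Γ] [NonUnitalCommRing B] [StarRing B] [Module ℂ B]
variable {act : Γ →* (B ≃⋆ₐ[ℂ] B)}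
variable {A : Type*} [NonUnitalRing A] [StarRing A] [Module ℂ A]
    [IsScalarTower ℂ A A] [SMulCommClass ℂ A A] [StarModule ℂ A]
variable [IsScalarTower ℂ B B] [SMulCommClass ℂ B B] [StarModule ℂ B]
variable {E : EvAlg act A}

namespace Weight

lemma ext (μ : Weight act) {c d : B} (h : ∀ b, μ.toFun (b * c) = μ.toFun (b * d)) : c = d :=
  sub_eq_zero.1 (μ.faithful _ fun b => by rw [mul_sub, map_sub, h, sub_self])

lemma map_star (hB : HasLocalUnits B) (μ : Weight act) (b : B) :
    μ.toFun (star b) = star (μ.toFun b) := by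
  classical
  obtain ⟨u, hu⟩ := hB {b, star b}
  have h1 : u * star b = star b := hu _ (by simp)
  have h2 : star u * b = b := by
    have := congrArg star h1
    rwa [star_mul, star_star, mul_comm] at this
  have := herm_of_pos μ.toFun μ.nonneg b u
  rw [h2, mul_comm, h1] at this
  exact this.symm

end Weight

lemma EvAlg.star_r_rgt (E : EvAlg act A) (b : B) (a : A) :
    star ((E.r b).rgt a) = (E.r (star b)).lft (star a) := by
  rw [StarHomClass.map_star E.r, Mult.star_lft, star_star]

lemma EvAlg.star_s_rgt (E : EvAlg act A) (b : B) (a : A) :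
    star ((E.s b).rgt a) = (E.s (star b)).lft (star a) := by
  rw [StarHomClass.map_star E.s, Mult.star_lft, star_star]

namespace MeasuredHopf

variable (𝒢 : MeasuredHopf E)

lemma nu_eq_phi (a : A) : 𝒢.nu a = 𝒢.μ.toFun (𝒢.φ.toFun a) := rfl

lemma nu_eq_psi (a : A) : 𝒢.nu a = 𝒢.μ.toFun (𝒢.ψ.toFun a) := LinearMap.congr_fun 𝒢.coincide a

lemma nu_r_lft (b : B) (a : A) : 𝒢.nu ((E.r b).lft a) = 𝒢.μ.toFun (b * 𝒢.φ.toFun a) := by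
  rw [nu_eq_phi, 𝒢.φ.map_lft]

lemma nu_r_rgt (b : B) (a : A) : 𝒢.nu ((E.r b).rgt a) = 𝒢.μ.toFun (b * 𝒢.φ.toFun a) := by
  rw [nu_eq_phi, 𝒢.φ.map_rgt, mul_comm]

lemma nu_s_lft (b : B) (a : A) : 𝒢.nu ((E.s b).lft a) = 𝒢.μ.toFun (b * 𝒢.ψ.toFun a) := by
  rw [nu_eq_psi, 𝒢.ψ.map_lft]

lemma nu_s_rgt (b : B) (a : A) : 𝒢.nu ((E.s b).rgt a) = 𝒢.μ.toFun (b * 𝒢.ψ.toFun a) := by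
  rw [nu_eq_psi, 𝒢.ψ.map_rgt, mul_comm]

/-- The axioms only provide vanishing in the first degree. In the second degree φ inherits it from
ψ, because μ(bφ(a)) = ν(r(b)a) can also be computed with ψ and μ is faithful. -/
lemma phi_eq_zero {g : Γ × Γ} {a : A} (ha : a ∈ E.gr g) (hg : g ≠ 1) : 𝒢.φ.toFun a = 0 := by
  by_cases h1 : g.1 = 1
  · have h2 : g.2 ≠ 1 := fun h2 => hg (Prod.ext h1 h2)
    refine 𝒢.μ.faithful _ fun b => ?_
    rw [← nu_r_lft, nu_eq_psi, 𝒢.ψ.map_gr (E.r_mem b ha) h2, map_zero]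
  · exact 𝒢.φ.map_gr ha h1

lemma psi_eq_zero {g : Γ × Γ} {a : A} (ha : a ∈ E.gr g) (hg : g ≠ 1) : 𝒢.ψ.toFun a = 0 := by
  by_cases h2 : g.2 = 1
  · have h1 : g.1 ≠ 1 := fun h1 => hg (Prod.ext h1 h2)
    refine 𝒢.μ.faithful _ fun b => ?_
    rw [← nu_s_lft, nu_eq_phi, 𝒢.φ.map_gr (E.s_mem b ha) h1, map_zero]
  · exact 𝒢.ψ.map_gr ha h2

lemma nu_eq_zero {g : Γ × Γ} {a : A} (ha : a ∈ E.gr g) (hg : g ≠ 1) : 𝒢.nu a = 0 := by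
  rw [nu_eq_phi, 𝒢.phi_eq_zero ha hg, map_zero]

lemma nu_star (a : A) : 𝒢.nu (star a) = star (𝒢.nu a) := by
  classical
  obtain ⟨u, -, hu⟩ := E.units {a, star a}
  have h2 : star a * star u = star a := by rw [← star_mul, hu a (by simp)]
  have := herm_of_pos 𝒢.nu 𝒢.nonneg a (star u)
  rw [star_star, hu a (by simp), h2] at this
  exact this.symm

/-- Tested against μ, this is the hermiticity of ν; faithfulness of μ removes the test. -/
lemma phi_star (hB : HasLocalUnits B) (a : A) : 𝒢.φ.toFun (star a) = star (𝒢.φ.toFun a) := by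
  refine 𝒢.μ.ext fun b => ?_
  have h : (E.r b).lft (star a) = star ((E.r (star b)).rgt a) := by
    rw [E.star_r_rgt, star_star]
  rw [← nu_r_lft, h, nu_star, nu_r_rgt, ← 𝒢.μ.map_star hB, star_mul, star_star, mul_comm]

lemma psi_star (hB : HasLocalUnits B) (a : A) : 𝒢.ψ.toFun (star a) = star (𝒢.ψ.toFun a) := by
  refine 𝒢.μ.ext fun b => ?_
  have h : (E.s b).lft (star a) = star ((E.s (star b)).rgt a) := by
    rw [E.star_s_rgt, star_star]
  rw [← nu_s_lft, h, nu_star, nu_s_rgt, ← 𝒢.μ.map_star hB, star_mul, star_star, mul_comm]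

lemma inner_Lam (x y : A) : inner ℂ (𝒢.Lam x) (𝒢.Lam y) = 𝒢.nu (star x * y) :=
  GNS.inner_lam 𝒢.nu 𝒢.nu_nonneg x y

lemma nu_star_mul_self (x : A) : 𝒢.nu (star x * x) = ((‖𝒢.Lam x‖ ^ 2 : ℝ) : ℂ) := by
  rw [← inner_Lam, inner_self_eq_norm_sq_to_K]; norm_cast

lemma norm_nu_le (x y : A) : ‖𝒢.nu (star x * y)‖ ≤ ‖𝒢.Lam x‖ * ‖𝒢.Lam y‖ := by
  rw [← inner_Lam]; exact norm_inner_le_norm _ _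

/-- The vector of z in H has norm zero, so ν(xz) = 0 for all x by the Cauchy-Schwarz inequality, and
ν is faithful. Identities in A can thus be proved by multiplying a difference by its own adjoint. -/
lemma eq_zero_of_star_mul_self (𝒢 : MeasuredHopf E) {z : A} (h : star z * z = 0) : z = 0 := by
  have h1 : ‖𝒢.Lam z‖ = 0 := by
    have := 𝒢.nu_star_mul_self z
    rw [h, map_zero] at this
    exact pow_eq_zero_iff (two_ne_zero) |>.1 (by exact_mod_cast this.symm)
  refine 𝒢.faithful z fun x => ?_
  have := 𝒢.norm_nu_le (star x) z
  rw [h1, mul_zero, star_star] at this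
  exact norm_le_zero_iff.1 this

lemma eq_zero_of_mul_star_self (𝒢 : MeasuredHopf E) {z : A} (h : z * star z = 0) : z = 0 :=
  star_eq_zero.1 (𝒢.eq_zero_of_star_mul_self (by rwa [star_star]))

lemma nu_ext {x y : A} (h : ∀ e, 𝒢.nu (e * x) = 𝒢.nu (e * y)) : x = y :=
  sub_eq_zero.1 (𝒢.faithful _ fun e => by
    change 𝒢.nu _ = 0
    rw [mul_sub, map_sub, h, sub_self])

/-- Either φ(y) = 0, or y has degree e; in the latter case the matching condition makes the second
degree of x trivial, so s(b) passes x without a twist. -/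
lemma s_phi_comm {g h : Γ × Γ} {x y : A} (e : g.2 = h.1) (hx : x ∈ E.gr g) (hy : y ∈ E.gr h) :
    (E.s (𝒢.φ.toFun y)).rgt x = (E.s (𝒢.φ.toFun y)).lft x := by
  by_cases h1 : h = 1
  · rw [E.twist_s _ hx, e, h1, Prod.fst_one, act_one_apply]
  · rw [𝒢.phi_eq_zero hy h1]; simp

/-- `x ⊗̃ y ↦ x s(φ(cy))`. -/
def fpPhiR (c : A) : FP E E →ₗ[ℂ] A := 𝒢.φ.sliceR ∘ₗ E.sndMul c ∘ₗ E.toR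
/-- `x ⊗̃ y ↦ s(φ(yb))x`. -/
def fpPhiL (b : A) : FP E E →ₗ[ℂ] A := 𝒢.φ.sliceL ∘ₗ E.mulSnd b ∘ₗ E.toL
/-- `x ⊗̃ y ↦ y r(ψ(wx))`. -/
def fpPsiR (w : A) : FP E E →ₗ[ℂ] A := 𝒢.ψ.sliceR ∘ₗ E.fstMul w ∘ₗ E.toR
/-- `x ⊗̃ y ↦ r(ψ(xt))y`. -/
def fpPsiL (t : A) : FP E E →ₗ[ℂ] A := 𝒢.ψ.sliceL ∘ₗ E.mulFst t ∘ₗ E.toL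

section
variable {g h : Γ × Γ} {x y : A} (e : g.2 = h.1) (hx : x ∈ E.gr g) (hy : y ∈ E.gr h)
include e hx hy

lemma fpPhiR_tm (c : A) : 𝒢.fpPhiR c (FP.tm x y) = (E.s (𝒢.φ.toFun (c * y))).rgt x := by
  rw [fpPhiR, LinearMap.comp_apply, LinearMap.comp_apply, E.toR_tm e hx hy, E.sndMul_tmR]; rfl

lemma fpPhiL_tm (b : A) : 𝒢.fpPhiL b (FP.tm x y) = (E.s (𝒢.φ.toFun (y * b))).lft x := by
  rw [fpPhiL, LinearMap.comp_apply, LinearMap.comp_apply, E.toL_tm e hx hy, E.mulSnd_tmL]; rfl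

lemma fpPsiR_tm (w : A) : 𝒢.fpPsiR w (FP.tm x y) = (E.r (𝒢.ψ.toFun (w * x))).rgt y := by
  rw [fpPsiR, LinearMap.comp_apply, LinearMap.comp_apply, E.toR_tm e hx hy, E.fstMul_tmR]; rfl

lemma fpPsiL_tm (t : A) : 𝒢.fpPsiL t (FP.tm x y) = (E.r (𝒢.ψ.toFun (x * t))).lft y := by
  rw [fpPsiL, LinearMap.comp_apply, LinearMap.comp_apply, E.toL_tm e hx hy, E.mulFst_tmL]; rfl

end

/-- `∑ b₁ s(φ(c b₂))`. -/
def phiR : A →ₗ[ℂ] A →ₗ[ℂ] A := 𝒢.Δ.inrMulB.compr₂ 𝒢.φ.sliceR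
/-- `∑ s(φ(a₂ b)) a₁`. -/
def phiL : A →ₗ[ℂ] A →ₗ[ℂ] A := 𝒢.Δ.mulInrB.compr₂ 𝒢.φ.sliceL
/-- `∑ t₂ r(ψ(w t₁))`. -/
def psiR : A →ₗ[ℂ] A →ₗ[ℂ] A := 𝒢.Δ.inlMulB.compr₂ 𝒢.ψ.sliceR
/-- `∑ r(ψ(w₁ t)) w₂`. -/
def psiL : A →ₗ[ℂ] A →ₗ[ℂ] A := 𝒢.Δ.mulInlB.compr₂ 𝒢.ψ.sliceL

lemma phiR_apply (c b : A) : 𝒢.phiR c b = 𝒢.φ.sliceR (𝒢.Δ.inrMul c b) := rfl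
lemma phiL_apply (a b : A) : 𝒢.phiL a b = 𝒢.φ.sliceL (𝒢.Δ.mulInr a b) := rfl
lemma psiR_apply (w t : A) : 𝒢.psiR w t = 𝒢.ψ.sliceR (𝒢.Δ.inlMul w t) := rfl
lemma psiL_apply (w t : A) : 𝒢.psiL w t = 𝒢.ψ.sliceL (𝒢.Δ.mulInl w t) := rfl

section
variable {u : A} (hu : u ∈ E.gr 1) {W : FP E E}
include hu

lemma phiR_eq {c b : A} (hc : c * u = c)
    (hW : Mult.of W = FP.inrM (Mult.of u) (E.of_mem hu) * 𝒢.Δ.toHom b) :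
    𝒢.phiR c b = 𝒢.fpPhiR c W := by
  rw [phiR_apply, 𝒢.Δ.inrMul_eq hu hc hW]; rfl

lemma phiL_eq {a b : A} (hb : u * b = b)
    (hW : Mult.of W = 𝒢.Δ.toHom a * FP.inrM (Mult.of u) (E.of_mem hu)) :
    𝒢.phiL a b = 𝒢.fpPhiL b W := by
  rw [phiL_apply, 𝒢.Δ.mulInr_eq hu hb hW]; rfl

lemma psiR_eq {w t : A} (hw : w * u = w)
    (hW : Mult.of W = FP.inlM (Mult.of u) (E.of_mem hu) * 𝒢.Δ.toHom t) :
    𝒢.psiR w t = 𝒢.fpPsiR w W := by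
  rw [psiR_apply, 𝒢.Δ.inlMul_eq hu hw hW]; rfl

lemma psiL_eq {w t : A} (ht : u * t = t)
    (hW : Mult.of W = 𝒢.Δ.toHom w * FP.inlM (Mult.of u) (E.of_mem hu)) :
    𝒢.psiL w t = 𝒢.fpPsiL t W := by
  rw [psiL_apply, 𝒢.Δ.mulInl_eq hu ht hW]; rfl

lemma fpPhiR_inrM (c : A) (W : FP E E) :
    𝒢.fpPhiR c ((FP.inrM (Mult.of u) (E.of_mem hu)).lft W) = 𝒢.fpPhiR (c * u) W := by
  simp only [fpPhiR, LinearMap.comp_apply]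
  rw [E.toR_inrM_lft hu, E.sndMul_sndMul]

lemma fpPsiR_inlM (w : A) (W : FP E E) :
    𝒢.fpPsiR w ((FP.inlM (Mult.of u) (E.of_mem hu)).lft W) = 𝒢.fpPsiR (w * u) W := by
  simp only [fpPsiR, LinearMap.comp_apply]
  rw [E.toR_inlM_lft hu, E.fstMul_fstMul]

end

/-- On a ⊗ c both sides are μ(ψ(a)φ(c)): ν is evaluated through ψ on one slice and through φ on the
other. -/
lemma nu_sliceR (T : E.RBal) : 𝒢.nu (𝒢.φ.sliceR T) = 𝒢.nu (𝒢.ψ.sliceR T) :=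
  LinearMap.congr_fun (f := 𝒢.nu ∘ₗ 𝒢.φ.sliceR) (g := 𝒢.nu ∘ₗ 𝒢.ψ.sliceR)
    (E.RBal_hext fun a c => by
      change 𝒢.nu ((E.s (𝒢.φ.toFun c)).rgt a) = 𝒢.nu ((E.r (𝒢.ψ.toFun a)).rgt c)
      rw [nu_s_rgt, nu_r_rgt, mul_comm]) T

/-- Both sides are the value of μ(ψ(·)φ(·)) on (w ⊗ c)Δ(b). The identity moves a slice from one leg
to the other and underlies all adjoint computations. -/
lemma nu_mul_phiR (w c b : A) : 𝒢.nu (w * 𝒢.phiR c b) = 𝒢.nu (c * 𝒢.psiR w b) := by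
  obtain ⟨u, hu, hw⟩ := E.runit1 w
  obtain ⟨v, hv, hc⟩ := E.runit1 c
  obtain ⟨W, hW⟩ := 𝒢.Δ.exists_inrM_mul b hv
  obtain ⟨W', hW'⟩ := 𝒢.Δ.exists_inlM_mul b hu
  -- The two slices use different cut-offs of Δ(b); after inserting the missing unit, both become (u
  -- ⊗ v)Δ(b).
  have h1 : (FP.inlM (Mult.of u) (E.of_mem hu)).lft W =
      (FP.inrM (Mult.of v) (E.of_mem hv)).lft W' := by
    apply (FP.ev E E).of_injective
    rw [of_lft_eq, of_lft_eq, hW, hW', ← mul_assoc, ← mul_assoc, FP.inlM_mul_inrM hu hv,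
      FP.inrM_mul_inlM hu hv]
  rw [𝒢.phiR_eq hv hc hW, 𝒢.psiR_eq hu hw hW']
  have h2 : ∀ W, 𝒢.nu (w * 𝒢.fpPhiR c W) = 𝒢.nu (w * 𝒢.fpPhiR c
      ((FP.inlM (Mult.of u) (E.of_mem hu)).lft W)) := fun W =>
    LinearMap.congr_fun (f := 𝒢.nu ∘ₗ LinearMap.mulLeft ℂ w ∘ₗ 𝒢.fpPhiR c)
      (g := 𝒢.nu ∘ₗ LinearMap.mulLeft ℂ w ∘ₗ 𝒢.fpPhiR c ∘ₗ
        (FP.inlM (Mult.of u) (E.of_mem hu)).lft)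
      (FP.hext fun g h x y e hx hy => by
        simp only [LinearMap.comp_apply, LinearMap.mulLeft_apply]
        rw [FP.inlM_lft _ e hx hy, Mult.of_lft, 𝒢.fpPhiR_tm e hx hy,
          𝒢.fpPhiR_tm e (by simpa using E.mul_mem hu hx) hy, ← Mult.rgt_mul, ← Mult.rgt_mul,
          ← mul_assoc, hw]) W
  have h3 : ∀ W, 𝒢.nu (w * 𝒢.fpPhiR c W) = 𝒢.nu (c * 𝒢.fpPsiR w W) := fun W =>
    LinearMap.congr_fun (f := 𝒢.nu ∘ₗ LinearMap.mulLeft ℂ w ∘ₗ 𝒢.fpPhiR c)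
      (g := 𝒢.nu ∘ₗ LinearMap.mulLeft ℂ c ∘ₗ 𝒢.fpPsiR w)
      (FP.hext fun g h x y e hx hy => by
        simp only [LinearMap.comp_apply, LinearMap.mulLeft_apply]
        rw [𝒢.fpPhiR_tm e hx hy, 𝒢.fpPsiR_tm e hx hy, ← Mult.rgt_mul, ← Mult.rgt_mul, nu_s_rgt,
          nu_r_rgt, mul_comm]) W
  have h4 : ∀ W, 𝒢.nu (c * 𝒢.fpPsiR w W) = 𝒢.nu (c * 𝒢.fpPsiR w
      ((FP.inrM (Mult.of v) (E.of_mem hv)).lft W)) := fun W =>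
    LinearMap.congr_fun (f := 𝒢.nu ∘ₗ LinearMap.mulLeft ℂ c ∘ₗ 𝒢.fpPsiR w)
      (g := 𝒢.nu ∘ₗ LinearMap.mulLeft ℂ c ∘ₗ 𝒢.fpPsiR w ∘ₗ
        (FP.inrM (Mult.of v) (E.of_mem hv)).lft)
      (FP.hext fun g h x y e hx hy => by
        simp only [LinearMap.comp_apply, LinearMap.mulLeft_apply]
        rw [FP.inrM_lft _ e hx hy, Mult.of_lft, 𝒢.fpPsiR_tm e hx hy,
          𝒢.fpPsiR_tm e hx (by simpa using E.mul_mem hv hy), ← Mult.rgt_mul, ← Mult.rgt_mul,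
          ← mul_assoc, hc]) W
  rw [h2, h1, h3, ← h4]

lemma star_fpPhiR (hB : HasLocalUnits B) (c : A) (W : FP E E) :
    star (𝒢.fpPhiR c W) = 𝒢.fpPhiL (star c) (star W) := by
  refine FP.induction (p := fun W => star (𝒢.fpPhiR c W) = 𝒢.fpPhiL (star c) (star W))
    (by simp) (fun x y hx hy => by simp only [map_add, star_add, hx, hy]) ?_ W
  intro g h x y e hx hy
  rw [𝒢.fpPhiR_tm e hx hy, FP.star_tm e hx hy,
    𝒢.fpPhiL_tm (by simp [e]) (E.star_mem hx) (E.star_mem hy), E.star_s_rgt, ← 𝒢.phi_star hB,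
    star_mul]

lemma star_fpPsiR (hB : HasLocalUnits B) (w : A) (W : FP E E) :
    star (𝒢.fpPsiR w W) = 𝒢.fpPsiL (star w) (star W) := by
  refine FP.induction (p := fun W => star (𝒢.fpPsiR w W) = 𝒢.fpPsiL (star w) (star W))
    (by simp) (fun x y hx hy => by simp only [map_add, star_add, hx, hy]) ?_ W
  intro g h x y e hx hy
  rw [𝒢.fpPsiR_tm e hx hy, FP.star_tm e hx hy,
    𝒢.fpPsiL_tm (by simp [e]) (E.star_mem hx) (E.star_mem hy), E.star_r_rgt, ← 𝒢.psi_star hB,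
    star_mul]

lemma star_phiR (hB : HasLocalUnits B) (c b : A) :
    star (𝒢.phiR c b) = 𝒢.phiL (star b) (star c) := by
  obtain ⟨u, hu, hc⟩ := E.runit1 c
  obtain ⟨W, hW⟩ := 𝒢.Δ.exists_inrM_mul b hu
  have hu' : star u ∈ E.gr 1 := by simpa using E.star_mem hu
  rw [𝒢.phiR_eq hu hc hW, 𝒢.star_fpPhiR hB, 𝒢.phiL_eq hu' (W := star W)
    (by rw [← star_mul, hc])
    (by rw [FP.of_star, hW, star_mul, FP.star_inrM hu, StarHomClass.map_star 𝒢.Δ.toHom])]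

lemma star_psiR (hB : HasLocalUnits B) (w t : A) :
    star (𝒢.psiR w t) = 𝒢.psiL (star t) (star w) := by
  obtain ⟨u, hu, hw⟩ := E.runit1 w
  obtain ⟨W, hW⟩ := 𝒢.Δ.exists_inlM_mul t hu
  have hu' : star u ∈ E.gr 1 := by simpa using E.star_mem hu
  rw [𝒢.psiR_eq hu hw hW, 𝒢.star_fpPsiR hB, 𝒢.psiL_eq hu' (W := star W)
    (by rw [← star_mul, hw])
    (by rw [FP.of_star, hW, star_mul, FP.star_inlM hu, StarHomClass.map_star 𝒢.Δ.toHom])]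

lemma star_phiL (hB : HasLocalUnits B) (a b : A) :
    star (𝒢.phiL a b) = 𝒢.phiR (star b) (star a) := by
  rw [← star_star (𝒢.phiR _ _), 𝒢.star_phiR hB, star_star, star_star]

lemma star_psiL (hB : HasLocalUnits B) (w t : A) :
    star (𝒢.psiL w t) = 𝒢.psiR (star t) (star w) := by
  rw [← star_star (𝒢.psiR _ _), 𝒢.star_psiR hB, star_star, star_star]

lemma nu_phiL_mul (hB : HasLocalUnits B) (a b t : A) :
    𝒢.nu (𝒢.phiL a b * t) = 𝒢.nu (𝒢.psiL a t * b) := by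
  rw [← star_inj, ← nu_star, ← nu_star, star_mul, star_mul, 𝒢.star_phiL hB, 𝒢.star_psiL hB,
    nu_mul_phiR]

end MeasuredHopf

end Functionals

/-! ### Counit and antipode axioms on elements of the fiber product. -/

section CounitAntipode

variable {Γ B : Type*} [Group Γ] [NonUnitalCommRing B] [StarRing B] [Module ℂ B]
variable {act : Γ →* (B ≃⋆ₐ[ℂ] B)}
variable {A : Type*} [NonUnitalRing A] [StarRing A] [Module ℂ A]
    [IsScalarTower ℂ A A] [SMulCommClass ℂ A A] [StarModule ℂ A]
variable [IsScalarTower ℂ B B] [SMulCommClass ℂ B B] [StarModule ℂ B]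
variable {E : EvAlg act A}

namespace CrossedHom

variable {E : EvAlg act A} (ε : CrossedHom E)

lemma toFun_eq_single {γ : Γ} {a : A} (ha : a ∈ E.gr (γ, γ)) :
    ε.toFun a = Finsupp.single γ (ε.toFun a γ) := by
  classical
  ext γ'
  by_cases h : γ' = γ
  · subst h; simp
  · rw [Finsupp.single_eq_of_ne h]
    exact ε.map_gr ha γ' fun h' => h (Prod.ext_iff.1 h').1.symm

lemma toFun_eq_zero {g : Γ × Γ} {a : A} (ha : a ∈ E.gr g) (h : g.1 ≠ g.2) : ε.toFun a = 0 :=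
  Finsupp.ext fun γ => ε.map_gr ha γ fun h' => h (by rw [h'])

lemma flat_eq {γ : Γ} {a : A} (ha : a ∈ E.gr (γ, γ)) : ε.flat a = act γ⁻¹ (ε.sharp a) := by
  rw [flat, sharp_apply, ε.toFun_eq_single ha]
  rw [Finsupp.sum_single_index (by simp), Finsupp.sum_single_index (by simp)]

/-- The sum `∑ b_γ` of the coefficients. -/
def total : (Γ →₀ B) →ₗ[ℂ] B := Finsupp.lsum ℂ fun _ => LinearMap.id

lemma total_single (γ : Γ) (b : B) : total (Finsupp.single γ b) = b :=
  Finsupp.sum_single_index (h := fun _ (b : B) => b) rfl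

lemma sharp_eq_total (a : A) : ε.sharp a = total (ε.toFun a) := rfl

lemma crossedMul_add_left (f f' g : Γ →₀ B) :
    crossedMul act (f + f') g = crossedMul act f g + crossedMul act f' g := by
  classical
  exact Finsupp.sum_add_index' (by simp) fun γ b b' => by
    simp [add_mul, Finsupp.single_add, Finsupp.sum_add]

lemma crossedMul_add_right (f g g' : Γ →₀ B) :
    crossedMul act f (g + g') = crossedMul act f g + crossedMul act f g' := by
  classical
  rw [crossedMul, crossedMul, crossedMul, ← Finsupp.sum_add]
  refine Finsupp.sum_congr fun γ _ => ?_
  exact Finsupp.sum_add_index' (by simp) fun γ' b b' => by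
    simp [mul_add, Finsupp.single_add]

lemma crossedMul_single (γ γ' : Γ) (b b' : B) :
    crossedMul act (Finsupp.single γ b) (Finsupp.single γ' b') =
      Finsupp.single (γ * γ') (b * act γ b') := by
  rw [crossedMul, Finsupp.sum_single_index (by simp), Finsupp.sum_single_index (by simp)]

lemma crossedMul_zero_left (g : Γ →₀ B) : crossedMul act 0 g = 0 := Finsupp.sum_zero_index
lemma crossedMul_zero_right (f : Γ →₀ B) : crossedMul act f 0 = 0 := by
  simp [crossedMul]

lemma total_crossedMul_single_one (b : B) (h : Γ →₀ B) :
    total (crossedMul act (Finsupp.single 1 b) h) = b * total h := by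
  induction h using Finsupp.induction_linear with
  | zero => rw [crossedMul_zero_right]; simp
  | add f g hf hg => rw [crossedMul_add_right, map_add, hf, hg, map_add, mul_add]
  | single γ c =>
    rw [crossedMul_single, total_single, total_single, act_one_apply]

lemma total_crossedMul_assoc (b : B) (h f : Γ →₀ B) :
    total (crossedMul act (crossedMul act (Finsupp.single 1 b) h) f) =
      b * total (crossedMul act h f) := by
  induction h using Finsupp.induction_linear with
  | zero => simp [crossedMul_zero_right, crossedMul_zero_left]
  | add h h' hf hg =>
    rw [crossedMul_add_right, crossedMul_add_left, map_add, hf, hg, crossedMul_add_left, map_add,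
      mul_add]
  | single γ c =>
    induction f using Finsupp.induction_linear with
    | zero => simp [crossedMul_zero_right]
    | add h h' hf hg => rw [crossedMul_add_right, map_add, hf, hg, crossedMul_add_right, map_add,
        mul_add]
    | single γ' c' =>
      rw [crossedMul_single, crossedMul_single, crossedMul_single, total_single, total_single, one_mul, act_one_apply, mul_assoc]

/-- On the crossed product ♯ is not multiplicative in general, since (bγ)(b'γ') involves γ(b'). For
a left factor of degree e there is no twist. -/
lemma sharp_mul {u : A} (hu : u ∈ E.gr 1) (a : A) : ε.sharp (u * a) = ε.sharp u * ε.sharp a := by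
  have h := ε.toFun_eq_single (γ := 1) hu
  rw [sharp_eq_total, ε.map_mul, h, total_crossedMul_single_one, sharp_eq_total, h,
    total_single, Finsupp.single_eq_same, ← sharp_eq_total]

/-- Non-degeneracy of ε says that the products ε(a)f span B ⋊ Γ. Writing a = ua with u of degree e
pulls the coefficient ε^♯(u) out of the coefficient sum, so r(b)X = 0 for every b, in particular for
a local unit of X. -/
lemma eq_zero_of_r_sharp {X : A} (h : ∀ u ∈ E.gr 1, (E.r (ε.sharp u)).lft X = 0) : X = 0 := by
  suffices key : ∀ f : Γ →₀ B, (E.r (total f)).lft X = 0 by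
    obtain ⟨b, hb⟩ := E.r_units {X}
    have := key (Finsupp.single 1 b)
    rwa [total_single, hb X (by simp)] at this
  intro f
  have hf : f ∈ Submodule.span ℂ {x | ∃ a f, x = crossedMul act (ε.toFun a) f} := by
    rw [ε.span_lft]; trivial
  refine Submodule.span_induction ?_ (by simp) ?_ ?_ hf
  · rintro _ ⟨a, f, rfl⟩
    obtain ⟨u, hu, ha⟩ := E.unit1 a
    have h1 := ε.toFun_eq_single (γ := 1) hu
    have h2 : ε.sharp u = ε.toFun u 1 := by rw [sharp_eq_total, h1, total_single, Finsupp.single_eq_same]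
    rw [← ha, ε.map_mul, h1, total_crossedMul_assoc, mul_comm, _root_.map_mul E.r, Mult.mul_lft, ← h2, h u hu,
      map_zero]
  · intro x y _ _ hx hy; rw [map_add, map_add, Mult.add_lft, hx, hy, add_zero]
  · intro z x _ hx; rw [map_smul, map_smul, Mult.smul_lft, hx, smul_zero]

lemma epsId_tm {g h : Γ × Γ} {a c : A} (e : g.2 = h.1) (ha : a ∈ E.gr g) (hc : c ∈ E.gr h) :
    ε.epsId (FP.tm a c) = (E.r (ε.sharp a)).lft c := FP.lift_tm _ _ e ha hc

end CrossedHom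

/-- The counit axiom concerns multipliers; this is its version for the element Δ(a)(1 ⊗ v).
Multiplication by u ⊗ y from the left turns W into (u ⊗ y)Δ(a)(1 ⊗ v), to which the axiom applies,
and the factor r(ε^♯(u)) is removed by `eq_zero_of_r_sharp`. -/
lemma IsCounit.epsId_eq {Δ : Comul E} {ε : CrossedHom E} (hε : IsCounit Δ ε) {a v : A}
    (hv : v ∈ E.gr 1) {W : FP E E}
    (hW : Mult.of W = Δ.toHom a * FP.inrM (Mult.of v) (E.of_mem hv)) : ε.epsId W = a * v := by
  rw [← sub_eq_zero]
  refine ε.eq_zero_of_r_sharp fun u hu => ?_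
  obtain ⟨y, hy, hX⟩ := E.unit1 ((E.r (ε.sharp u)).lft (ε.epsId W - a * v))
  have h1 : ∀ W, ε.epsId (FP.tm u y * W) = y * (E.r (ε.sharp u)).lft (ε.epsId W) := by
    intro W
    refine FP.induction (p := fun W => ε.epsId (FP.tm u y * W) =
      y * (E.r (ε.sharp u)).lft (ε.epsId W)) (by simp)
      (fun x y hx hy => by simp only [mul_add, map_add, hx, hy]) ?_ W
    intro g h p q e hp hq
    rw [FP.tm_mul_tm (g := 1) (h := 1) rfl hu hy e hp hq, ε.epsId_tm e
      (by simpa using E.mul_mem hu hp) (by simpa using E.mul_mem hy hq), ε.epsId_tm e hp hq,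
      ε.sharp_mul hu, _root_.map_mul E.r, Mult.mul_lft, E.mul_r y _ hy, E.mul_r y _ hy, Prod.fst_one,
      act_one_apply, act_one_apply]
  have h2 : FP.tm u y * W = (FP.inrM (Mult.of v) (E.of_mem hv)).rgt
      ((Δ.toHom a).rgt (FP.tm u y)) := by
    apply (FP.ev E E).of_injective
    rw [map_mul, hW, of_rgt_eq, of_rgt_eq, mul_assoc]
  have h3 : ∀ Z, ε.epsId ((FP.inrM (Mult.of v) (E.of_mem hv)).rgt Z) = ε.epsId Z * v := by
    intro Z
    refine FP.induction (p := fun Z => ε.epsId ((FP.inrM (Mult.of v) (E.of_mem hv)).rgt Z) =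
      ε.epsId Z * v) (by simp) (fun x y hx hy => by simp only [map_add, add_mul, hx, hy]) ?_ Z
    intro g h p q e hp hq
    rw [FP.inrM_rgt _ e hp hq, Mult.of_rgt, ε.epsId_tm e hp (by simpa using E.mul_mem hq hv),
      ε.epsId_tm e hp hq, Mult.lft_mul]
  have h4 : ε.epsId ((Δ.toHom a).rgt (FP.tm u y)) = ε.epsId (FP.tm u y) * a := by
    apply E.of_injective
    rw [map_mul]; exact (hε.epsId a _).2.symm
  rw [← hX, map_sub, mul_sub, ← h1, h2, h3, h4, ε.epsId_tm (g := 1) (h := 1) rfl hu hy, mul_assoc,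
    ← Mult.lft_mul, sub_eq_zero]
  rw [E.mul_r y _ hy, Prod.fst_one, act_one_apply, Mult.lft_mul]

namespace FP

lemma proj_mem (g : Γ × Γ) (a : A) : proj E (· = g) a ∈ E.gr g := by
  refine E.hinduction (p := fun a => proj E (· = g) a ∈ E.gr g) (by simp)
    (fun x y hx hy => by rw [map_add]; exact add_mem hx hy) (fun h a ha => ?_) a
  by_cases e : h = g
  · subst e; rw [proj_of (P := (· = h)) ha rfl]; exact ha
  · rw [proj_of_not ha e]; exact zero_mem _

end FP

namespace AntiIso

variable {E : EvAlg act A} (S : AntiIso E)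

/-- S intertwines the projections onto the homogeneous components, and it is injective; hence S⁻¹
respects the grading as well. -/
lemma mem_of_map_mem {γ γ' : Γ} {a : A} (h : S.toEquiv a ∈ E.gr (γ'⁻¹, γ⁻¹)) :
    a ∈ E.gr (γ, γ') := by
  have key : S.toEquiv.toLinearMap ∘ₗ FP.proj E (· = (γ, γ')) =
      FP.proj E (· = (γ'⁻¹, γ⁻¹)) ∘ₗ S.toEquiv.toLinearMap := by
    refine E.hext fun g x hx => ?_
    simp only [LinearMap.comp_apply, LinearEquiv.coe_coe]
    have hS : S.toEquiv x ∈ E.gr (g.2⁻¹, g.1⁻¹) := S.map_gr hx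
    by_cases e : g = (γ, γ')
    · rw [FP.proj_of hx e, FP.proj_of hS (by rw [e])]
    · rw [FP.proj_of_not hx e, FP.proj_of_not hS, map_zero]
      intro h'
      exact e (Prod.ext (by simpa using (Prod.ext_iff.1 h').2) (by simpa using (Prod.ext_iff.1 h').1))
  have h1 := LinearMap.congr_fun key a
  simp only [LinearMap.comp_apply, LinearEquiv.coe_coe] at h1
  rw [FP.proj_of (P := (· = (γ'⁻¹, γ⁻¹))) h rfl] at h1
  rw [← S.toEquiv.injective h1]
  exact FP.proj_mem _ _

lemma map_gr_one {a : A} (ha : a ∈ E.gr 1) : S.toEquiv a ∈ E.gr 1 := by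
  have := S.map_gr (γ := 1) (γ' := 1) ha
  rwa [inv_one] at this

lemma symm_mem {γ γ' : Γ} {a : A} (ha : a ∈ E.gr (γ, γ')) :
    S.toEquiv.symm a ∈ E.gr (γ'⁻¹, γ⁻¹) :=
  S.mem_of_map_mem (by simpa using ha)

/-- `x ⊗̃ y ↦ S(x)y`. -/
def fpMul : FP E E →ₗ[ℂ] A := S.mulS_id ∘ₗ E.toL

lemma fpMul_tm {g h : Γ × Γ} {a c : A} (e : g.2 = h.1) (ha : a ∈ E.gr g) (hc : c ∈ E.gr h) :
    S.fpMul (FP.tm a c) = S.toEquiv a * c := by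
  rw [fpMul, LinearMap.comp_apply, E.toL_tm e ha hc]; rfl

lemma flipMap_tm {g h : Γ × Γ} {a c : A} (e : g.2 = h.1) (ha : a ∈ E.gr g) (hc : c ∈ E.gr h) :
    S.flipMap (FP.tm a c) = FP.tm (S.toEquiv c) (S.toEquiv a) := FP.lift_tm _ _ e ha hc

lemma flipMap_surjective : Function.Surjective S.flipMap := by
  intro z
  refine FP.induction (p := fun z => ∃ w, S.flipMap w = z) ⟨0, map_zero _⟩ ?_ ?_ z
  · rintro x y ⟨w, rfl⟩ ⟨w', rfl⟩; exact ⟨w + w', map_add _ _ _⟩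
  · intro g h a c e ha hc
    refine ⟨FP.tm (S.toEquiv.symm c) (S.toEquiv.symm a), ?_⟩
    rw [S.flipMap_tm (by simp [e]) (S.symm_mem (γ := h.1) (γ' := h.2) hc)
      (S.symm_mem (γ := g.1) (γ' := g.2) ha)]
    simp

lemma flipMap_mul (x y : FP E E) : S.flipMap (x * y) = S.flipMap y * S.flipMap x := by
  refine FP.induction (p := fun x => S.flipMap (x * y) = S.flipMap y * S.flipMap x) (by simp)
    (fun x x' h h' => by simp only [add_mul, mul_add, map_add, h, h']) ?_ x
  intro g h a c e ha hc
  refine FP.induction (p := fun y => S.flipMap (FP.tm a c * y) =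
    S.flipMap y * S.flipMap (FP.tm a c)) (by simp)
    (fun x x' h h' => by simp only [add_mul, mul_add, map_add, h, h']) ?_ y
  intro g' h' a' c' e' ha' hc'
  have k : ∀ {g h : Γ × Γ}, g.2 = h.1 → ((h.2⁻¹, h.1⁻¹) : Γ × Γ).2 = ((g.2⁻¹, g.1⁻¹) : Γ × Γ).1 :=
    fun e => by simp [e]
  rw [FP.tm_mul_tm e ha hc e' ha' hc', S.flipMap_tm (by simp [e, e']) (E.mul_mem ha ha')
    (E.mul_mem hc hc'), S.flipMap_tm e ha hc, S.flipMap_tm e' ha' hc', S.map_mul, S.map_mul,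
    FP.tm_mul_tm (k e') (S.map_gr hc') (S.map_gr ha') (k e) (S.map_gr hc) (S.map_gr ha)]

lemma flipMap_inrM_rgt {v : A} (hv : v ∈ E.gr 1) (z : FP E E) :
    S.flipMap ((FP.inrM (Mult.of v) (E.of_mem hv)).rgt z) =
      (FP.inlM (Mult.of (S.toEquiv v)) (E.of_mem (S.map_gr_one hv))).lft (S.flipMap z) := by
  refine FP.induction (p := fun z => S.flipMap ((FP.inrM (Mult.of v) (E.of_mem hv)).rgt z) =
      (FP.inlM (Mult.of (S.toEquiv v)) (E.of_mem (S.map_gr_one hv))).lft (S.flipMap z)) (by simp)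
    (fun x y hx hy => by simp only [map_add, hx, hy]) ?_ z
  intro g h a c e ha hc
  rw [FP.inrM_rgt _ e ha hc, Mult.of_rgt, S.flipMap_tm e ha (by simpa using E.mul_mem hc hv),
    S.flipMap_tm e ha hc, FP.inlM_lft (k := (h.2⁻¹, h.1⁻¹)) (l := (g.2⁻¹, g.1⁻¹)) _ (by simp [e])
    (S.map_gr hc) (S.map_gr ha), Mult.of_lft, S.map_mul]

lemma flipMap_inrM_lft {v : A} (hv : v ∈ E.gr 1) (z : FP E E) :
    S.flipMap ((FP.inrM (Mult.of v) (E.of_mem hv)).lft z) =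
      (FP.inlM (Mult.of (S.toEquiv v)) (E.of_mem (S.map_gr_one hv))).rgt (S.flipMap z) := by
  refine FP.induction (p := fun z => S.flipMap ((FP.inrM (Mult.of v) (E.of_mem hv)).lft z) =
      (FP.inlM (Mult.of (S.toEquiv v)) (E.of_mem (S.map_gr_one hv))).rgt (S.flipMap z)) (by simp)
    (fun x y hx hy => by simp only [map_add, hx, hy]) ?_ z
  intro g h a c e ha hc
  rw [FP.inrM_lft _ e ha hc, Mult.of_lft, S.flipMap_tm e ha (by simpa using E.mul_mem hv hc),
    S.flipMap_tm e ha hc, FP.inlM_rgt (k := (h.2⁻¹, h.1⁻¹)) (l := (g.2⁻¹, g.1⁻¹)) _ (by simp [e])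
    (S.map_gr hc) (S.map_gr ha), Mult.of_rgt, S.map_mul]

end AntiIso

namespace IsAntipode

variable {Δ : Comul E} {ε : CrossedHom E} {S : AntiIso E} (hS : IsAntipode Δ ε S)
include hS

/-- Antipode and flip send Δ(x)(1 ⊗ v) to (S(v) ⊗ 1)Δ(S(x)). The axiom only gives this on the range
of `flipMap`, which is everything. -/
lemma of_flipMap_mul_inrM {x v : A} (hv : v ∈ E.gr 1) {W : FP E E}
    (hW : Mult.of W = Δ.toHom x * FP.inrM (Mult.of v) (E.of_mem hv)) :
    Mult.of (S.flipMap W) =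
      FP.inlM (Mult.of (S.toEquiv v)) (E.of_mem (S.map_gr_one hv)) * Δ.toHom (S.toEquiv x) := by
  refine Mult.ext (fun z => ?_) fun z => ?_
  · obtain ⟨z, rfl⟩ := S.flipMap_surjective z
    rw [Mult.of_lft, ← S.flipMap_mul, Mult.mul_lft, ← (hS.comul x z).2, ← S.flipMap_inrM_rgt hv,
      ← Mult.mul_rgt, ← hW, Mult.of_rgt]
  · obtain ⟨z, rfl⟩ := S.flipMap_surjective z
    rw [Mult.of_rgt, ← S.flipMap_mul, Mult.mul_rgt, ← S.flipMap_inrM_lft hv, ← (hS.comul x _).1,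
      ← Mult.mul_lft, ← hW, Mult.of_lft]

lemma of_flipMap_inrM_mul {x v : A} (hv : v ∈ E.gr 1) {W : FP E E}
    (hW : Mult.of W = FP.inrM (Mult.of v) (E.of_mem hv) * Δ.toHom x) :
    Mult.of (S.flipMap W) = Δ.toHom (S.toEquiv x) *
      FP.inlM (Mult.of (S.toEquiv v)) (E.of_mem (S.map_gr_one hv)) := by
  refine Mult.ext (fun z => ?_) fun z => ?_
  · obtain ⟨z, rfl⟩ := S.flipMap_surjective z
    rw [Mult.of_lft, ← S.flipMap_mul, Mult.mul_lft, ← S.flipMap_inrM_rgt hv, ← (hS.comul x _).2,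
      ← Mult.mul_rgt, ← hW, Mult.of_rgt]
  · obtain ⟨z, rfl⟩ := S.flipMap_surjective z
    rw [Mult.of_rgt, ← S.flipMap_mul, Mult.mul_rgt, ← (hS.comul x z).1, ← S.flipMap_inrM_lft hv,
      ← Mult.mul_lft, ← hW, Mult.of_lft]

/-- S(f₁x)f₂c = S(x)·S(f₁)f₂c, and the antipode axiom collapses the last two factors. -/
lemma fpMul_lft {f x c : A} {k l : Γ × Γ} (e : k.2 = l.1) (hx : x ∈ E.gr k) (hc : c ∈ E.gr l) :
    S.fpMul ((Δ.toHom f).lft (FP.tm x c)) = S.toEquiv x * (E.s (ε.flat f)).lft c := by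
  obtain ⟨v, hv, h⟩ := E.unit1 c
  obtain ⟨W, hW⟩ := Δ.exists_mul_inrM f hv
  have h1 : (Δ.toHom f).lft (FP.tm x c) = W * FP.tm x c := by
    rw [← Mult.of_lft, hW, Mult.mul_lft, FP.inrM_lft _ e hx hc, Mult.of_lft, h]
  have h2 : ∀ W, S.fpMul (W * FP.tm x c) = S.toEquiv x * S.mulS_id (E.mulSnd c (E.toL W)) := by
    intro W
    refine FP.induction (p := fun W => S.fpMul (W * FP.tm x c) =
      S.toEquiv x * S.mulS_id (E.mulSnd c (E.toL W))) (by simp)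
      (fun x y hx hy => by simp only [map_add, mul_add, add_mul, hx, hy]) ?_ W
    intro g h p q e' hp hq
    rw [FP.tm_mul_tm e' hp hq e hx hc, S.fpMul_tm (by simp [e, e']) (E.mul_mem hp hx)
      (E.mul_mem hq hc), E.toL_tm e' hp hq, E.mulSnd_tmL, S.map_mul, mul_assoc]
    rfl
  rw [h1, h2, ← Δ.mulInr_eq hv h hW, hS.left]

end IsAntipode

end CounitAntipode

/-! ### Strong left invariance. -/

section StrongInvariance

variable {Γ B : Type*} [Group Γ] [NonUnitalCommRing B] [StarRing B] [Module ℂ B]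
variable {act : Γ →* (B ≃⋆ₐ[ℂ] B)}
variable {A : Type*} [NonUnitalRing A] [StarRing A] [Module ℂ A]
    [IsScalarTower ℂ A A] [SMulCommClass ℂ A A] [StarModule ℂ A]
variable [IsScalarTower ℂ B B] [SMulCommClass ℂ B B] [StarModule ℂ B]
variable {E : EvAlg act A}


namespace EvAlg

lemma of_eq_mem (E : EvAlg act A) {g : Γ × Γ} {w : A} {T : Mult A} (h : Mult.of w = T)
    (hT : T ∈ E.multGr g) : w ∈ E.gr g := E.mem_of_of_mem_multGr (h ▸ hT)

end EvAlg

namespace Comul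

variable (Δ : Comul E)

section
variable {g : Γ × Γ} {a u : A} (ha : a ∈ E.gr g) (hu : u ∈ E.gr 1) {W : FP E E}
include ha

lemma mem_of_mul_inlM (h : Mult.of W = Δ.toHom a * FP.inlM (Mult.of u) (E.of_mem hu)) :
    W ∈ (FP.ev E E).gr g := (FP.ev E E).of_eq_mem h (by
  simpa using (FP.ev E E).multGr_mul (Δ.map_gr ha) (FP.inlM_mem hu))

lemma mem_of_mul_inrM (h : Mult.of W = Δ.toHom a * FP.inrM (Mult.of u) (E.of_mem hu)) :
    W ∈ (FP.ev E E).gr g := (FP.ev E E).of_eq_mem h (by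
  simpa using (FP.ev E E).multGr_mul (Δ.map_gr ha) (FP.inrM_mem hu))

lemma mem_of_inrM_mul (h : Mult.of W = FP.inrM (Mult.of u) (E.of_mem hu) * Δ.toHom a) :
    W ∈ (FP.ev E E).gr g := (FP.ev E E).of_eq_mem h (by
  simpa using (FP.ev E E).multGr_mul (FP.inrM_mem hu) (Δ.map_gr ha))

end

lemma lft_mem {f : A} {X : FP E E} {g k : Γ × Γ} (hf : f ∈ E.gr g) (hX : X ∈ (FP.ev E E).gr k) :
    (Δ.toHom f).lft X ∈ (FP.ev E E).gr (g * k) := (Δ.map_gr hf k X hX).1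

end Comul

namespace MeasuredHopf

variable (𝒢 : MeasuredHopf E)

/-- φ kills every term in which the second leg times b does not have degree e. The surviving terms
have a second leg whose first degree is that of b⁻¹ in Γ, which by matching fixes the first leg. -/
lemma phiL_mem {α β : Γ × Γ} {a b : A} (ha : a ∈ E.gr α) (hb : b ∈ E.gr β) :
    𝒢.phiL a b ∈ E.gr (α.1, β.1⁻¹) := by
  obtain ⟨v, hv, h⟩ := E.unit1 b
  obtain ⟨W, hW⟩ := 𝒢.Δ.exists_mul_inrM a hv
  rw [𝒢.phiL_eq hv h hW]
  refine FP.grade_induction (p := fun W => 𝒢.fpPhiL b W ∈ E.gr (α.1, β.1⁻¹)) (by simp)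
    (fun x y hx hy => by rw [map_add]; exact add_mem hx hy) ?_ (𝒢.Δ.mem_of_mul_inrM ha hv hW)
  rintro p q f c e hf hc rfl
  rw [𝒢.fpPhiL_tm e hf hc]
  by_cases hq : q * β = 1
  · refine E.s_mem _ ?_
    have : p = (p.1, β.1⁻¹) := Prod.ext rfl (by
      rw [e]; exact eq_inv_of_mul_eq_one_left (congrArg Prod.fst hq))
    simpa [← this] using hf
  · rw [𝒢.phi_eq_zero (E.mul_mem hc hb) hq]; simp

lemma phiR_mem {α β : Γ × Γ} {a b : A} (ha : a ∈ E.gr α) (hb : b ∈ E.gr β) :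
    𝒢.phiR a b ∈ E.gr (β.1, α.1⁻¹) := by
  obtain ⟨v, hv, h⟩ := E.runit1 a
  obtain ⟨W, hW⟩ := 𝒢.Δ.exists_inrM_mul b hv
  rw [𝒢.phiR_eq hv h hW]
  refine FP.grade_induction (p := fun W => 𝒢.fpPhiR a W ∈ E.gr (β.1, α.1⁻¹)) (by simp)
    (fun x y hx hy => by rw [map_add]; exact add_mem hx hy) ?_ (𝒢.Δ.mem_of_inrM_mul hb hv hW)
  rintro p q f c e hf hc rfl
  rw [𝒢.fpPhiR_tm e hf hc]
  by_cases hq : α * q = 1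
  · refine E.s_rgt_mem _ ?_
    have : p = (p.1, α.1⁻¹) := Prod.ext rfl (by
      rw [e]; exact eq_inv_of_mul_eq_one_right (congrArg Prod.fst hq))
    simpa [← this] using hf
  · rw [𝒢.phi_eq_zero (E.mul_mem ha hc) hq]; simp

/-- `x ⊗̃ y ↦ s(φ(y))x`. -/
def fpPhi : FP E E →ₗ[ℂ] A := 𝒢.φ.sliceL ∘ₗ E.toL

lemma fpPhi_tm {g h : Γ × Γ} {x y : A} (e : g.2 = h.1) (hx : x ∈ E.gr g) (hy : y ∈ E.gr h) :
    𝒢.fpPhi (FP.tm x y) = (E.s (𝒢.φ.toFun y)).lft x := by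
  rw [fpPhi, LinearMap.comp_apply, E.toL_tm e hx hy]; rfl

lemma fpPhi_r_lft (b : B) (Y : FP E E) :
    𝒢.fpPhi ((FP.rHom E E b).lft Y) = (E.r b).lft (𝒢.fpPhi Y) :=
  LinearMap.congr_fun (f := 𝒢.fpPhi ∘ₗ (FP.rHom E E b).lft) (g := (E.r b).lft ∘ₗ 𝒢.fpPhi)
    (FP.hext fun g h x y e hx hy => by
      simp only [LinearMap.comp_apply]
      rw [FP.rHom_lft E E b e hx hy, 𝒢.fpPhi_tm e (E.r_mem b hx) hy, 𝒢.fpPhi_tm e hx hy,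
        E.r_lft_s_lft]) Y

/-- Left invariance of φ, with Δ(b) cut down in its first leg. -/
lemma fpPhi_mul_inlM {b t : A} (ht : t ∈ E.gr 1) {Y : FP E E}
    (hY : Mult.of Y = 𝒢.Δ.toHom b * FP.inlM (Mult.of t) (E.of_mem ht)) :
    𝒢.fpPhi Y = (E.r (𝒢.φ.toFun b)).lft t := by
  obtain ⟨u, hu, h⟩ := E.unit1 t
  obtain ⟨W, hW⟩ := 𝒢.Δ.exists_mul_inlM b hu
  have h1 : Y = (FP.inlM (Mult.of t) (E.of_mem ht)).rgt W := by
    apply (FP.ev E E).of_injective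
    rw [of_rgt_eq, hW, hY, mul_assoc, FP.inlM_mul hu ht]
    simp only [h]
  rw [← (𝒢.left_integral b t).1, 𝒢.Δ.mulInl_eq hu h hW, h1, fpPhi, LinearMap.comp_apply,
    E.toL_inlM_rgt ht]

/-- `x ⊗̃ (y ⊗̃ z) ↦ S(x) s(φ(z))y`. -/
def antiPhi : FP E (FP.ev E E) →ₗ[ℂ] A :=
  FP.lift ((LinearMap.mul ℂ A).compl₁₂ 𝒢.S.toEquiv.toLinearMap 𝒢.fpPhi) fun g h x Y b e hx hY => by
    simp only [LinearMap.compl₁₂_apply, LinearEquiv.coe_coe, LinearMap.mul_apply']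
    rw [𝒢.S.map_s_lft, Mult.mid]
    exact congrArg _ (𝒢.fpPhi_r_lft b Y).symm

lemma antiPhi_tm {g h : Γ × Γ} {x : A} {Y : FP E E} (e : g.2 = h.1) (hx : x ∈ E.gr g)
    (hY : Y ∈ (FP.ev E E).gr h) : 𝒢.antiPhi (FP.tm x Y) = 𝒢.S.toEquiv x * 𝒢.fpPhi Y :=
  FP.lift_tm _ _ e hx hY

lemma antiPhi_assocAux {g h : Γ × Γ} {X : FP E E} {d : A} (e : g.2 = h.1)
    (hX : X ∈ (FP.ev E E).gr g) (hd : d ∈ E.gr h) :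
    𝒢.antiPhi (FP.assocAux X d) = (E.s (𝒢.φ.toFun d)).rgt (𝒢.S.fpMul X) := by
  refine FP.grade_induction (p := fun X => 𝒢.antiPhi (FP.assocAux X d) =
    (E.s (𝒢.φ.toFun d)).rgt (𝒢.S.fpMul X)) (by simp)
    (fun x y hx hy => by simp only [map_add, LinearMap.add_apply, hx, hy]) ?_ hX
  rintro p q x c e' hx hc rfl
  rw [FP.assocAux_tm e' hx hc, 𝒢.antiPhi_tm (h := (q.1, h.2)) e' hx (FP.tm_mem (g := q) e hc hd),
    𝒢.fpPhi_tm (g := q) e hc hd, ← 𝒢.s_phi_comm (g := q) e hc hd, 𝒢.S.fpMul_tm e' hx hc, Mult.rgt_mul]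

/-- One side of strong invariance: in ∑ S(f₁x) f₂c s(φ(gd)) the antipode axiom produces s(ε^♭(f)),
which is then absorbed by φ as ε^♯(f), giving ε ⊗ id on the tensor f ⊗ g. -/
lemma antiPhi_map_toHom_id {k l m : Γ × Γ} {x c d : A} (e : k.2 = l.1) (e' : l.2 = m.1)
    (hx : x ∈ E.gr k) (hc : c ∈ E.gr l) (hd : d ∈ E.gr m) (W : FP E E) :
    𝒢.antiPhi (FP.assoc ((FP.map 𝒢.Δ.toEvHom (EvHom.id E) W).lft (FP.tm (FP.tm x c) d))) =
      𝒢.S.toEquiv x * (E.s (𝒢.φ.toFun (𝒢.ε.epsId W * d))).rgt c := by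
  refine FP.induction (p := fun W =>
    𝒢.antiPhi (FP.assoc ((FP.map 𝒢.Δ.toEvHom (EvHom.id E) W).lft (FP.tm (FP.tm x c) d))) =
      𝒢.S.toEquiv x * (E.s (𝒢.φ.toFun (𝒢.ε.epsId W * d))).rgt c) (by simp)
    (fun x y hx hy => by
      simp only [map_add, Mult.add_lft, add_mul, Mult.add_rgt, mul_add, hx, hy]) ?_ W
  intro p q f g' ep hf hg
  have hX : FP.tm x c ∈ (FP.ev E E).gr (k.1, l.2) := FP.tm_mem e hx hc
  rw [𝒢.Δ.map_toHom_id_tm ep hf hg (k := (k.1, l.2)) (l := m) e' hX hd, FP.assoc,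
    FP.lift_tm _ _ (g := p * (k.1, l.2)) (h := q * m) (by simp [ep, e'])
      (𝒢.Δ.lft_mem hf hX) (E.mul_mem hg hd),
    𝒢.antiPhi_assocAux (g := p * (k.1, l.2)) (h := q * m) (by simp [ep, e'])
      (𝒢.Δ.lft_mem hf hX) (E.mul_mem hg hd),
    𝒢.antipode.fpMul_lft e hx hc, 𝒢.ε.epsId_tm ep hf hg, ← Mult.lft_mul, 𝒢.φ.map_lft,
    _root_.map_mul E.s, Mult.mul_rgt, Mult.rgt_mul]
  by_cases hq : q * m = 1
  · by_cases hp : p.1 = p.2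
    · obtain ⟨γ, γ'⟩ := p
      obtain rfl : γ = γ' := hp
      -- If φ(gd) does not vanish for degree reasons, c has second degree γ⁻¹. The twist in ε^♭(f) =
      -- γ⁻¹(ε^♯(f)) is then exactly the one picked up by moving s(ε^♯(f)) past c.
      have h1 : l.2 = γ⁻¹ := by
        rw [e', eq_inv_of_mul_eq_one_right (congrArg Prod.fst hq)]
        exact congrArg _ ep.symm
      rw [𝒢.ε.flat_eq hf, E.twist_s (𝒢.ε.sharp f) hc, h1]
    · rw [CrossedHom.sharp_eq_total, CrossedHom.flat, 𝒢.ε.toFun_eq_zero hf hp]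
      simp
  · rw [𝒢.phi_eq_zero (E.mul_mem hg hd) hq]; simp

/-- The other side of strong invariance: Δ(g')Y is Δ(g'b)(t ⊗ 1), and left invariance replaces its
slice by r(φ(g'b))t; the antipode turns this r into the factor s of `phiL`. -/
lemma antiPhi_map_id_toHom {b t : A} (ht : t ∈ E.gr 1) {Y : FP E E}
    (hY : Mult.of Y = 𝒢.Δ.toHom b * FP.inlM (Mult.of t) (E.of_mem ht)) {k l : Γ × Γ} {x : A}
    (e : k.2 = l.1) (hx : x ∈ E.gr k) (hYl : Y ∈ (FP.ev E E).gr l) (W : FP E E) :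
    𝒢.antiPhi ((FP.map (EvHom.id E) 𝒢.Δ.toEvHom W).lft (FP.tm x Y)) =
      𝒢.S.toEquiv x * (𝒢.S.toEquiv (𝒢.fpPhiL b W) * t) := by
  refine FP.induction (p := fun W =>
    𝒢.antiPhi ((FP.map (EvHom.id E) 𝒢.Δ.toEvHom W).lft (FP.tm x Y)) =
      𝒢.S.toEquiv x * (𝒢.S.toEquiv (𝒢.fpPhiL b W) * t)) (by simp)
    (fun x y hx hy => by
      simp only [map_add, Mult.add_lft, add_mul, mul_add, hx, hy]) ?_ W
  intro p q f g' ep hf hg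
  have h1 : Mult.of ((𝒢.Δ.toHom g').lft Y) =
      𝒢.Δ.toHom (g' * b) * FP.inlM (Mult.of t) (E.of_mem ht) := by
    rw [of_lft_eq, hY, map_mul 𝒢.Δ.toHom, mul_assoc]
  rw [𝒢.Δ.map_id_toHom_tm ep hf hg e hx hYl, 𝒢.antiPhi_tm (g := p * k) (h := q * l)
    (by simp [ep, e]) (E.mul_mem hf hx) (𝒢.Δ.lft_mem hg hYl), 𝒢.fpPhi_mul_inlM ht h1,
    𝒢.S.map_mul, 𝒢.fpPhiL_tm ep hf hg, 𝒢.S.map_s_lft, Mult.mid, mul_assoc]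

/-- Coassociativity moves the computation to (Δ ⊗ id)Δ(a), where the counit reduces the inner term
to a itself. -/
lemma antiPhi_lft {a : A} {U : Mult (FP (FP.ev E E) E)} {V : Mult (FP E (FP.ev E E))}
    (hU : Extends (FP.map 𝒢.Δ.toEvHom (EvHom.id E)) (𝒢.Δ.toHom a) U)
    (hUV : ∀ {k l m : Γ × Γ} {x c d : A}, k.2 = l.1 → l.2 = m.1 → x ∈ E.gr k → c ∈ E.gr l →
      d ∈ E.gr m → FP.assoc (U.lft (FP.tm (FP.tm x c) d)) = V.lft (FP.tm x (FP.tm c d)))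
    {k l : Γ × Γ} {x : A} {Y : FP E E} (e : k.2 = l.1) (hx : x ∈ E.gr k)
    (hY : Y ∈ (FP.ev E E).gr l) :
    𝒢.antiPhi (V.lft (FP.tm x Y)) = 𝒢.S.toEquiv x * 𝒢.fpPhiR a Y := by
  refine FP.grade_induction (p := fun Y => 𝒢.antiPhi (V.lft (FP.tm x Y)) =
    𝒢.S.toEquiv x * 𝒢.fpPhiR a Y) (by simp)
    (fun x y hx hy => by simp only [map_add, mul_add, hx, hy]) ?_ hY
  rintro p q c d e' hc hd rfl
  obtain ⟨v, hv, h⟩ := E.unit1 d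
  obtain ⟨W, hW⟩ := 𝒢.Δ.exists_mul_inrM a hv
  rw [← hUV (l := p) e e' hx hc hd, 𝒢.Δ.extends_toHom_id hU hv hW (k := (k.1, p.2)) e' (FP.tm_mem e hx hc) hd h,
    𝒢.antiPhi_map_toHom_id (l := p) e e' hx hc hd, 𝒢.counit.epsId_eq hv hW, mul_assoc, h,
    𝒢.fpPhiR_tm e' hc hd]

lemma fpPhiR_inlM_rgt {t : A} (ht : t ∈ E.gr 1) (c : A) (W : FP E E) :
    𝒢.fpPhiR c ((FP.inlM (Mult.of t) (E.of_mem ht)).rgt W) = 𝒢.fpPhiR c W * t :=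
  LinearMap.congr_fun (f := 𝒢.fpPhiR c ∘ₗ (FP.inlM (Mult.of t) (E.of_mem ht)).rgt)
    (g := LinearMap.mulRight ℂ t ∘ₗ 𝒢.fpPhiR c) (FP.hext fun g h x y e hx hy => by
      simp only [LinearMap.comp_apply, LinearMap.mulRight_apply]
      rw [FP.inlM_rgt _ e hx hy, Mult.of_rgt, 𝒢.fpPhiR_tm e (by simpa using E.mul_mem hx ht) hy,
        𝒢.fpPhiR_tm e hx hy, Mult.rgt_mul, Mult.mid, E.twist_s _ ht, Prod.snd_one,
        act_one_apply]) W

lemma fpPhiR_mul_inlM {b u : A} (hu : u ∈ E.gr 1) {X : FP E E}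
    (hX : Mult.of X = 𝒢.Δ.toHom b * FP.inlM (Mult.of u) (E.of_mem hu)) (c : A) :
    𝒢.fpPhiR c X = 𝒢.phiR c b * u := by
  obtain ⟨v, hv, hc⟩ := E.runit1 c
  obtain ⟨W, hW⟩ := 𝒢.Δ.exists_inrM_mul b hv
  rw [𝒢.phiR_eq hv hc hW, ← 𝒢.fpPhiR_inlM_rgt hu]
  conv_lhs => rw [← hc]
  rw [← 𝒢.fpPhiR_inrM hv]
  congr 1
  apply (FP.ev E E).of_injective
  rw [of_lft_eq, of_rgt_eq, hW, hX, mul_assoc]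

/-- Strong left invariance. -/
lemma S_phiL (a b : A) : 𝒢.S.toEquiv (𝒢.phiL a b) = 𝒢.phiR a b := by
  classical
  refine E.hinduction (p := fun a => 𝒢.S.toEquiv (𝒢.phiL a b) = 𝒢.phiR a b) (by simp)
    (fun x y hx hy => by simp only [map_add, LinearMap.add_apply, hx, hy]) (fun α a ha => ?_) a
  refine E.hinduction (p := fun b => 𝒢.S.toEquiv (𝒢.phiL a b) = 𝒢.phiR a b) (by simp)
    (fun x y hx hy => by simp only [map_add, hx, hy]) (fun β b hb => ?_) b
  set D := 𝒢.S.toEquiv (𝒢.phiL a b) - 𝒢.phiR a b with hD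
  have hDm : D ∈ E.gr (β.1, α.1⁻¹) := by
    refine sub_mem ?_ (𝒢.phiR_mem ha hb)
    simpa using 𝒢.S.map_gr (𝒢.phiL_mem ha hb)
  obtain ⟨t, ht, htD⟩ := E.runit1 D
  -- The two evaluations of `antiPhi` are compared on x ⊗ Δ(b)(t ⊗ 1); they differ by S(x)Dt.
  obtain ⟨Y, hY⟩ := 𝒢.Δ.exists_mul_inlM b ht
  obtain ⟨U, V, hU, hV, hUV⟩ := 𝒢.Δ.coassoc_lft a
  have hYβ := 𝒢.Δ.mem_of_mul_inlM hb ht hY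
  obtain ⟨v, hv, hvb⟩ := E.unit1 b
  obtain ⟨W, hW⟩ := 𝒢.Δ.exists_mul_inrM a hv
  have hvY : (𝒢.Δ.toHom v).lft Y = Y := by
    apply (FP.ev E E).of_injective
    rw [of_lft_eq, hY, ← mul_assoc, ← map_mul 𝒢.Δ.toHom, hvb]
  have h1 : 𝒢.fpPhiR a Y = 𝒢.phiR a b * t := 𝒢.fpPhiR_mul_inlM ht hY a
  -- The test element x = S⁻¹(D^*) makes S(x)Dt equal to D^*D. For homogeneous a and b its second
  -- degree is the first degree of Y, so that x ⊗ Y is a matched tensor.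
  have hx : 𝒢.S.toEquiv.symm (star D) ∈ E.gr (α.1⁻¹, β.1) := by
    simpa using 𝒢.S.symm_mem (γ := β.1⁻¹) (γ' := α.1) (by simpa using E.star_mem hDm)
  have h2 := 𝒢.antiPhi_lft hU hUV (k := (α.1⁻¹, β.1)) (l := β) rfl hx hYβ
  rw [𝒢.Δ.extends_id_toHom_of_inrM hV hv hW (k := (α.1⁻¹, β.1)) (l := β) rfl hx hYβ hvY,
    𝒢.antiPhi_map_id_toHom ht hY (k := (α.1⁻¹, β.1)) (l := β) rfl hx hYβ, ← 𝒢.phiL_eq hv hvb hW,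
    h1, LinearEquiv.apply_symm_apply] at h2
  have h3 : star D * D = 0 := by
    rw [← htD, ← sub_eq_zero.2 h2, htD, hD, ← mul_sub, ← sub_mul, ← hD, htD]
  exact sub_eq_zero.1 (𝒢.eq_zero_of_star_mul_self h3)

end MeasuredHopf

end StrongInvariance

/-! ### The antipode exchanges the integrals and the slices. -/

section IntegralsAndAntipode

variable {Γ B : Type*} [Group Γ] [NonUnitalCommRing B] [StarRing B] [Module ℂ B]
variable {act : Γ →* (B ≃⋆ₐ[ℂ] B)}
variable {A : Type*} [NonUnitalRing A] [StarRing A] [Module ℂ A]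
    [IsScalarTower ℂ A A] [SMulCommClass ℂ A A] [StarModule ℂ A]
variable [IsScalarTower ℂ B B] [SMulCommClass ℂ B B] [StarModule ℂ B]
variable {E : EvAlg act A}


namespace MeasuredHopf

variable (𝒢 : MeasuredHopf E)

/-- For Δ(a) = ∑ x ⊗ y the left side is ∑ φ(S(x))φ(yb). As S flips the legs of Δ, this is a slice of
Δ(S(a)) seen through S⁻¹, and left invariance at S(a) evaluates it. -/
lemma phi_S_phiL (a b : A) :
    𝒢.φ.toFun (𝒢.S.toEquiv (𝒢.phiL a b)) = 𝒢.φ.toFun ((E.s (𝒢.φ.toFun (𝒢.S.toEquiv a))).lft b) := by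
  obtain ⟨v, hv, h⟩ := E.unit1 b
  obtain ⟨W, hW⟩ := 𝒢.Δ.exists_mul_inrM a hv
  have h1 : ∀ W, 𝒢.φ.toFun (𝒢.S.toEquiv (𝒢.fpPhiL b W)) = 𝒢.φ.toFun (𝒢.S.toEquiv.symm
      (𝒢.φ.sliceR (E.fstMul (𝒢.S.toEquiv b) (E.toR (𝒢.S.flipMap W))))) := fun W => by
    refine FP.induction (p := fun W => 𝒢.φ.toFun (𝒢.S.toEquiv (𝒢.fpPhiL b W)) =
      𝒢.φ.toFun (𝒢.S.toEquiv.symm (𝒢.φ.sliceR (E.fstMul (𝒢.S.toEquiv b)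
        (E.toR (𝒢.S.flipMap W)))))) (by simp)
      (fun x y hx hy => by simp only [map_add, hx, hy]) ?_ W
    intro g h x y e hx hy
    have h2 : 𝒢.φ.sliceR (E.tmR (𝒢.S.toEquiv b * 𝒢.S.toEquiv y) (𝒢.S.toEquiv x)) =
      (E.s (𝒢.φ.toFun (𝒢.S.toEquiv x))).rgt (𝒢.S.toEquiv b * 𝒢.S.toEquiv y) := rfl
    rw [𝒢.fpPhiL_tm e hx hy, 𝒢.S.flipMap_tm e hx hy, E.toR_tm (g := (h.2⁻¹, h.1⁻¹))
      (h := (g.2⁻¹, g.1⁻¹)) (by simp [e]) (𝒢.S.map_gr hy) (𝒢.S.map_gr hx), E.fstMul_tmR, h2,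
      ← 𝒢.S.map_mul, ← 𝒢.S.map_r_lft, LinearEquiv.symm_apply_apply, 𝒢.φ.map_lft, 𝒢.S.map_s_lft,
      𝒢.φ.map_rgt]
  rw [𝒢.phiL_eq hv h hW, h1, ← 𝒢.Δ.inlMul_eq (𝒢.S.map_gr_one hv) (by rw [← 𝒢.S.map_mul, h])
    (𝒢.antipode.of_flipMap_mul_inrM hv hW), (𝒢.left_integral _ _).2, ← 𝒢.S.map_s_lft,
    LinearEquiv.symm_apply_apply]

lemma nu_phiR (a b : A) : 𝒢.nu (𝒢.phiR a b) = 𝒢.μ.toFun (𝒢.ψ.toFun a * 𝒢.ψ.toFun b) := by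
  rw [phiR_apply, nu_sliceR, (𝒢.right_integral _ _).2, nu_s_rgt, mul_comm]

/-- Applying μ to `phi_S_phiL` gives μ(φ(S(a))ψ(b)), while strong invariance and right invariance
give μ(ψ(a)ψ(b)) for the same element. Surjectivity of ψ and faithfulness of μ conclude. -/
lemma phi_S (a : A) : 𝒢.φ.toFun (𝒢.S.toEquiv a) = 𝒢.ψ.toFun a := by
  refine 𝒢.μ.ext fun b => ?_
  obtain ⟨c, rfl⟩ := 𝒢.ψ_surjective b
  rw [mul_comm, ← nu_s_lft, nu_eq_phi, ← phi_S_phiL, ← nu_eq_phi, S_phiL, nu_phiR, mul_comm]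

lemma nu_S (a : A) : 𝒢.nu (𝒢.S.toEquiv a) = 𝒢.nu a := by
  rw [nu_eq_phi, phi_S, nu_eq_psi]

/-- By `phi_S`, ν is S-invariant; tested against μ this gives the companion relation, since S turns
s into r. -/
lemma psi_S (a : A) : 𝒢.ψ.toFun (𝒢.S.toEquiv a) = 𝒢.φ.toFun a := by
  refine 𝒢.μ.ext fun b => ?_
  rw [← nu_s_lft, ← 𝒢.S.map_r_rgt, nu_S, nu_r_rgt]

lemma S_phiR (c b : A) :
    𝒢.S.toEquiv (𝒢.phiR c b) = 𝒢.psiL (𝒢.S.toEquiv b) (𝒢.S.toEquiv c) := by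
  obtain ⟨u, hu, h⟩ := E.runit1 c
  obtain ⟨W, hW⟩ := 𝒢.Δ.exists_inrM_mul b hu
  rw [𝒢.phiR_eq hu h hW, 𝒢.psiL_eq (𝒢.S.map_gr_one hu) (by rw [← 𝒢.S.map_mul, h])
    (𝒢.antipode.of_flipMap_inrM_mul hu hW)]
  refine FP.induction (p := fun W => 𝒢.S.toEquiv (𝒢.fpPhiR c W) =
    𝒢.fpPsiL (𝒢.S.toEquiv c) (𝒢.S.flipMap W)) (by simp)
    (fun x y hx hy => by simp only [map_add, hx, hy]) ?_ W
  intro g h x y e hx hy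
  rw [𝒢.fpPhiR_tm e hx hy, 𝒢.S.flipMap_tm e hx hy, 𝒢.fpPsiL_tm (g := (h.2⁻¹, h.1⁻¹))
    (h := (g.2⁻¹, g.1⁻¹)) (by simp [e]) (𝒢.S.map_gr hy) (𝒢.S.map_gr hx), 𝒢.S.map_s_rgt,
    ← 𝒢.S.map_mul, psi_S]

/-- S flips the legs of Δ and ψ ∘ S = φ, so a φ-slice of the second leg becomes a ψ-slice of the
first. -/
lemma S_phiL_eq_psiR (a b : A) :
    𝒢.S.toEquiv (𝒢.phiL a b) = 𝒢.psiR (𝒢.S.toEquiv b) (𝒢.S.toEquiv a) := by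
  obtain ⟨u, hu, h⟩ := E.unit1 b
  obtain ⟨W, hW⟩ := 𝒢.Δ.exists_mul_inrM a hu
  rw [𝒢.phiL_eq hu h hW, 𝒢.psiR_eq (𝒢.S.map_gr_one hu) (by rw [← 𝒢.S.map_mul, h])
    (𝒢.antipode.of_flipMap_mul_inrM hu hW)]
  refine FP.induction (p := fun W => 𝒢.S.toEquiv (𝒢.fpPhiL b W) =
    𝒢.fpPsiR (𝒢.S.toEquiv b) (𝒢.S.flipMap W)) (by simp)
    (fun x y hx hy => by simp only [map_add, hx, hy]) ?_ W
  intro g h x y e hx hy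
  rw [𝒢.fpPhiL_tm e hx hy, 𝒢.S.flipMap_tm e hx hy, 𝒢.fpPsiR_tm (g := (h.2⁻¹, h.1⁻¹))
    (h := (g.2⁻¹, g.1⁻¹)) (by simp [e]) (𝒢.S.map_gr hy) (𝒢.S.map_gr hx), 𝒢.S.map_s_lft,
    ← 𝒢.S.map_mul, psi_S]

/-- Two formulas for S(`phiL a b`) are compared. Statements about φ-slices transfer to ψ-slices in
this way. -/
lemma phiR_eq_psiR (a b : A) : 𝒢.phiR a b = 𝒢.psiR (𝒢.S.toEquiv b) (𝒢.S.toEquiv a) := by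
  rw [← S_phiL, S_phiL_eq_psiR]

/-- Strong right invariance. -/
lemma S_psiR (w t : A) : 𝒢.S.toEquiv (𝒢.psiR w t) = 𝒢.psiL w t := by
  have := 𝒢.S_phiR (𝒢.S.toEquiv.symm t) (𝒢.S.toEquiv.symm w)
  rwa [phiR_eq_psiR, LinearEquiv.apply_symm_apply, LinearEquiv.apply_symm_apply] at this

lemma psiR_mem {α β : Γ × Γ} {w t : A} (hw : w ∈ E.gr α) (ht : t ∈ E.gr β) :
    𝒢.psiR w t ∈ E.gr (α.2⁻¹, β.2) := by
  have h := 𝒢.phiR_mem (a := 𝒢.S.toEquiv.symm t) (b := 𝒢.S.toEquiv.symm w)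
    (𝒢.S.symm_mem (γ := β.1) (γ' := β.2) ht) (𝒢.S.symm_mem (γ := α.1) (γ' := α.2) hw)
  rw [phiR_eq_psiR, LinearEquiv.apply_symm_apply, LinearEquiv.apply_symm_apply] at h
  simpa using h

lemma psiL_mem {α β : Γ × Γ} {w t : A} (hw : w ∈ E.gr α) (ht : t ∈ E.gr β) :
    𝒢.psiL w t ∈ E.gr (β.2⁻¹, α.2) := by
  rw [← S_psiR]
  simpa using 𝒢.S.map_gr (𝒢.psiR_mem hw ht)

end MeasuredHopf

end IntegralsAndAntipode

/-! ### The slices span the algebra. -/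

section Spanning

variable {Γ B : Type*} [Group Γ] [NonUnitalCommRing B] [StarRing B] [Module ℂ B]
variable {act : Γ →* (B ≃⋆ₐ[ℂ] B)}
variable {A : Type*} [NonUnitalRing A] [StarRing A] [Module ℂ A]
    [IsScalarTower ℂ A A] [SMulCommClass ℂ A A] [StarModule ℂ A]
variable [IsScalarTower ℂ B B] [SMulCommClass ℂ B B] [StarModule ℂ B]
variable {E : EvAlg act A}


lemma FP.exists_inlM_rgt_eq (W : FP E E) : ∃ P : Finset A, ∀ c (hc : c ∈ E.gr 1),
    (∀ a ∈ P, a * c = a) → (FP.inlM (Mult.of c) (E.of_mem hc)).rgt W = W := by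
  classical
  refine FP.induction (p := fun W => ∃ P : Finset A, ∀ c (hc : c ∈ E.gr 1),
    (∀ a ∈ P, a * c = a) → (FP.inlM (Mult.of c) (E.of_mem hc)).rgt W = W) ⟨∅, by simp⟩ ?_ ?_ W
  · rintro x y ⟨P, hP⟩ ⟨Q, hQ⟩
    refine ⟨P ∪ Q, fun c hc h => ?_⟩
    rw [map_add, hP c hc fun a ha => h a (Finset.mem_union_left _ ha),
      hQ c hc fun a ha => h a (Finset.mem_union_right _ ha)]
  · intro g h x y e hx hy
    exact ⟨{x}, fun c hc h => by rw [FP.inlM_rgt _ e hx hy, Mult.of_rgt, h x (by simp)]⟩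

namespace MeasuredHopf

variable (𝒢 : MeasuredHopf E)

lemma fpPsiR_r_lft (w : A) (b : B) (Y : FP E E) :
    𝒢.fpPsiR w ((FP.rHom E E b).lft Y) = 𝒢.fpPsiR ((E.r b).rgt w) Y :=
  LinearMap.congr_fun (f := 𝒢.fpPsiR w ∘ₗ (FP.rHom E E b).lft)
    (g := 𝒢.fpPsiR ((E.r b).rgt w)) (FP.hext fun g h x y e hx hy => by
      simp only [LinearMap.comp_apply]
      rw [FP.rHom_lft E E b e hx hy, 𝒢.fpPsiR_tm e (E.r_mem b hx) hy, 𝒢.fpPsiR_tm e hx hy,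
        Mult.mid]) Y

lemma fpPsiR_inrM_rgt {d : A} (hd : d ∈ E.gr 1) (w : A) (W : FP E E) :
    𝒢.fpPsiR w ((FP.inrM (Mult.of d) (E.of_mem hd)).rgt W) = 𝒢.fpPsiR w W * d :=
  LinearMap.congr_fun (f := 𝒢.fpPsiR w ∘ₗ (FP.inrM (Mult.of d) (E.of_mem hd)).rgt)
    (g := LinearMap.mulRight ℂ d ∘ₗ 𝒢.fpPsiR w) (FP.hext fun g h x y e hx hy => by
      simp only [LinearMap.comp_apply, LinearMap.mulRight_apply]
      rw [FP.inrM_rgt _ e hx hy, Mult.of_rgt, 𝒢.fpPsiR_tm e hx (by simpa using E.mul_mem hy hd),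
        𝒢.fpPsiR_tm e hx hy, Mult.rgt_mul, Mult.mid, E.twist_r _ hd, Prod.fst_one,
        act_one_apply]) W

/-- `(w, x ⊗̃ y) ↦ y r(ψ(wx))`. -/
def fpPsiRB : A →ₗ[ℂ] FP E E →ₗ[ℂ] A := LinearMap.mk₂ ℂ (fun w Y => 𝒢.fpPsiR w Y)
  (fun w w' Y => LinearMap.congr_fun (g := 𝒢.fpPsiR w + 𝒢.fpPsiR w')
    (FP.hext fun g h x y e hx hy => by
      rw [LinearMap.add_apply]; rw [𝒢.fpPsiR_tm e hx hy, 𝒢.fpPsiR_tm e hx hy, 𝒢.fpPsiR_tm e hx hy]; simp [add_mul]) Y)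
  (fun z w Y => LinearMap.congr_fun (g := z • 𝒢.fpPsiR w)
    (FP.hext fun g h x y e hx hy => by
      rw [LinearMap.smul_apply]; rw [𝒢.fpPsiR_tm e hx hy, 𝒢.fpPsiR_tm e hx hy, smul_mul_assoc, map_smul, map_smul,
        Mult.smul_rgt]) Y)
  (fun w Y Y' => map_add _ _ _) (fun z w Y => map_smul _ _ _)

lemma fpPsiRB_apply (w : A) (Y : FP E E) : 𝒢.fpPsiRB w Y = 𝒢.fpPsiR w Y := rfl

/-- `x ⊗̃ (y ⊗̃ z) ↦ z r(ψ(S(x)y))`. -/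
def antiPsi : FP E (FP.ev E E) →ₗ[ℂ] A :=
  FP.lift (𝒢.fpPsiRB ∘ₗ 𝒢.S.toEquiv.toLinearMap) fun g h x Y b e hx hY => by
    simp only [LinearMap.comp_apply, LinearEquiv.coe_coe, fpPsiRB_apply]
    rw [𝒢.S.map_s_lft]
    exact (𝒢.fpPsiR_r_lft _ b Y).symm

lemma antiPsi_tm {g h : Γ × Γ} {x : A} {Y : FP E E} (e : g.2 = h.1) (hx : x ∈ E.gr g)
    (hY : Y ∈ (FP.ev E E).gr h) : 𝒢.antiPsi (FP.tm x Y) = 𝒢.fpPsiR (𝒢.S.toEquiv x) Y :=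
  FP.lift_tm _ _ e hx hY

lemma antiPsi_assocAux {g h : Γ × Γ} {X : FP E E} {d : A} (e : g.2 = h.1)
    (hX : X ∈ (FP.ev E E).gr g) (hd : d ∈ E.gr h) :
    𝒢.antiPsi (FP.assocAux X d) = (E.r (𝒢.ψ.toFun (𝒢.S.fpMul X))).rgt d := by
  refine FP.grade_induction (p := fun X => 𝒢.antiPsi (FP.assocAux X d) =
    (E.r (𝒢.ψ.toFun (𝒢.S.fpMul X))).rgt d) (by simp)
    (fun x y hx hy => by simp only [map_add, LinearMap.add_apply, Mult.add_rgt, hx, hy]) ?_ hX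
  rintro p q x c e' hx hc rfl
  rw [FP.assocAux_tm e' hx hc, 𝒢.antiPsi_tm (h := (q.1, h.2)) e' hx (FP.tm_mem (g := q) e hc hd),
    𝒢.fpPsiR_tm (g := q) e hc hd, 𝒢.S.fpMul_tm e' hx hc]

/-- ∑ S(f₁x)f₂c collapses to S(x)s(ε^♭(f))c, and ψ moves the coefficient to the last leg, where it
becomes the counit. -/
lemma antiPsi_map_toHom_id {x c d : A} (hx : x ∈ E.gr 1) (hc : c ∈ E.gr 1) (hd : d ∈ E.gr 1)
    (W : FP E E) :
    𝒢.antiPsi (FP.assoc ((FP.map 𝒢.Δ.toEvHom (EvHom.id E) W).lft (FP.tm (FP.tm x c) d))) =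
      (E.r (𝒢.ψ.toFun (𝒢.S.toEquiv x * c))).rgt (𝒢.ε.epsId W * d) := by
  refine FP.induction (p := fun W =>
    𝒢.antiPsi (FP.assoc ((FP.map 𝒢.Δ.toEvHom (EvHom.id E) W).lft (FP.tm (FP.tm x c) d))) =
      (E.r (𝒢.ψ.toFun (𝒢.S.toEquiv x * c))).rgt (𝒢.ε.epsId W * d)) (by simp)
    (fun x y hx hy => by
      simp only [map_add, Mult.add_lft, add_mul, hx, hy]) ?_ W
  intro p q f g' ep hf hg
  have hX : FP.tm x c ∈ (FP.ev E E).gr 1 := FP.tm_mem (g := 1) (h := 1) rfl hx hc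
  have hgd : g' * d ∈ E.gr q := by simpa using E.mul_mem hg hd
  have hfX : (𝒢.Δ.toHom f).lft (FP.tm x c) ∈ (FP.ev E E).gr p := by
    simpa using 𝒢.Δ.lft_mem hf hX
  rw [𝒢.Δ.map_toHom_id_tm ep hf hg (k := 1) (l := 1) rfl hX hd, FP.assoc,
    FP.lift_tm _ _ ep hfX hgd, 𝒢.antiPsi_assocAux ep hfX hgd,
    𝒢.antipode.fpMul_lft (k := 1) (l := 1) rfl hx hc, 𝒢.ε.epsId_tm ep hf hg,
    E.mul_s _ _ (𝒢.S.map_gr_one hx), 𝒢.ψ.map_lft, Prod.snd_one, act_one_apply,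
    _root_.map_mul E.r, Mult.mul_rgt, ← Mult.lft_mul]
  by_cases hp : p.1 = p.2
  · obtain ⟨γ, γ'⟩ := p
    obtain rfl : γ = γ' := hp
    rw [E.twist_r _ hgd, 𝒢.ε.flat_eq hf, ← show γ = q.1 from ep, act_act_inv]
  · rw [CrossedHom.sharp_eq_total, CrossedHom.flat, 𝒢.ε.toFun_eq_zero hf hp]
    simp

/-- On f ⊗ g the map `antiPsi` yields the slice of Δ(g) against S(fx). The finite set P consists of
the first legs occurring in the cut-off of Δ(g); once c is a right unit for them it disappears, so y
depends neither on c nor on d. -/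
lemma exists_antiPsi_map_id_toHom {x : A} (hx : x ∈ E.gr 1) (W : FP E E) :
    ∃ y ∈ Submodule.span ℂ {z | ∃ w t, z = 𝒢.psiR w t}, ∃ P : Finset A, ∀ c ∈ E.gr 1,
      (∀ a ∈ P, a * c = a) → ∀ d ∈ E.gr 1,
      𝒢.antiPsi ((FP.map (EvHom.id E) 𝒢.Δ.toEvHom W).lft (FP.tm x (FP.tm c d))) = y * d := by
  classical
  refine FP.induction (p := fun W =>
    ∃ y ∈ Submodule.span ℂ {z | ∃ w t, z = 𝒢.psiR w t}, ∃ P : Finset A, ∀ c ∈ E.gr 1,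
      (∀ a ∈ P, a * c = a) → ∀ d ∈ E.gr 1,
      𝒢.antiPsi ((FP.map (EvHom.id E) 𝒢.Δ.toEvHom W).lft (FP.tm x (FP.tm c d))) = y * d)
    ⟨0, zero_mem _, ∅, by simp⟩ ?_ ?_ W
  · rintro X Y ⟨y, hy, P, hP⟩ ⟨z, hz, Q, hQ⟩
    refine ⟨y + z, add_mem hy hz, P ∪ Q, fun c hc h d hd => ?_⟩
    rw [map_add, Mult.add_lft, map_add, hP c hc (fun a ha => h a (Finset.mem_union_left _ ha)) d hd,
      hQ c hc (fun a ha => h a (Finset.mem_union_right _ ha)) d hd, add_mul]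
  · intro p q f g e hf hg
    obtain ⟨u, hu, hwu⟩ := E.runit1 (𝒢.S.toEquiv (f * x))
    obtain ⟨W, hW⟩ := 𝒢.Δ.exists_inlM_mul g hu
    obtain ⟨P, hP⟩ := FP.exists_inlM_rgt_eq W
    refine ⟨𝒢.psiR (𝒢.S.toEquiv (f * x)) g, Submodule.subset_span ⟨_, _, rfl⟩, P,
      fun c hc h d hd => ?_⟩
    have hY : FP.tm c d ∈ (FP.ev E E).gr 1 := FP.tm_mem (g := 1) (h := 1) rfl hc hd
    have hgY : (𝒢.Δ.toHom g).lft (FP.tm c d) ∈ (FP.ev E E).gr q := by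
      simpa using 𝒢.Δ.lft_mem hg hY
    have hfx : f * x ∈ E.gr p := by simpa using E.mul_mem hf hx
    have h1 : (FP.inlM (Mult.of u) (E.of_mem hu)).lft ((𝒢.Δ.toHom g).lft (FP.tm c d)) =
        (FP.inrM (Mult.of d) (E.of_mem hd)).rgt W := by
      rw [← hP c hc h]
      apply (FP.ev E E).of_injective
      rw [of_lft_eq, of_lft_eq, of_rgt_eq, of_rgt_eq, hW, ← FP.inlM_mul_inrM hc hd]
      simp only [mul_assoc]
    rw [𝒢.Δ.map_id_toHom_tm e hf hg (k := 1) (l := 1) rfl hx hY, 𝒢.antiPsi_tm e hfx hgY]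
    conv_lhs => rw [← hwu]
    rw [← 𝒢.fpPsiR_inlM hu, h1, 𝒢.fpPsiR_inrM_rgt hd, ← 𝒢.psiR_eq hu hwu hW]

/-- Applying `antiPsi` to both forms of coassociativity at a gives a r(ψ(S(x))) on one side and a
sum of slices on the other, up to the units c and d. -/
lemma r_psi_S_rgt_mem {x : A} (hx : x ∈ E.gr 1) (a : A) :
    (E.r (𝒢.ψ.toFun (𝒢.S.toEquiv x))).rgt a ∈
      Submodule.span ℂ {z | ∃ w t, z = 𝒢.psiR w t} := by
  classical
  obtain ⟨u, hu, hux⟩ := E.unit1 x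
  obtain ⟨W, hW⟩ := 𝒢.Δ.exists_mul_inlM a hu
  obtain ⟨U, V, hU, hV, hUV⟩ := 𝒢.Δ.coassoc_lft a
  obtain ⟨y, hy, P, hP⟩ := 𝒢.exists_antiPsi_map_id_toHom hx W
  obtain ⟨c, hc, hPc⟩ := E.runits (insert (𝒢.S.toEquiv x) P)
  obtain ⟨d, hd, hyd⟩ := E.runits {y, (E.r (𝒢.ψ.toFun (𝒢.S.toEquiv x))).rgt a}
  obtain ⟨v, hv, hvd⟩ := E.unit1 d
  obtain ⟨W', hW'⟩ := 𝒢.Δ.exists_mul_inrM a hv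
  have hY : FP.tm c d ∈ (FP.ev E E).gr 1 := FP.tm_mem (g := 1) (h := 1) rfl hc hd
  have hX : FP.tm x c ∈ (FP.ev E E).gr 1 := FP.tm_mem (g := 1) (h := 1) rfl hx hc
  have h := hP c hc (fun a ha => hPc a (Finset.mem_insert_of_mem ha)) d hd
  rw [← 𝒢.Δ.extends_id_toHom_of_inlM hV hu hW (k := 1) (l := 1) rfl hx hY hux,
    ← hUV (k := 1) (l := 1) (m := 1) rfl rfl hx hc hd,
    𝒢.Δ.extends_toHom_id hU hv hW' (k := 1) (l := 1) rfl hX hd hvd,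
    𝒢.antiPsi_map_toHom_id hx hc hd, 𝒢.counit.epsId_eq hv hW', mul_assoc, hvd,
    hPc _ (Finset.mem_insert_self _ _), Mult.rgt_mul, E.twist_r _ hd, Prod.fst_one, act_one_apply,
    ← Mult.mid, hyd y (by simp), hyd _ (by simp)] at h
  rw [h]; exact hy

/-- Since ψ ∘ S = φ is surjective, the factor in a r(ψ(S(x))) can be made a right unit for a. -/
lemma span_psiR : Submodule.span ℂ {z | ∃ w t, z = 𝒢.psiR w t} = ⊤ := by
  rw [eq_top_iff]
  intro a _
  obtain ⟨b, hb⟩ := E.r_units {star a}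
  obtain ⟨x, hx⟩ := 𝒢.φ_surjective (star b)
  -- φ sees only the component of degree e, so the preimage x may be replaced by that component.
  have h1 : 𝒢.φ.toFun ∘ₗ FP.proj E (· = 1) = 𝒢.φ.toFun := E.hext fun g y hy => by
    rw [LinearMap.comp_apply]
    by_cases hg : g = 1
    · rw [FP.proj_of hy hg]
    · rw [FP.proj_of_not hy hg, 𝒢.phi_eq_zero hy hg, map_zero]
  have h2 := 𝒢.r_psi_S_rgt_mem (FP.proj_mem 1 x) a
  rw [psi_S, ← LinearMap.comp_apply, h1, hx] at h2
  have h3 : (E.r (star b)).rgt a = a := by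
    rw [← star_inj, E.star_r_rgt, star_star, hb _ (by simp)]
  rwa [h3] at h2

lemma span_phiR : Submodule.span ℂ {z | ∃ c b, z = 𝒢.phiR c b} = ⊤ := by
  rw [← 𝒢.span_psiR]
  congr 1
  ext z
  constructor
  · rintro ⟨c, b, rfl⟩; exact ⟨_, _, 𝒢.phiR_eq_psiR c b⟩
  · rintro ⟨w, t, rfl⟩
    exact ⟨𝒢.S.toEquiv.symm t, 𝒢.S.toEquiv.symm w, by rw [phiR_eq_psiR]; simp⟩

end MeasuredHopf

end Spanning

/-! ### Adjoints and products of convolution operators. -/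

section ConvolutionAlgebra

variable {Γ B : Type*} [Group Γ] [NonUnitalCommRing B] [StarRing B] [Module ℂ B]
variable {act : Γ →* (B ≃⋆ₐ[ℂ] B)}
variable {A : Type*} [NonUnitalRing A] [StarRing A] [Module ℂ A]
    [IsScalarTower ℂ A A] [SMulCommClass ℂ A A] [StarModule ℂ A]
variable [IsScalarTower ℂ B B] [SMulCommClass ℂ B B] [StarModule ℂ B]
variable {E : EvAlg act A}


namespace MeasuredHopf

variable (𝒢 : MeasuredHopf E)

/-- On a slice S exchanges `psiR` and `psiL` with the same arguments, whereas the involution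
exchanges them and replaces the arguments by their adjoints in reversed order. Hence S ∘ * ∘ S = *
on slices, and these span A. -/
lemma S_star_S (hB : HasLocalUnits B) (x : A) :
    𝒢.S.toEquiv (star (𝒢.S.toEquiv x)) = star x := by
  have hx : x ∈ Submodule.span ℂ {z | ∃ w t, z = 𝒢.psiR w t} := by
    rw [𝒢.span_psiR]; trivial
  refine Submodule.span_induction ?_ (by simp) ?_ ?_ hx
  · rintro _ ⟨w, t, rfl⟩
    rw [S_psiR, 𝒢.star_psiL hB, S_psiR, ← 𝒢.star_psiR hB]
  · intro x y _ _ hx hy; simp only [map_add, star_add, hx, hy]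
  · intro z x _ hx; simp only [map_smul, star_smul, hx]

/-- The chain is ν(S(x) `phiR w z`) = ν(S(x) S(`phiL w z`)) = ν(`phiL w z` x) = ν(`psiL w x` z), by
moving slices between the legs, strong invariance and ν ∘ S = ν. -/
lemma nu_mul_psiR (hB : HasLocalUnits B) (w x z : A) :
    𝒢.nu (w * 𝒢.psiR (𝒢.S.toEquiv x) z) = 𝒢.nu (𝒢.psiL w x * z) := by
  rw [← nu_mul_phiR, ← S_phiL, ← 𝒢.S.map_mul, nu_S, 𝒢.nu_phiL_mul hB]

lemma nu_star_mul_psiR (hB : HasLocalUnits B) (x y z : A) :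
    𝒢.nu (star y * 𝒢.psiR (𝒢.S.toEquiv x) z) =
      𝒢.nu (star (𝒢.psiR (𝒢.S.toEquiv (star (𝒢.S.toEquiv x))) y) * z) := by
  rw [𝒢.nu_mul_psiR hB, 𝒢.S_star_S hB, 𝒢.star_psiR hB, star_star]

/-- `x ⊗̃ y ↦ r(ψ(x))y`. -/
def fpPsi : FP E E →ₗ[ℂ] A := 𝒢.ψ.sliceL ∘ₗ E.toL

lemma fpPsi_tm {g h : Γ × Γ} {x y : A} (e : g.2 = h.1) (hx : x ∈ E.gr g) (hy : y ∈ E.gr h) :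
    𝒢.fpPsi (FP.tm x y) = (E.r (𝒢.ψ.toFun x)).lft y := by
  rw [fpPsi, LinearMap.comp_apply, E.toL_tm e hx hy]; rfl

lemma fpPhi_lft {k l : Γ × Γ} {g c b : A} (e : k.2 = l.1) (hc : c ∈ E.gr k) (hb : b ∈ E.gr l) :
    𝒢.fpPhi ((𝒢.Δ.toHom g).lft (FP.tm c b)) = 𝒢.phiL g b * c := by
  obtain ⟨v, hv, h⟩ := E.unit1 b
  obtain ⟨W, hW⟩ := 𝒢.Δ.exists_mul_inrM g hv
  have h1 : (𝒢.Δ.toHom g).lft (FP.tm c b) = W * FP.tm c b := by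
    rw [← Mult.of_lft, hW, Mult.mul_lft, FP.inrM_lft _ e hc hb, Mult.of_lft, h]
  rw [h1, 𝒢.phiL_eq hv h hW]
  refine FP.induction (p := fun W => 𝒢.fpPhi (W * FP.tm c b) = 𝒢.fpPhiL b W * c) (by simp)
    (fun x y hx hy => by simp only [map_add, add_mul, hx, hy]) ?_ W
  intro p q x y e' hx hy
  rw [FP.tm_mul_tm e' hx hy e hc hb, 𝒢.fpPhi_tm (by simp [e, e']) (E.mul_mem hx hc)
    (E.mul_mem hy hb), 𝒢.fpPhiL_tm e' hx hy, Mult.lft_mul]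

lemma fpPsi_lft {k l : Γ × Γ} {f t c : A} (e : k.2 = l.1) (ht : t ∈ E.gr k) (hc : c ∈ E.gr l) :
    𝒢.fpPsi ((𝒢.Δ.toHom f).lft (FP.tm t c)) = 𝒢.psiL f t * c := by
  obtain ⟨v, hv, h⟩ := E.unit1 t
  obtain ⟨W, hW⟩ := 𝒢.Δ.exists_mul_inlM f hv
  have h1 : (𝒢.Δ.toHom f).lft (FP.tm t c) = W * FP.tm t c := by
    rw [← Mult.of_lft, hW, Mult.mul_lft, FP.inlM_lft _ e ht hc, Mult.of_lft, h]
  rw [h1, 𝒢.psiL_eq hv h hW]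
  refine FP.induction (p := fun W => 𝒢.fpPsi (W * FP.tm t c) = 𝒢.fpPsiL t W * c) (by simp)
    (fun x y hx hy => by simp only [map_add, add_mul, hx, hy]) ?_ W
  intro p q x y e' hx hy
  rw [FP.tm_mul_tm e' hx hy e ht hc, 𝒢.fpPsi_tm (by simp [e, e']) (E.mul_mem hx ht)
    (E.mul_mem hy hc), 𝒢.fpPsiL_tm e' hx hy, Mult.lft_mul]

lemma phiL_r_lft (β : B) (a b : A) : 𝒢.phiL ((E.r β).lft a) b = (E.r β).lft (𝒢.phiL a b) := by
  obtain ⟨v, hv, h⟩ := E.unit1 b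
  obtain ⟨W, hW⟩ := 𝒢.Δ.exists_mul_inrM a hv
  rw [𝒢.phiL_eq hv h hW, 𝒢.phiL_eq hv h (W := (FP.rHom E E β).lft W)
    (by rw [of_lft_eq, hW, 𝒢.Δ.map_r_lft, mul_assoc]; rfl)]
  exact LinearMap.congr_fun (f := 𝒢.fpPhiL b ∘ₗ (FP.rHom E E β).lft)
    (g := (E.r β).lft ∘ₗ 𝒢.fpPhiL b) (FP.hext fun g h x y e hx hy => by
      simp only [LinearMap.comp_apply]
      rw [FP.rHom_lft E E β e hx hy, 𝒢.fpPhiL_tm e (E.r_mem β hx) hy, 𝒢.fpPhiL_tm e hx hy,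
        E.r_lft_s_lft]) W

lemma psiL_s_lft (β : B) (a t : A) : 𝒢.psiL ((E.s β).lft a) t = (E.s β).lft (𝒢.psiL a t) := by
  obtain ⟨v, hv, h⟩ := E.unit1 t
  obtain ⟨W, hW⟩ := 𝒢.Δ.exists_mul_inlM a hv
  rw [𝒢.psiL_eq hv h hW, 𝒢.psiL_eq hv h (W := (FP.sHom E E β).lft W)
    (by rw [of_lft_eq, hW, 𝒢.Δ.map_s_lft, mul_assoc]; rfl)]
  exact LinearMap.congr_fun (f := 𝒢.fpPsiL t ∘ₗ (FP.sHom E E β).lft)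
    (g := (E.s β).lft ∘ₗ 𝒢.fpPsiL t) (FP.hext fun g h x y e hx hy => by
      simp only [LinearMap.comp_apply]
      rw [FP.sHom_lft E E β e hx hy, 𝒢.fpPsiL_tm e hx (E.s_mem β hy), 𝒢.fpPsiL_tm e hx hy,
        E.r_lft_s_lft]) W

/-- `x ⊗̃ (y ⊗̃ z) ↦ r(ψ(x)) s(φ(z)) y`. -/
def psiPhi : FP E (FP.ev E E) →ₗ[ℂ] A :=
  FP.lift ((E.rL ∘ₗ 𝒢.ψ.toFun).compl₂ 𝒢.fpPhi) fun g h x Y b e hx hY => by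
    simp only [LinearMap.compl₂_apply, LinearMap.comp_apply, EvAlg.rL_apply]
    rw [𝒢.ψ.map_lft, mul_comm, _root_.map_mul E.r, Mult.mul_lft]
    exact congrArg _ (𝒢.fpPhi_r_lft b Y).symm

lemma psiPhi_tm {g h : Γ × Γ} {x : A} {Y : FP E E} (e : g.2 = h.1) (hx : x ∈ E.gr g)
    (hY : Y ∈ (FP.ev E E).gr h) :
    𝒢.psiPhi (FP.tm x Y) = (E.r (𝒢.ψ.toFun x)).lft (𝒢.fpPhi Y) :=
  FP.lift_tm _ _ e hx hY

lemma psiPhi_assocAux {g h : Γ × Γ} {X : FP E E} {d : A} (e : g.2 = h.1)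
    (hX : X ∈ (FP.ev E E).gr g) (hd : d ∈ E.gr h) :
    𝒢.psiPhi (FP.assocAux X d) = (E.s (𝒢.φ.toFun d)).lft (𝒢.fpPsi X) := by
  refine FP.grade_induction (p := fun X => 𝒢.psiPhi (FP.assocAux X d) =
    (E.s (𝒢.φ.toFun d)).lft (𝒢.fpPsi X)) (by simp)
    (fun x y hx hy => by simp only [map_add, LinearMap.add_apply, hx, hy]) ?_ hX
  rintro p q x c e' hx hc rfl
  rw [FP.assocAux_tm e' hx hc, 𝒢.psiPhi_tm (h := (q.1, h.2)) e' hx (FP.tm_mem (g := q) e hc hd),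
    𝒢.fpPhi_tm (g := q) e hc hd, 𝒢.fpPsi_tm e' hx hc, E.r_lft_s_lft]

/-- Both sides are ∑ r(ψ(a₁t)) s(φ(a₃b)) a₂c: coassociativity applied to t ⊗ c ⊗ b, with ψ on the
first leg and φ on the third. -/
lemma psiL_phiL_mul {k l m : Γ × Γ} {a b t c : A} (e : k.2 = l.1) (e' : l.2 = m.1)
    (ht : t ∈ E.gr k) (hc : c ∈ E.gr l) (hb : b ∈ E.gr m) :
    𝒢.psiL (𝒢.phiL a b) t * c = 𝒢.phiL (𝒢.psiL a t) b * c := by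
  obtain ⟨U, V, hU, hV, hUV⟩ := 𝒢.Δ.coassoc_lft a
  obtain ⟨u, hu, hut⟩ := E.unit1 t
  obtain ⟨v, hv, hvb⟩ := E.unit1 b
  obtain ⟨W, hW⟩ := 𝒢.Δ.exists_mul_inlM a hu
  obtain ⟨W', hW'⟩ := 𝒢.Δ.exists_mul_inrM a hv
  have hX : FP.tm t c ∈ (FP.ev E E).gr (k.1, l.2) := FP.tm_mem e ht hc
  have hY : FP.tm c b ∈ (FP.ev E E).gr (l.1, m.2) := FP.tm_mem e' hc hb
  have h := congrArg 𝒢.psiPhi (hUV e e' ht hc hb)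
  rw [𝒢.Δ.extends_id_toHom_of_inlM hV hu hW (l := (l.1, m.2)) e ht hY hut,
    𝒢.Δ.extends_toHom_id hU hv hW' (k := (k.1, l.2)) e' hX hb hvb] at h
  have h1 : ∀ W, 𝒢.psiPhi (FP.assoc ((FP.map 𝒢.Δ.toEvHom (EvHom.id E) W).lft
      (FP.tm (FP.tm t c) b))) = 𝒢.psiL (𝒢.fpPhiL b W) t * c := fun W => by
    refine FP.induction (p := fun W => 𝒢.psiPhi (FP.assoc ((FP.map 𝒢.Δ.toEvHom (EvHom.id E) W).lft
      (FP.tm (FP.tm t c) b))) = 𝒢.psiL (𝒢.fpPhiL b W) t * c) (by simp)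
      (fun x y hx hy => by simp only [map_add, Mult.add_lft, LinearMap.add_apply, add_mul, hx, hy])
      ?_ W
    intro p q f g ep hf hg
    rw [𝒢.Δ.map_toHom_id_tm ep hf hg (k := (k.1, l.2)) e' hX hb, FP.assoc,
      FP.lift_tm _ _ (g := p * (k.1, l.2)) (h := q * m) (by simp [ep, e'])
        (𝒢.Δ.lft_mem hf hX) (E.mul_mem hg hb),
      𝒢.psiPhi_assocAux (g := p * (k.1, l.2)) (h := q * m) (by simp [ep, e'])
        (𝒢.Δ.lft_mem hf hX) (E.mul_mem hg hb), 𝒢.fpPsi_lft e ht hc, 𝒢.fpPhiL_tm ep hf hg,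
      psiL_s_lft, Mult.lft_mul]
  have h2 : ∀ W, 𝒢.psiPhi ((FP.map (EvHom.id E) 𝒢.Δ.toEvHom W).lft
      (FP.tm t (FP.tm c b))) = 𝒢.phiL (𝒢.fpPsiL t W) b * c := fun W => by
    refine FP.induction (p := fun W => 𝒢.psiPhi ((FP.map (EvHom.id E) 𝒢.Δ.toEvHom W).lft
      (FP.tm t (FP.tm c b))) = 𝒢.phiL (𝒢.fpPsiL t W) b * c) (by simp)
      (fun x y hx hy => by simp only [map_add, Mult.add_lft, LinearMap.add_apply, add_mul, hx, hy])
      ?_ W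
    intro p q f g ep hf hg
    rw [𝒢.Δ.map_id_toHom_tm ep hf hg (l := (l.1, m.2)) e ht hY,
      𝒢.psiPhi_tm (g := p * k) (h := q * (l.1, m.2)) (by simp [ep, e]) (E.mul_mem hf ht)
        (𝒢.Δ.lft_mem hg hY), 𝒢.fpPhi_lft e' hc hb, 𝒢.fpPsiL_tm ep hf hg, phiL_r_lft, Mult.lft_mul]
  rwa [h1, h2, ← 𝒢.phiL_eq hv hvb hW', ← 𝒢.psiL_eq hu hut hW] at h

lemma psiL_phiL (a b t : A) : 𝒢.psiL (𝒢.phiL a b) t = 𝒢.phiL (𝒢.psiL a t) b := by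
  refine E.hinduction (p := fun a => 𝒢.psiL (𝒢.phiL a b) t = 𝒢.phiL (𝒢.psiL a t) b) (by simp)
    (fun x y hx hy => by simp only [map_add, LinearMap.add_apply, hx, hy]) (fun α a ha => ?_) a
  refine E.hinduction (p := fun b => 𝒢.psiL (𝒢.phiL a b) t = 𝒢.phiL (𝒢.psiL a t) b) (by simp)
    (fun x y hx hy => by simp only [map_add, LinearMap.add_apply, hx, hy]) (fun β b hb => ?_) b
  refine E.hinduction (p := fun t => 𝒢.psiL (𝒢.phiL a b) t = 𝒢.phiL (𝒢.psiL a t) b) (by simp)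
    (fun x y hx hy => by simp only [map_add, LinearMap.add_apply, hx, hy]) (fun τ t ht => ?_) t
  set D := 𝒢.psiL (𝒢.phiL a b) t - 𝒢.phiL (𝒢.psiL a t) b with hD
  have hDm : D ∈ E.gr (τ.2⁻¹, β.1⁻¹) := sub_mem (𝒢.psiL_mem (𝒢.phiL_mem ha hb) ht)
    (𝒢.phiL_mem (𝒢.psiL_mem ha ht) hb)
  -- The difference D is removed by taking c = D^*, whose degree is exactly the one that matches t
  -- on the left and b on the right.
  have hc : star D ∈ E.gr (τ.2, β.1) := by simpa using E.star_mem hDm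
  refine sub_eq_zero.1 (𝒢.eq_zero_of_mul_star_self (z := D) ?_)
  conv_lhs => rw [hD, sub_mul]
  rw [𝒢.psiL_phiL_mul (l := (τ.2, β.1)) rfl rfl ht hc hb, sub_self]

lemma psiR_phiR (hB : HasLocalUnits B) (w e z : A) :
    𝒢.psiR w (𝒢.phiR e z) = 𝒢.phiR e (𝒢.psiR w z) := by
  rw [← star_inj, 𝒢.star_psiR hB, 𝒢.star_phiR hB, 𝒢.star_phiR hB, 𝒢.star_psiR hB, psiL_phiL]

/-- The product rule of the dual algebra. Pairing with ν(e ·) turns the outer slice into `phiR e`,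
which commutes with the inner one and can then be moved back by `nu_mul_psiR`; strong right
invariance identifies the resulting `psiL w x`. -/
lemma psiR_psiR (hB : HasLocalUnits B) (w x z : A) :
    𝒢.psiR w (𝒢.psiR (𝒢.S.toEquiv x) z) = 𝒢.psiR (𝒢.S.toEquiv (𝒢.psiR w x)) z := by
  refine 𝒢.nu_ext fun e => ?_
  rw [← nu_mul_phiR, ← 𝒢.psiR_phiR hB, 𝒢.nu_mul_psiR hB, nu_mul_phiR, S_psiR]

end MeasuredHopf

end ConvolutionAlgebra

/-! ### A modular map for ν. -/

section Modular

variable {Γ B : Type*} [Group Γ] [NonUnitalCommRing B] [StarRing B] [Module ℂ B]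
variable {act : Γ →* (B ≃⋆ₐ[ℂ] B)}
variable {A : Type*} [NonUnitalRing A] [StarRing A] [Module ℂ A]
    [IsScalarTower ℂ A A] [SMulCommClass ℂ A A] [StarModule ℂ A]
variable [IsScalarTower ℂ B B] [SMulCommClass ℂ B B] [StarModule ℂ B]
variable {E : EvAlg act A}


namespace Weight

/-- D_{γ⁻¹} only lies in M(B); multiplying it into k makes the Radon-Nikodym factor an element of B,
namely k' = γ⁻¹(D_{γ⁻¹}γ(k)). -/
lemma exists_twist (μ : Weight act) (γ : Γ) (k : B) :
    ∃ k', ∀ y, μ.toFun (act γ (k * y)) = μ.toFun (k' * y) := by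
  refine ⟨act γ⁻¹ ((μ.D γ⁻¹).rgt (act γ k)), fun y => ?_⟩
  have h1 : ∀ y, act γ⁻¹ (act γ y) = y := fun y => by
    rw [_root_.map_inv]; exact (act γ).symm_apply_apply y
  rw [← μ.D_spec γ⁻¹ (act γ (k * y)), mul_comm k, _root_.map_mul (act γ), Mult.rgt_mul,
    _root_.map_mul (act γ⁻¹), h1, mul_comm]

lemma exists_twist_left (μ : Weight act) (γ : Γ) (k : B) :
    ∃ k', ∀ x y, μ.toFun (act γ⁻¹ (k * x) * y) = μ.toFun (act γ y * (k' * x)) := by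
  obtain ⟨k', h⟩ := μ.exists_twist γ⁻¹ k
  refine ⟨k', fun x y => ?_⟩
  have h1 : act γ⁻¹ (act γ y) = y := by
    rw [_root_.map_inv]; exact (act γ).symm_apply_apply y
  have := h (x * act γ y)
  rw [← mul_assoc, _root_.map_mul (act γ⁻¹), h1] at this
  rw [this, mul_comm (act γ y), mul_assoc]

lemma exists_twist_right (μ : Weight act) (γ : Γ) (k : B) :
    ∃ k', ∀ x y, μ.toFun (act γ⁻¹ x * (k * y)) = μ.toFun (act γ (k' * y) * x) := by
  obtain ⟨k', h⟩ := μ.exists_twist_left γ (act γ k)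
  refine ⟨act γ⁻¹ k', fun x y => ?_⟩
  have h1 : ∀ y, act γ⁻¹ (act γ y) = y := fun y => by
    rw [_root_.map_inv]; exact (act γ).symm_apply_apply y
  have h2 : ∀ y, act γ (act γ⁻¹ y) = y := fun y => by
    rw [_root_.map_inv]; exact (act γ).apply_symm_apply y
  have := h x y
  rw [_root_.map_mul (act γ⁻¹), h1] at this
  rw [_root_.map_mul (act γ), h2, ← mul_assoc, mul_comm (act γ⁻¹ x) k, this, mul_comm k' x,
    ← mul_assoc, mul_comm (k' * act γ y), ← mul_assoc, mul_comm (act γ y), mul_assoc, mul_assoc,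
    mul_comm k']

end Weight

namespace MeasuredHopf

variable (𝒢 : MeasuredHopf E)

lemma fpPsiL_inrM_lft {d : A} (hd : d ∈ E.gr 1) (w : A) (W : FP E E) :
    𝒢.fpPsiL w ((FP.inrM (Mult.of d) (E.of_mem hd)).lft W) = d * 𝒢.fpPsiL w W :=
  LinearMap.congr_fun (f := 𝒢.fpPsiL w ∘ₗ (FP.inrM (Mult.of d) (E.of_mem hd)).lft)
    (g := LinearMap.mulLeft ℂ d ∘ₗ 𝒢.fpPsiL w) (FP.hext fun g h x y e hx hy => by
      simp only [LinearMap.comp_apply, LinearMap.mulLeft_apply]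
      rw [FP.inrM_lft _ e hx hy, Mult.of_lft, 𝒢.fpPsiL_tm e hx (by simpa using E.mul_mem hd hy),
        𝒢.fpPsiL_tm e hx hy, E.mul_r _ _ hd, Prod.fst_one, act_one_apply]) W

lemma fpPhiL_inlM_lft {d : A} (hd : d ∈ E.gr 1) (w : A) (W : FP E E) :
    𝒢.fpPhiL w ((FP.inlM (Mult.of d) (E.of_mem hd)).lft W) = d * 𝒢.fpPhiL w W :=
  LinearMap.congr_fun (f := 𝒢.fpPhiL w ∘ₗ (FP.inlM (Mult.of d) (E.of_mem hd)).lft)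
    (g := LinearMap.mulLeft ℂ d ∘ₗ 𝒢.fpPhiL w) (FP.hext fun g h x y e hx hy => by
      simp only [LinearMap.comp_apply, LinearMap.mulLeft_apply]
      rw [FP.inlM_lft _ e hx hy, Mult.of_lft, 𝒢.fpPhiL_tm e (by simpa using E.mul_mem hd hx) hy,
        𝒢.fpPhiL_tm e hx hy, E.mul_s _ _ hd, Prod.snd_one, act_one_apply]) W

/-- With X = (1 ⊗ u)Δ(d)(v ⊗ 1), which is one element of the fiber product, two slices that start
from different cut-offs of Δ(d) can be compared on elementary tensors. -/
lemma exists_phiR_psiL {u v : A} (hu : u ∈ E.gr 1) (hv : v ∈ E.gr 1) (d : A) : ∃ X : FP E E,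
    ∀ c t, c * u = c → v * t = t →
      𝒢.phiR c d * t = 𝒢.fpPhiR c X * t ∧ c * 𝒢.psiL d t = c * 𝒢.fpPsiL t X := by
  obtain ⟨W, hW⟩ := 𝒢.Δ.exists_inrM_mul d hu
  obtain ⟨W', hW'⟩ := 𝒢.Δ.exists_mul_inlM d hv
  have h : (FP.inlM (Mult.of v) (E.of_mem hv)).rgt W =
      (FP.inrM (Mult.of u) (E.of_mem hu)).lft W' := by
    apply (FP.ev E E).of_injective
    rw [of_rgt_eq, of_lft_eq, hW, hW', mul_assoc]
  refine ⟨(FP.inlM (Mult.of v) (E.of_mem hv)).rgt W, fun c t hc ht => ⟨?_, ?_⟩⟩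
  · rw [𝒢.phiR_eq hu hc hW, 𝒢.fpPhiR_inlM_rgt hv, mul_assoc, ht]
  · rw [h, 𝒢.psiL_eq hv ht hW', 𝒢.fpPsiL_inrM_lft hu, ← mul_assoc, hc]

lemma exists_psiR_phiL {u v : A} (hu : u ∈ E.gr 1) (hv : v ∈ E.gr 1) (t : A) : ∃ X : FP E E,
    ∀ d c, d * u = d → v * c = c →
      𝒢.psiR d t * c = 𝒢.fpPsiR d X * c ∧ d * 𝒢.phiL t c = d * 𝒢.fpPhiL c X := by
  obtain ⟨W, hW⟩ := 𝒢.Δ.exists_inlM_mul t hu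
  obtain ⟨W', hW'⟩ := 𝒢.Δ.exists_mul_inrM t hv
  have h : (FP.inrM (Mult.of v) (E.of_mem hv)).rgt W =
      (FP.inlM (Mult.of u) (E.of_mem hu)).lft W' := by
    apply (FP.ev E E).of_injective
    rw [of_rgt_eq, of_lft_eq, hW, hW', mul_assoc]
  refine ⟨(FP.inrM (Mult.of v) (E.of_mem hv)).rgt W, fun d c hd hc => ⟨?_, ?_⟩⟩
  · rw [𝒢.psiR_eq hu hd hW, 𝒢.fpPsiR_inrM_rgt hv, mul_assoc, hc]
  · rw [h, 𝒢.phiL_eq hv hc hW', 𝒢.fpPhiL_inlM_lft hu, ← mul_assoc, hd]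

section
variable {p q κ : Γ × Γ} {x y c : A} (e : p.2 = q.1) (hx : x ∈ E.gr p) (hy : y ∈ E.gr q)
  (hc : c ∈ E.gr κ)
include e hx hy hc

/-- Moving s(φ(cy)) to the left of x twists it by the first degree of y. Where φ(cy) does not
vanish, this is the inverse of the first degree of c, so the twist depends on c alone. -/
lemma nu_fpPhiR_tm_mul (t : A) : 𝒢.nu (𝒢.fpPhiR c (FP.tm x y) * t) =
    𝒢.μ.toFun (act κ.1⁻¹ (𝒢.φ.toFun (c * y)) * 𝒢.ψ.toFun (x * t)) := by
  rw [𝒢.fpPhiR_tm e hx hy]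
  by_cases h : κ * q = 1
  · rw [E.twist_s _ hx, ← Mult.lft_mul, nu_s_lft, e,
      eq_inv_of_mul_eq_one_right (congrArg Prod.fst h)]
  · rw [𝒢.phi_eq_zero (E.mul_mem hc hy) h]; simp

lemma nu_mul_fpPsiL_tm (t : A) : 𝒢.nu (c * 𝒢.fpPsiL t (FP.tm x y)) =
    𝒢.μ.toFun (act κ.1 (𝒢.ψ.toFun (x * t)) * 𝒢.φ.toFun (c * y)) := by
  rw [𝒢.fpPsiL_tm e hx hy, E.mul_r _ _ hc, nu_r_lft]

lemma nu_fpPhiR_tm_mul' (t : A) : 𝒢.nu (𝒢.fpPhiR t (FP.tm x y) * c) =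
    𝒢.μ.toFun (act κ.2⁻¹ (𝒢.φ.toFun (t * y)) * 𝒢.ψ.toFun (x * c)) := by
  rw [𝒢.fpPhiR_tm e hx hy]
  rw [E.twist_s _ hx, ← Mult.lft_mul, nu_s_lft]
  by_cases h : p * κ = 1
  · rw [eq_inv_of_mul_eq_one_left (congrArg Prod.snd h)]
  · rw [𝒢.psi_eq_zero (E.mul_mem hx hc) h]; simp

lemma nu_mul_fpPsiL_tm' (t : A) : 𝒢.nu (t * 𝒢.fpPsiL c (FP.tm x y)) =
    𝒢.μ.toFun (act κ.2 (𝒢.ψ.toFun (x * c)) * 𝒢.φ.toFun (t * y)) := by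
  rw [𝒢.fpPsiL_tm e hx hy]
  by_cases h : p * κ = 1
  · have h1 : κ.2 = q.1⁻¹ := by
      rw [← e]; exact eq_inv_of_mul_eq_one_right (congrArg Prod.snd h)
    have h2 := E.twist_r (act q.1⁻¹ (𝒢.ψ.toFun (x * c))) hy
    rw [act_act_inv] at h2
    rw [← h2, ← Mult.rgt_mul, nu_r_rgt, h1]
  · rw [𝒢.psi_eq_zero (E.mul_mem hx hc) h]; simp

lemma nu_fpPsiR_tm_mul (t : A) : 𝒢.nu (𝒢.fpPsiR c (FP.tm x y) * t) =
    𝒢.μ.toFun (act κ.2⁻¹ (𝒢.ψ.toFun (c * x)) * 𝒢.φ.toFun (y * t)) := by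
  rw [𝒢.fpPsiR_tm e hx hy]
  by_cases h : κ * p = 1
  · rw [E.twist_r _ hy, ← Mult.lft_mul, nu_r_lft, ← e,
      eq_inv_of_mul_eq_one_right (congrArg Prod.snd h)]
  · rw [𝒢.psi_eq_zero (E.mul_mem hc hx) h]; simp

lemma nu_mul_fpPhiL_tm (t : A) : 𝒢.nu (c * 𝒢.fpPhiL t (FP.tm x y)) =
    𝒢.μ.toFun (act κ.2 (𝒢.φ.toFun (y * t)) * 𝒢.ψ.toFun (c * x)) := by
  rw [𝒢.fpPhiL_tm e hx hy, E.mul_s _ _ hc, nu_s_lft]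

end

/-- For c of degree κ the two sides only differ in whether κ₁⁻¹ acts on φ(cy) or κ₁ acts on ψ(xt).
Quasi-invariance of μ exchanges them, at the price of changing c. -/
lemma exists_nu_phiR_mul (c : A) :
    ∃ c', ∀ d t, 𝒢.nu (𝒢.phiR c d * t) = 𝒢.nu (c' * 𝒢.psiL d t) := by
  refine E.hinduction (p := fun c => ∃ c', ∀ d t, 𝒢.nu (𝒢.phiR c d * t) =
    𝒢.nu (c' * 𝒢.psiL d t)) ⟨0, by simp⟩ ?_ (fun κ c hc => ?_) c
  · rintro x y ⟨x', hx⟩ ⟨y', hy⟩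
    exact ⟨x' + y', fun d t => by simp only [map_add, LinearMap.add_apply, add_mul, hx, hy]⟩
  -- The local unit k is where the Radon-Nikodym multiplier is absorbed; c' = r(k')c.
  obtain ⟨k, hk⟩ := E.r_units {c}
  obtain ⟨k', hk'⟩ := 𝒢.μ.exists_twist_left κ.1 k
  refine ⟨(E.r k').lft c, fun d t => ?_⟩
  obtain ⟨u, hu, hcu⟩ := E.runit1 c
  obtain ⟨v, hv, hvt⟩ := E.unit1 t
  obtain ⟨X, hX⟩ := 𝒢.exists_phiR_psiL hu hv d
  rw [(hX c t hcu hvt).1, (hX _ t (by rw [← Mult.lft_mul, hcu]) hvt).2]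
  refine FP.induction (p := fun X => 𝒢.nu (𝒢.fpPhiR c X * t) =
    𝒢.nu ((E.r k').lft c * 𝒢.fpPsiL t X)) (by simp)
    (fun x y hx hy => by simp only [map_add, add_mul, mul_add, hx, hy]) ?_ X
  intro p q x y e hx hy
  rw [𝒢.nu_fpPhiR_tm_mul e hx hy hc, 𝒢.nu_mul_fpPsiL_tm e hx hy (E.r_mem k' hc)]
  conv_lhs => rw [← hk c (by simp)]
  rw [← Mult.lft_mul, ← Mult.lft_mul, 𝒢.φ.map_lft, 𝒢.φ.map_lft, hk']

lemma exists_nu_phiR_mul' (w : A) :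
    ∃ w', ∀ c d, 𝒢.nu (𝒢.phiR c d * w) = 𝒢.nu (c * 𝒢.psiL d w') := by
  refine E.hinduction (p := fun w => ∃ w', ∀ c d, 𝒢.nu (𝒢.phiR c d * w) =
    𝒢.nu (c * 𝒢.psiL d w')) ⟨0, by simp⟩ ?_ (fun κ w hw => ?_) w
  · rintro x y ⟨x', hx⟩ ⟨y', hy⟩
    exact ⟨x' + y', fun d t => by simp only [map_add, mul_add, hx, hy]⟩
  obtain ⟨k, hk⟩ := E.s_units {star w}
  have hkw : (E.s (star k)).rgt w = w := by
    rw [← star_inj, E.star_s_rgt, star_star, hk _ (by simp)]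
  obtain ⟨k', hk'⟩ := 𝒢.μ.exists_twist_right κ.2 (star k)
  refine ⟨(E.s k').rgt w, fun c d => ?_⟩
  obtain ⟨u, hu, hcu⟩ := E.runit1 c
  obtain ⟨v, hv, hvw⟩ := E.unit1 w
  obtain ⟨X, hX⟩ := 𝒢.exists_phiR_psiL hu hv d
  rw [(hX c w hcu hvw).1, (hX c _ hcu (by rw [← Mult.rgt_mul, hvw])).2]
  refine FP.induction (p := fun X => 𝒢.nu (𝒢.fpPhiR c X * w) =
    𝒢.nu (c * 𝒢.fpPsiL ((E.s k').rgt w) X)) (by simp)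
    (fun x y hx hy => by simp only [map_add, add_mul, mul_add, hx, hy]) ?_ X
  intro p q x y e hx hy
  rw [𝒢.nu_fpPhiR_tm_mul' e hx hy hw, 𝒢.nu_mul_fpPsiL_tm' e hx hy (E.s_rgt_mem k' hw)]
  conv_lhs => rw [← hkw]
  rw [← Mult.rgt_mul, ← Mult.rgt_mul, 𝒢.ψ.map_rgt, 𝒢.ψ.map_rgt, mul_comm _ (star k), hk',
    mul_comm k']

lemma exists_nu_psiR_mul (d : A) :
    ∃ d', ∀ t c, 𝒢.nu (𝒢.psiR d t * c) = 𝒢.nu (d' * 𝒢.phiL t c) := by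
  refine E.hinduction (p := fun d => ∃ d', ∀ t c, 𝒢.nu (𝒢.psiR d t * c) =
    𝒢.nu (d' * 𝒢.phiL t c)) ⟨0, by simp⟩ ?_ (fun κ d hd => ?_) d
  · rintro x y ⟨x', hx⟩ ⟨y', hy⟩
    exact ⟨x' + y', fun d t => by simp only [map_add, LinearMap.add_apply, add_mul, hx, hy]⟩
  obtain ⟨k, hk⟩ := E.s_units {d}
  obtain ⟨k', hk'⟩ := 𝒢.μ.exists_twist_left κ.2 k
  refine ⟨(E.s k').lft d, fun t c => ?_⟩
  obtain ⟨u, hu, hdu⟩ := E.runit1 d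
  obtain ⟨v, hv, hvc⟩ := E.unit1 c
  obtain ⟨X, hX⟩ := 𝒢.exists_psiR_phiL hu hv t
  rw [(hX d c hdu hvc).1, (hX _ c (by rw [← Mult.lft_mul, hdu]) hvc).2]
  refine FP.induction (p := fun X => 𝒢.nu (𝒢.fpPsiR d X * c) =
    𝒢.nu ((E.s k').lft d * 𝒢.fpPhiL c X)) (by simp)
    (fun x y hx hy => by simp only [map_add, add_mul, mul_add, hx, hy]) ?_ X
  intro p q x y e hx hy
  rw [𝒢.nu_fpPsiR_tm_mul e hx hy hd, 𝒢.nu_mul_fpPhiL_tm e hx hy (E.s_mem k' hd)]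
  conv_lhs => rw [← hk d (by simp)]
  rw [← Mult.lft_mul, ← Mult.lft_mul, 𝒢.ψ.map_lft, 𝒢.ψ.map_lft, hk']

/-- The functional `ν` admits a modular map. -/
lemma exists_nu_mul_comm (u : A) :
    ∃ b, ∀ t, 𝒢.nu (u * t) = 𝒢.nu (t * b) := by
  have hu : u ∈ Submodule.span ℂ {z | ∃ c b, z = 𝒢.phiR c b} := by
    rw [𝒢.span_phiR]; trivial
  refine Submodule.span_induction ?_ ⟨0, by simp⟩ ?_ ?_ hu
  · rintro _ ⟨c, d, rfl⟩
    obtain ⟨c₁, h₁⟩ := 𝒢.exists_nu_phiR_mul c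
    obtain ⟨d₁, h₂⟩ := 𝒢.exists_nu_psiR_mul d
    obtain ⟨w₁, h₃⟩ := 𝒢.exists_nu_phiR_mul' (𝒢.S.toEquiv d₁)
    -- With v = S⁻¹(c₁): ν(`phiR c d` t) = ν(c₁ `psiL d t`) = ν(`psiR d t` v) = ν(d₁ `phiL t v`) =
    -- ν(`phiR t v` S(d₁)) = ν(t `psiL v w₁`). Each use of S relies on strong invariance and ν ∘ S =
    -- ν.
    refine ⟨𝒢.psiL (𝒢.S.toEquiv.symm c₁) w₁, fun t => ?_⟩
    rw [h₁, ← S_psiR]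
    conv_lhs => rw [← 𝒢.S.toEquiv.apply_symm_apply c₁]
    rw [← 𝒢.S.map_mul, nu_S, h₂, ← nu_S, 𝒢.S.map_mul, S_phiL, h₃]
  · rintro x y _ _ ⟨b, hb⟩ ⟨c, hc⟩
    exact ⟨b + c, fun t => by simp only [add_mul, mul_add, map_add, hb, hc]⟩
  · rintro z x _ ⟨b, hb⟩
    exact ⟨z • b, fun t => by simp only [smul_mul_assoc, mul_smul_comm, map_smul, hb]⟩

end MeasuredHopf

end Modular

/-! ### Positive operator matrices and their Schur products. -/

section Hilbert

variable {H : Type*} [NormedAddCommGroup H] [InnerProductSpace ℂ H]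
variable {ι : Type*} [Fintype ι]

/-- A positive operator has a positive square root in its double commutant. -/
lemma exists_sqrt [CompleteSpace H] {q : H →L[ℂ] H} (hq : 0 ≤ q) :
    ∃ r : H →L[ℂ] H, r * r = q ∧ (∀ x y, inner ℂ (r x) y = inner ℂ x (r y)) ∧
      ∀ T, Commute q T → Commute r T := by
  refine ⟨CFC.sqrt q, CFC.sqrt_mul_sqrt_self q, ?_, fun T hT => ?_⟩
  · have h1 : IsSelfAdjoint (CFC.sqrt q) := (CFC.sqrt_nonneg q).isSelfAdjoint
    rw [ContinuousLinearMap.isSelfAdjoint_iff_isSymmetric] at h1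
    exact h1
  · rw [CFC.sqrt]
    exact Commute.cfcₙ_nnreal hT NNReal.sqrt

/-- The operator on `H^ι` given by an operator matrix. -/
def opMatrix (Q : ι → ι → H →L[ℂ] H) : PiLp 2 (fun _ : ι => H) →L[ℂ] PiLp 2 (fun _ : ι => H) :=
  (PiLp.continuousLinearEquiv 2 ℂ (fun _ : ι => H)).symm.toContinuousLinearMap ∘L
    ContinuousLinearMap.pi fun i => ∑ j, Q i j ∘L PiLp.proj 2 (fun _ : ι => H) j

@[simp] lemma opMatrix_apply (Q : ι → ι → H →L[ℂ] H) (x : PiLp 2 (fun _ : ι => H)) (i : ι) :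
    opMatrix Q x i = ∑ j, Q i j (x j) := by
  simp [opMatrix]

/-- The diagonal operator on `H^ι`. -/
def opDiag (ι : Type*) [Fintype ι] (T : H →L[ℂ] H) :
    PiLp 2 (fun _ : ι => H) →L[ℂ] PiLp 2 (fun _ : ι => H) :=
  (PiLp.continuousLinearEquiv 2 ℂ (fun _ : ι => H)).symm.toContinuousLinearMap ∘L
    ContinuousLinearMap.pi fun i => T ∘L PiLp.proj 2 (fun _ : ι => H) i

@[simp] lemma opDiag_apply (T : H →L[ℂ] H) (x : PiLp 2 (fun _ : ι => H)) (i : ι) :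
    opDiag ι T x i = T (x i) := by
  simp [opDiag]

lemma opMatrix_commute {Q : ι → ι → H →L[ℂ] H} {T : H →L[ℂ] H} (h : ∀ i j, Commute T (Q i j)) :
    Commute (opMatrix Q) (opDiag ι T) := by
  refine ContinuousLinearMap.ext fun x => ?_
  ext i
  simp only [mul_apply_eq_comp, opMatrix_apply, opDiag_apply, map_sum]
  exact Finset.sum_congr rfl fun j _ => (DFunLike.congr_fun (h i j).eq (x j)).symm

variable [CompleteSpace H]

lemma opMatrix_nonneg {Q : ι → ι → H →L[ℂ] H}
    (h : ∀ ξ : ι → H, 0 ≤ ∑ i, ∑ j, inner ℂ (ξ i) (Q i j (ξ j))) : 0 ≤ opMatrix Q := by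
  rw [ContinuousLinearMap.nonneg_iff_isPositive, ContinuousLinearMap.isPositive_iff_complex]
  intro x
  have h1 : inner ℂ x (opMatrix Q x) = ∑ i, ∑ j, inner ℂ (x i) (Q i j (x j)) := by
    simp [PiLp.inner_apply, inner_sum]
  have h2 := h fun i => x i
  rw [← h1] at h2
  have h3 : inner ℂ (opMatrix Q x) x = inner ℂ x (opMatrix Q x) := by
    rw [← inner_conj_symm]
    exact Complex.conj_eq_iff_im.2 (Complex.nonneg_iff.1 h2).2.symm
  rw [h3]
  refine ⟨?_, (Complex.nonneg_iff.1 h2).1⟩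
  exact Complex.ext (by simp) (by simpa using (Complex.nonneg_iff.1 h2).2)

/-- The Schur product of commuting positive operator matrices is positive. -/
lemma schur_nonneg {P Q : ι → ι → H →L[ℂ] H}
    (hP : ∀ ξ : ι → H, 0 ≤ ∑ i, ∑ j, inner ℂ (ξ i) (P i j (ξ j)))
    (hQ : ∀ ξ : ι → H, 0 ≤ ∑ i, ∑ j, inner ℂ (ξ i) (Q i j (ξ j)))
    (hc : ∀ i j k l, Commute (star (P i j)) (Q k l)) (v : H) :
    0 ≤ ∑ i, ∑ j, inner ℂ v (P i j (Q i j v)) := by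
  classical
  set q := opMatrix Q with hq
  have q0 : 0 ≤ q := opMatrix_nonneg hQ
  -- The root of Q, unlike an arbitrary factorization, commutes with everything that commutes with
  -- Q, in particular with the diagonal operators of the adjoints of the entries of P.
  obtain ⟨r, hrr, hrs, hrc'⟩ := exists_sqrt q0
  have hrc : ∀ i j, Commute r (opDiag ι (star (P i j))) := fun i j =>
    hrc' _ (opMatrix_commute (hc i j))
  let e : ι → H → PiLp 2 (fun _ : ι => H) := fun i x => PiLp.single 2 i x
  have he : ∀ i x k, e i x k = if k = i then x else 0 := fun i x k => by
    simp [e]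
  -- ⟨v, P_ij Q_ij v⟩ is the matrix coefficient of Q between P_ij^*v in slot i and v in slot j.
  -- Writing Q = r·r and moving the diagonal operator of P_ij^* past r leaves one form of P for each
  -- coordinate k.
  have hi : ∀ i j, inner ℂ v (P i j (Q i j v)) =
      ∑ k, inner ℂ (r (e i v) k) (P i j (r (e j v) k)) := fun i j => by
    have h1 : ∀ x y, inner ℂ (e i x) (q (e j y)) = inner ℂ x (Q i j y) := fun x y => by
      rw [PiLp.inner_apply, Finset.sum_eq_single i]
      · simp [hq, he, apply_ite]
      · intro k _ hk; simp [he, hk]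
      · simp
    have h2 : opDiag ι (star (P i j)) (e i v) = e i (star (P i j) v) := by
      ext k; simp only [opDiag_apply, he]; split_ifs <;> simp
    rw [← ContinuousLinearMap.adjoint_inner_left, ← ContinuousLinearMap.star_eq_adjoint, ← h1,
      ← hrr, mul_apply_eq_comp, ← hrs, ← h2]
    have h3 := DFunLike.congr_fun (hrc i j).eq (e i v)
    simp only [mul_apply_eq_comp] at h3
    rw [h3, PiLp.inner_apply]
    simp only [opDiag_apply]
    exact Finset.sum_congr rfl fun k _ => by
      rw [ContinuousLinearMap.star_eq_adjoint, ContinuousLinearMap.adjoint_inner_left]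
  have h4 : ∑ i, ∑ j, inner ℂ v (P i j (Q i j v)) =
      ∑ k, ∑ i, ∑ j, inner ℂ (r (e i v) k) (P i j (r (e j v) k)) := by
    simp only [hi]
    rw [Finset.sum_comm]
    conv_rhs => rw [Finset.sum_comm]
    rw [Finset.sum_comm]
    exact Finset.sum_congr rfl fun i _ => Finset.sum_comm
  rw [h4]
  exact Finset.sum_nonneg fun k _ => hP fun i => r (e i v) k

end Hilbert

/-! ### The GNS completion: Cauchy-Schwarz, density and extension of bounded maps. -/

section Extension

variable {A : Type*} [NonUnitalRing A] [StarRing A] [Module ℂ A]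
    [IsScalarTower ℂ A A] [SMulCommClass ℂ A A] [StarModule ℂ A]
variable (ω : A →ₗ[ℂ] ℂ) (h : ∀ a, 0 ≤ ω (star a * a))

lemma GNS.denseRange_lam : DenseRange (GNS.lam ω h) :=
  UniformSpace.Completion.denseRange_coe (α := PreGNS ω h)

lemma GNS.norm_sq_lam (x : A) : ((‖GNS.lam ω h x‖ ^ 2 : ℝ) : ℂ) = ω (star x * x) := by
  rw [← GNS.inner_lam ω h, inner_self_eq_norm_sq_to_K]; simp

/-- The Cauchy-Schwarz inequality for a positive functional. -/
lemma GNS.cauchy_schwarz (h : ∀ a, 0 ≤ ω (star a * a)) (x y : A) :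
    ‖ω (star x * y)‖ ^ 2 ≤ (ω (star x * x)).re * (ω (star y * y)).re := by
  rw [← GNS.inner_lam ω h, ← GNS.norm_sq_lam ω h, ← GNS.norm_sq_lam ω h, Complex.ofReal_re,
    Complex.ofReal_re, ← mul_pow]
  exact pow_le_pow_left₀ (norm_nonneg _) (norm_inner_le_norm _ _) 2

lemma GNS.clm_ext {V : Type*} [NormedAddCommGroup V] [NormedSpace ℂ V] {S T : GNS ω h →L[ℂ] V}
    (hST : ∀ x, S (GNS.lam ω h x) = T (GNS.lam ω h x)) : S = T :=
  ContinuousLinearMap.coeFn_injective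
    ((GNS.denseRange_lam ω h).equalizer S.continuous T.continuous (funext hST))

/-- Operators which are bounded with respect to the inner product extend to the completion. -/
lemma GNS.exists_extend (R : A →ₗ[ℂ] A) (K : ℝ)
    (hK : ∀ y, (ω (star (R y) * R y)).re ≤ K * (ω (star y * y)).re) :
    ∃ T : GNS ω h →L[ℂ] GNS ω h, ∀ y, T (GNS.lam ω h y) = GNS.lam ω h (R y) := by
  have h1 : ∀ y, ‖(GNS.lam ω h ∘ₗ R) y‖ ≤ √K * ‖GNS.lam ω h y‖ := fun y => by
    have h2 := hK y
    rw [← GNS.norm_sq_lam ω h, ← GNS.norm_sq_lam ω h, Complex.ofReal_re, Complex.ofReal_re] at h2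
    rw [LinearMap.comp_apply, ← Real.sqrt_sq (norm_nonneg (GNS.lam ω h y)),
      ← Real.sqrt_mul' _ (sq_nonneg _)]
    exact Real.le_sqrt_of_sq_le h2
  exact ⟨(GNS.lam ω h ∘ₗ R).extendOfNorm (GNS.lam ω h), fun y =>
    LinearMap.extendOfNorm_eq (GNS.denseRange_lam ω h) ⟨_, h1⟩ y⟩

/-- A continuous inequality on `H^n` may be verified on `A^n`. -/
lemma GNS.forall_of_dense {ι : Type*} [Fintype ι] {f : (ι → GNS ω h) → ℂ} (hf : Continuous f)
    (h0 : ∀ c : ι → A, 0 ≤ f fun i => GNS.lam ω h (c i)) (ξ : ι → GNS ω h) : 0 ≤ f ξ := by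
  have hd : DenseRange fun c : ι → A => fun i => GNS.lam ω h (c i) :=
    DenseRange.piMap fun _ => GNS.denseRange_lam ω h
  have hcl : IsClosed {ξ | 0 ≤ f ξ} := by
    have : {ξ | 0 ≤ f ξ} = f ⁻¹' (Set.Ici 0) := rfl
    rw [this]
    have h2 : IsClosed (Set.Ici (0 : ℂ)) := by
      have : Set.Ici (0 : ℂ) = {z | 0 ≤ z.re} ∩ {z | 0 = z.im} := by
        ext z; exact Complex.nonneg_iff
      rw [this]
      exact (isClosed_le continuous_const Complex.continuous_re).inter
        (isClosed_eq continuous_const Complex.continuous_im)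
    exact h2.preimage hf
  exact hd.induction_on (p := fun ξ => 0 ≤ f ξ) ξ hcl h0

end Extension

/-! ### Positive matrices over B and the action of Γ on them. -/

section WeightPositivity

variable {Γ B : Type*} [Group Γ] [NonUnitalCommRing B] [StarRing B] [Module ℂ B]
variable {act : Γ →* (B ≃⋆ₐ[ℂ] B)}
variable {A : Type*} [NonUnitalRing A] [StarRing A] [Module ℂ A]
    [IsScalarTower ℂ A A] [SMulCommClass ℂ A A] [StarModule ℂ A]
variable [IsScalarTower ℂ B B] [SMulCommClass ℂ B B] [StarModule ℂ B]
variable {E : EvAlg act A}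


namespace Weight

variable (μ : Weight act)

variable {μ}

lemma IsBounded.exists_mulOp (hb : μ.IsBounded) (b : B) :
    ∃ T : GNS μ.toFun μ.nonneg →L[ℂ] GNS μ.toFun μ.nonneg,
      ∀ c, T (GNS.lam μ.toFun μ.nonneg c) = GNS.lam μ.toFun μ.nonneg (b * c) := by
  obtain ⟨K, hK, h⟩ := hb b
  refine GNS.exists_extend _ _ (LinearMap.mulLeft ℂ b) K fun c => ?_
  have := (Complex.le_def.1 (h c)).1
  simpa [mul_assoc, mul_left_comm] using this

/-- The operator of multiplication by `b`. -/
def IsBounded.mulOp (hb : μ.IsBounded) (b : B) : GNS μ.toFun μ.nonneg →L[ℂ] GNS μ.toFun μ.nonneg :=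
  Classical.choose (hb.exists_mulOp b)

variable (hb : μ.IsBounded)

@[simp] lemma IsBounded.mulOp_lam (b c : B) :
    hb.mulOp b (GNS.lam μ.toFun μ.nonneg c) = GNS.lam μ.toFun μ.nonneg (b * c) :=
  Classical.choose_spec (hb.exists_mulOp b) c

lemma IsBounded.star_mulOp (b : B) : star (hb.mulOp b) = hb.mulOp (star b) := by
  refine GNS.clm_ext _ _ fun x => ?_
  refine (GNS.denseRange_lam μ.toFun μ.nonneg).eq_of_inner_right (𝕜 := ℂ) fun y => ?_
  rw [ContinuousLinearMap.star_eq_adjoint, ContinuousLinearMap.adjoint_inner_right, mulOp_lam,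
    mulOp_lam, GNS.inner_lam, GNS.inner_lam]
  congr 1
  rw [star_mul, mul_assoc, mul_left_comm]

lemma IsBounded.commute_mulOp (b c : B) : Commute (hb.mulOp b) (hb.mulOp c) :=
  GNS.clm_ext _ _ fun x => by
    simp only [mul_apply_eq_comp, mulOp_lam]
    rw [mul_left_comm]

lemma exists_unit (hB : HasLocalUnits B) {ι : Type*} [Finite ι] (k : ι → B) :
    ∃ u : B, ∀ i, star u * (k i * u) = k i := by
  classical
  have := Fintype.ofFinite ι
  obtain ⟨u, hu⟩ := hB (Finset.univ.image k ∪ Finset.univ.image fun i => star (k i))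
  refine ⟨u, fun i => ?_⟩
  have h1 : u * k i = k i := hu _ (by simp)
  have h2 : u * star (k i) = star (k i) := hu _ (by simp)
  have h3 : k i * star u = k i := by simpa [mul_comm] using congrArg star h2
  rw [mul_comm (k i), h1, mul_comm, h3]

/-- A matrix over `B` is positive in the weight `μ`. -/
def PosMatrix (μ : Weight act) {ι : Type*} [Fintype ι] (P : ι → ι → B) : Prop :=
  ∀ c : ι → B, 0 ≤ ∑ i, ∑ j, μ.toFun (star (c i) * (P i j * c j))

lemma PosMatrix.mulOp_nonneg {ι : Type*} [Fintype ι] {P : ι → ι → B} (hP : μ.PosMatrix P)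
    (ξ : ι → GNS μ.toFun μ.nonneg) : 0 ≤ ∑ i, ∑ j, inner ℂ (ξ i) (hb.mulOp (P i j) (ξ j)) := by
  refine GNS.forall_of_dense _ _
    (f := fun ξ => ∑ i, ∑ j, inner ℂ (ξ i) (hb.mulOp (P i j) (ξ j))) (by fun_prop) (fun c => ?_) ξ
  simpa [GNS.inner_lam] using hP c

include hb in
-- Multiplication operators on L²(μ) commute, so the operator version applies. The vector is a local
-- unit u with u^*ku = k for all products k = P_ij Q_ij, which turns the vector state into μ.
lemma PosMatrix.schur (hB : HasLocalUnits B) {ι : Type*} [Fintype ι] {P Q : ι → ι → B}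
    (hP : μ.PosMatrix P) (hQ : μ.PosMatrix Q) : 0 ≤ ∑ i, ∑ j, μ.toFun (P i j * Q i j) := by
  obtain ⟨u, hu⟩ := exists_unit hB fun ij : ι × ι => P ij.1 ij.2 * Q ij.1 ij.2
  have := schur_nonneg (hP.mulOp_nonneg hb) (hQ.mulOp_nonneg hb) (fun i j k l => by
    rw [hb.star_mulOp]; exact hb.commute_mulOp _ _) (GNS.lam μ.toFun μ.nonneg u)
  refine this.trans_eq (Finset.sum_congr rfl fun i _ => Finset.sum_congr rfl fun j _ => ?_)
  rw [hb.mulOp_lam, hb.mulOp_lam, GNS.inner_lam]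
  congr 1
  simpa [mul_assoc] using hu (i, j)

lemma rgt_eq_lft (hB : HasLocalUnits B) (T : Mult B) (x : B) : T.rgt x = T.lft x := by
  classical
  obtain ⟨u, hu⟩ := hB {T.rgt x, T.lft x}
  rw [← hu (T.rgt x) (by simp), ← hu (T.lft x) (by simp), mul_comm u, T.mid, mul_comm, ← T.lft_mul,
    mul_comm u, T.lft_mul, mul_comm u]

/-- T is multiplication by δ⁻¹(D_{δ⁻¹}^{1/2}). By quasi-invariance μ ∘ δ is μ with density
δ⁻¹(D_{δ⁻¹}), and this density is split into two self-adjoint factors, one for each of c and d. -/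
lemma exists_root_twist (hB : HasLocalUnits B) (hr : μ.HasModularRoot) (δ : Γ) :
    ∃ T : B → B, ∀ c d, μ.toFun (act δ (star c * d)) = μ.toFun (star (T c) * T d) ∧
      ∀ y, μ.toFun (act δ (star c * (y * d))) = μ.toFun (star (T c) * (y * T d)) := by
  obtain ⟨R, -, hs, hD, -, -⟩ := hr
  have hi : ∀ x, act δ (act δ⁻¹ x) = x := fun x => by
    rw [_root_.map_inv]; exact (act δ).apply_symm_apply x
  have hi' : ∀ x, act δ⁻¹ (act δ x) = x := fun x => by
    rw [_root_.map_inv]; exact (act δ).symm_apply_apply x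
  have key : ∀ z, μ.toFun (act δ z) =
      μ.toFun (act δ⁻¹ ((R δ⁻¹).lft ((R δ⁻¹).lft (act δ z)))) := fun z => by
    rw [← μ.D_spec δ⁻¹ (act δ z), ← hD, Mult.mul_rgt, rgt_eq_lft hB, rgt_eq_lft hB]
  have hst : ∀ x, star ((R δ⁻¹).lft x) = (R δ⁻¹).lft (star x) := fun x => by
    rw [← rgt_eq_lft hB (R δ⁻¹) (star x)]
    conv_rhs => rw [← hs δ⁻¹, Mult.star_rgt, star_star]
  have hm : ∀ x y, (R δ⁻¹).lft (x * y) = x * (R δ⁻¹).lft y := fun x y => by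
    rw [mul_comm, Mult.lft_mul, mul_comm]
  refine ⟨fun c => act δ⁻¹ ((R δ⁻¹).lft (act δ c)), fun c d => ⟨?_, fun y => ?_⟩⟩
  · dsimp only
    rw [key, ← StarHomClass.map_star (act δ⁻¹), hst, ← map_mul, map_mul (act δ), hm, Mult.lft_mul,
      StarHomClass.map_star (act δ)]
  · dsimp only
    conv_rhs => rw [← hi' y]
    rw [key, ← StarHomClass.map_star (act δ⁻¹), hst, ← map_mul, ← map_mul, map_mul (act δ),
      map_mul (act δ), hm, Mult.lft_mul, hm, StarHomClass.map_star (act δ)]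

/-- The quadratic form of δ(P) at c is the quadratic form of P at T(δ⁻¹(c)). -/
lemma PosMatrix.twist (hB : HasLocalUnits B) (hr : μ.HasModularRoot) {ι : Type*} [Fintype ι]
    {P : ι → ι → B} (hP : μ.PosMatrix P) (δ : Γ) : μ.PosMatrix fun i j => act δ (P i j) := by
  intro c
  obtain ⟨T, hT⟩ := exists_root_twist hB hr δ
  have hi : ∀ x, act δ (act δ⁻¹ x) = x := fun x => by
    rw [_root_.map_inv]; exact (act δ).apply_symm_apply x
  refine (hP fun i => T (act δ⁻¹ (c i))).trans_eq
    (Finset.sum_congr rfl fun i _ => Finset.sum_congr rfl fun j _ => ?_)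
  rw [← (hT _ _).2, map_mul (act δ), map_mul (act δ), StarHomClass.map_star (act δ), hi, hi]

include hb in
-- If k ≤ K and β ≥ 0 as operators on L²(μ), then μ((K − k)β) ≥ 0, as the case of 1 × 1 matrices of
-- the Schur product.
lemma re_mul_le (hB : HasLocalUnits B) {k β : B} {K : ℝ}
    (hk : ∀ c, μ.toFun (star c * (k * c)) ≤ K * μ.toFun (star c * c))
    (hβ : ∀ c, 0 ≤ μ.toFun (star c * (β * c))) :
    (μ.toFun (k * β)).re ≤ K * (μ.toFun β).re := by
  obtain ⟨u, hu⟩ := exists_unit hB fun i : Bool => bif i then β else k * β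
  have h3 := hu true
  have h4 := hu false
  simp only [cond_true, cond_false] at h3 h4
  have h5 := PosMatrix.schur hb hB
    -- As B need not contain 1, the element K − k is cut down by a local unit u of β and kβ.
    (P := fun _ _ : Unit => (K : ℂ) • (star u * u) - star u * (k * u)) (Q := fun _ _ => β)
    (fun c => ?_) (fun c => by simpa using hβ (c default))
  · simp only [Finset.univ_unique, Finset.sum_singleton, sub_mul, map_sub, sub_nonneg,
      smul_mul_assoc, map_smul] at h5
    rw [show star u * u * β = star u * (β * u) by rw [mul_assoc, mul_comm u], h3,
      show star u * (k * u) * β = star u * (k * β * u) by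
        rw [mul_assoc, mul_assoc, mul_assoc, mul_comm u], h4] at h5
    simpa using (Complex.le_def.1 h5).1
  · have h6 := hk (u * c default)
    rw [star_mul] at h6
    simp only [Finset.univ_unique, Finset.sum_singleton, sub_mul, mul_sub, map_sub, sub_nonneg,
      smul_mul_assoc, mul_smul_comm, map_smul, smul_eq_mul]
    simpa only [mul_assoc] using h6

include hb in
-- The bound μ(c^*k^*kc) ≤ Kμ(c^*c) says that the operator k has norm at most √K, and the
-- self-adjoint k is therefore dominated by √K.
lemma exists_le (hB : HasLocalUnits B) {k : B} (hk : star k = k) :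
    ∃ K : ℝ, 0 ≤ K ∧ ∀ c, μ.toFun (star c * (k * c)) ≤ K * μ.toFun (star c * c) := by
  obtain ⟨K, hK, h⟩ := hb k
  refine ⟨√K, Real.sqrt_nonneg K, fun c => ?_⟩
  have h0 := Complex.nonneg_iff.1 (μ.nonneg c)
  have h1 : μ.toFun (star c * (k * c)) = star (μ.toFun (star c * (k * c))) := by
    rw [← Weight.map_star hB]
    congr 1
    simp only [star_mul, star_star, hk, mul_assoc]
  have h2 : (μ.toFun (star c * (k * c))).im = 0 := Complex.conj_eq_iff_im.1 h1.symm
  have h3 := GNS.cauchy_schwarz μ.toFun μ.nonneg c (k * c)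
  have h4 := (Complex.le_def.1 (h c)).1
  rw [Complex.re_ofReal_mul] at h4
  rw [show star c * star k * k * c = star (k * c) * (k * c) by
    simp only [star_mul, mul_assoc]] at h4
  rw [Complex.le_def, Complex.re_ofReal_mul, Complex.im_ofReal_mul, h2, ← h0.2, mul_zero]
  refine ⟨?_, rfl⟩
  refine le_of_abs_le ((Complex.abs_re_le_norm _).trans ?_)
  refine abs_le_of_sq_le_sq' ?_ (mul_nonneg (Real.sqrt_nonneg K) h0.1) |>.2
  rw [mul_pow, Real.sq_sqrt hK]
  nlinarith [h0.1]

include hb in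
/-- The operators `γ(k)` are uniformly bounded. -/
lemma exists_twist_bound (hB : HasLocalUnits B) (hr : μ.HasModularRoot) {k : B} (hk : star k = k) :
    ∃ K : ℝ, 0 ≤ K ∧ ∀ (γ : Γ) (β : B), (∀ c, 0 ≤ μ.toFun (star c * (β * c))) →
      (μ.toFun (act γ k * β)).re ≤ K * (μ.toFun β).re := by
  obtain ⟨K, hK, h⟩ := exists_le hb hB hk
  refine ⟨K, hK, fun γ β hβ => re_mul_le hb hB (fun c => ?_) hβ⟩
  obtain ⟨T, hT⟩ := exists_root_twist hB hr γ
  have hi : ∀ x, act γ (act γ⁻¹ x) = x := fun x => by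
    rw [_root_.map_inv]; exact (act γ).apply_symm_apply x
  -- The same vector T(γ⁻¹(c)) represents both forms, so the constant for k also serves for γ(k),
  -- for every γ.
  have h1 : μ.toFun (star c * c) = μ.toFun (star (T (act γ⁻¹ c)) * T (act γ⁻¹ c)) := by
    rw [← (hT _ _).1, map_mul (act γ), StarHomClass.map_star (act γ), hi]
  have h2 : μ.toFun (star c * (act γ k * c)) =
      μ.toFun (star (T (act γ⁻¹ c)) * (k * T (act γ⁻¹ c))) := by
    rw [← (hT _ _).2, map_mul (act γ), map_mul (act γ), StarHomClass.map_star (act γ), hi]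
  rw [h1, h2]
  exact h _

end Weight

namespace MeasuredHopf

variable (𝒢 : MeasuredHopf E)

/-- The quadratic form at c is ν(z^*z) for z = ∑ q_i r(c_i). -/
lemma posMatrix_phi {ι : Type*} [Fintype ι] (q : ι → A) :
    𝒢.μ.PosMatrix fun i j => 𝒢.φ.toFun (star (q i) * q j) := by
  intro c
  have h := 𝒢.nu_nonneg (∑ i, (E.r (c i)).rgt (q i))
  rw [star_sum, Finset.sum_mul_sum, map_sum] at h
  simp only [map_sum] at h
  refine h.trans_eq (Finset.sum_congr rfl fun i _ => Finset.sum_congr rfl fun j _ => ?_)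
  rw [nu_eq_phi, ← 𝒢.φ.map_rgt, ← 𝒢.φ.map_lft, E.star_r_rgt, ← Mult.lft_mul, Mult.rgt_mul]

lemma posMatrix_psi {ι : Type*} [Fintype ι] (q : ι → A) :
    𝒢.μ.PosMatrix fun i j => 𝒢.ψ.toFun (star (q i) * q j) := by
  intro c
  have h := 𝒢.nu_nonneg (∑ i, (E.s (c i)).rgt (q i))
  rw [star_sum, Finset.sum_mul_sum, map_sum] at h
  simp only [map_sum] at h
  refine h.trans_eq (Finset.sum_congr rfl fun i _ => Finset.sum_congr rfl fun j _ => ?_)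
  rw [nu_eq_psi, ← 𝒢.ψ.map_rgt, ← 𝒢.ψ.map_lft, E.star_s_rgt, ← Mult.lft_mul, Mult.rgt_mul]

/-- The functional `x ⊗ q ↦ μ(δ(φ(q))ψ(x))`. -/
def nuTensor (δ : Γ) : A ⊗[ℂ] A →ₗ[ℂ] ℂ :=
  TensorProduct.lift (LinearMap.mk₂ ℂ
    (fun x q => 𝒢.μ.toFun (act δ (𝒢.φ.toFun q) * 𝒢.ψ.toFun x))
    (fun x x' q => by simp [mul_add]) (fun z x q => by simp [mul_smul_comm])
    (fun x q q' => by simp [add_mul]) (fun z x q => by simp [smul_mul_assoc]))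

@[simp] lemma nuTensor_tmul (δ : Γ) (x q : A) :
    𝒢.nuTensor δ (x ⊗ₜ q) = 𝒢.μ.toFun (act δ (𝒢.φ.toFun q) * 𝒢.ψ.toFun x) := rfl

/-- For z = ∑ x_i ⊗ q_i the value is ∑ μ(δ(φ(q_i^*q_j))ψ(x_i^*x_j)), a Schur product of two positive
matrices, the first of which stays positive under δ. -/
lemma nuTensor_nonneg (hB : HasLocalUnits B) (hb : 𝒢.μ.IsBounded) (hr : 𝒢.μ.HasModularRoot)
    (δ : Γ) (z : A ⊗[ℂ] A) : 0 ≤ 𝒢.nuTensor δ (star z * z) := by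
  obtain ⟨S, rfl⟩ := TensorProduct.exists_finset z
  rw [← Finset.sum_coe_sort, star_sum, Finset.sum_mul_sum]
  simp only [map_sum, TensorProduct.star_tmul, Algebra.TensorProduct.tmul_mul_tmul, nuTensor_tmul]
  exact ((𝒢.posMatrix_phi fun i : S => i.1.2).twist hB hr δ).schur hb hB
    (𝒢.posMatrix_psi fun i : S => i.1.1)

end MeasuredHopf

end WeightPositivity

/-! ### The Cauchy-Schwarz inequality for slices of Δ. -/

section KeyInequality

variable {Γ B : Type*} [Group Γ] [NonUnitalCommRing B] [StarRing B] [Module ℂ B]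
variable {act : Γ →* (B ≃⋆ₐ[ℂ] B)}
variable {A : Type*} [NonUnitalRing A] [StarRing A] [Module ℂ A]
    [IsScalarTower ℂ A A] [SMulCommClass ℂ A A] [StarModule ℂ A]
variable [IsScalarTower ℂ B B] [SMulCommClass ℂ B B] [StarModule ℂ B]
variable {E : EvAlg act A}


namespace MeasuredHopf

variable (𝒢 : MeasuredHopf E)

/-- `x ⊗ y ↦ xa ⊗ y`. -/
def mulRightFst (a : A) : A ⊗[ℂ] A →ₗ[ℂ] A ⊗[ℂ] A := (LinearMap.mulRight ℂ a).rTensor A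

@[simp] lemma mulRightFst_tmul (a x y : A) :
    mulRightFst a (x ⊗ₜ[ℂ] y) = (x * a) ⊗ₜ y := rfl

lemma star_mulRightFst_mul (a : A) (z w : A ⊗[ℂ] A) :
    star (mulRightFst a z) * mulRightFst a w =
      (LinearMap.mulLeft ℂ (star a)).rTensor A (mulRightFst a (star z * w)) := by
  induction z with
  | zero => simp
  | add z z' h h' => simp only [map_add, star_add, add_mul, h, h']
  | tmul x y =>
    induction w with
    | zero => simp
    | add w w' h h' => simp only [map_add, mul_add, h, h']
    | tmul x' y' =>
      simp only [mulRightFst_tmul, TensorProduct.star_tmul, Algebra.TensorProduct.tmul_mul_tmul,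
        LinearMap.rTensor_tmul, LinearMap.mulLeft_apply, star_mul, mul_assoc]

/-- The source of the choice δ = g₂⁻¹: it is the twist that s(β) picks up when it is moved to the
right of a. -/
lemma nu_s_mul {g : Γ × Γ} {a : A} (ha : a ∈ E.gr g) (β : B) (z : A) :
    𝒢.nu ((E.s β).rgt z * a) = 𝒢.μ.toFun (act g.2⁻¹ β * 𝒢.ψ.toFun (z * a)) := by
  rw [Mult.mid, ← nu_s_rgt, Mult.rgt_mul, E.twist_s _ ha, act_act_inv]

/-- `nuTensor` lives on A ⊗ A, where no balancing relation is imposed. After multiplication by a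
homogeneous a in the first leg, and with the matching twist, its values on matched tensors factor
through the fiber product and are given by slices. -/
lemma nuTensor_mulRightFst {g : Γ × Γ} {a : A} (ha : a ∈ E.gr g) (e c : A) (ξ : matched E E) :
    𝒢.nuTensor g.2⁻¹ (star (e ⊗ₜ c) * mulRightFst a (ξ : A ⊗[ℂ] A)) =
      𝒢.nu (star e * 𝒢.fpPhiR (star c) (FP.mkQ E E ξ) * a) := by
  refine matched_induction (p := fun ξ =>
    𝒢.nuTensor g.2⁻¹ (star (e ⊗ₜ c) * mulRightFst a (ξ : A ⊗[ℂ] A)) =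
      𝒢.nu (star e * 𝒢.fpPhiR (star c) (FP.mkQ E E ξ) * a)) (by simp)
    (fun x y hx hy => by
      simp only [NonUnitalSubalgebra.coe_add, map_add, mul_add, add_mul, hx, hy])
    (fun z x hx => by
      simp only [NonUnitalSubalgebra.coe_smul, map_smul, mul_smul_comm, smul_mul_assoc, hx]) ?_ ξ
  intro k l x y h hx hy
  rw [← FP.tm_apply h hx hy, 𝒢.fpPhiR_tm h hx hy, ← Mult.rgt_mul, 𝒢.nu_s_mul ha]
  simp [mul_assoc]

lemma nuTensor_mulLeft_mulRightFst {g : Γ × Γ} {a : A} (ha : a ∈ E.gr g) (ζ : matched E E) :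
    𝒢.nuTensor g.2⁻¹ ((LinearMap.mulLeft ℂ (star a)).rTensor A (mulRightFst a (ζ : A ⊗[ℂ] A))) =
      𝒢.nu (star a * 𝒢.fpPhi (FP.mkQ E E ζ) * a) := by
  refine matched_induction (p := fun ζ =>
    𝒢.nuTensor g.2⁻¹ ((LinearMap.mulLeft ℂ (star a)).rTensor A (mulRightFst a (ζ : A ⊗[ℂ] A))) =
      𝒢.nu (star a * 𝒢.fpPhi (FP.mkQ E E ζ) * a)) (by simp)
    (fun x y hx hy => by
      simp only [NonUnitalSubalgebra.coe_add, map_add, mul_add, add_mul, hx, hy])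
    (fun z x hx => by
      simp only [NonUnitalSubalgebra.coe_smul, map_smul, mul_smul_comm, smul_mul_assoc, hx]) ?_ ζ
  intro k l x y h hx hy
  rw [← FP.tm_apply h hx hy, 𝒢.fpPhi_tm h hx hy, ← 𝒢.s_phi_comm h hx hy, ← Mult.rgt_mul,
    𝒢.nu_s_mul ha]
  simp [mul_assoc]

lemma fpPhi_inlM_lft {w : A} (hw : w ∈ E.gr 1) (Y : FP E E) :
    𝒢.fpPhi ((FP.inlM (Mult.of w) (E.of_mem hw)).lft Y) = w * 𝒢.fpPhi Y :=
  LinearMap.congr_fun (f := 𝒢.fpPhi ∘ₗ (FP.inlM (Mult.of w) (E.of_mem hw)).lft)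
    (g := LinearMap.mulLeft ℂ w ∘ₗ 𝒢.fpPhi) (FP.hext fun g h x y e hx hy => by
      simp only [LinearMap.comp_apply, LinearMap.mulLeft_apply]
      rw [FP.inlM_lft _ e hx hy, Mult.of_lft, 𝒢.fpPhi_tm e (by simpa using E.mul_mem hw hx) hy,
        𝒢.fpPhi_tm e hx hy, E.mul_s _ _ hw, Prod.snd_one, act_one_apply]) Y

/-- Since Δ(b)^*Δ(b) = Δ(b^*b), left invariance evaluates the slice. -/
lemma fpPhi_star_mul_self {b u : A} (hu : u ∈ E.gr 1) {X : FP E E}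
    (hX : Mult.of X = 𝒢.Δ.toHom b * FP.inlM (Mult.of u) (E.of_mem hu)) :
    𝒢.fpPhi (star X * X) = star u * (E.r (𝒢.φ.toFun (star b * b))).lft u := by
  obtain ⟨Y, hY⟩ := 𝒢.Δ.exists_mul_inlM (star b * b) hu
  have hu' : star u ∈ E.gr 1 := by simpa using E.star_mem hu
  have h1 : star X * X = (FP.inlM (Mult.of (star u)) (E.of_mem hu')).lft Y := by
    apply (FP.ev E E).of_injective
    rw [of_lft_eq, hY, map_mul Mult.of, FP.of_star, hX, star_mul, FP.star_inlM hu,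
      map_mul 𝒢.Δ.toHom, StarHomClass.map_star 𝒢.Δ.toHom]
    simp only [mul_assoc]
  rw [h1, 𝒢.fpPhi_inlM_lft hu', 𝒢.fpPhi_mul_inlM hu hY]

/-- The Cauchy-Schwarz inequality on the fiber product, for slices of `Δ(b)`. -/
lemma norm_nu_phiR_sq_le (hB : HasLocalUnits B) (hb : 𝒢.μ.IsBounded) (hr : 𝒢.μ.HasModularRoot)
    {g : Γ × Γ} {a : A} (ha : a ∈ E.gr g) (e c b : A) :
    ‖𝒢.nu (star e * 𝒢.phiR (star c) b * a)‖ ^ 2 ≤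
      (𝒢.μ.toFun (act g.2⁻¹ (𝒢.φ.toFun (star c * c)) * 𝒢.ψ.toFun (star e * e))).re *
        (𝒢.μ.toFun (act g.1⁻¹ (𝒢.φ.toFun (star b * b)) * 𝒢.φ.toFun (star a * a))).re := by
  obtain ⟨u, hu, hua⟩ := E.unit1 a
  obtain ⟨X, hX⟩ := 𝒢.Δ.exists_mul_inlM b hu
  -- Positivity is available on A ⊗ A only, so Δ(b)(u ⊗ 1) is lifted to a matched tensor ξ; the
  -- choice of the lift does not matter for the values below.
  obtain ⟨ξ, rfl⟩ := FP.mkQ_surjective X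
  have h := GNS.cauchy_schwarz (𝒢.nuTensor g.2⁻¹) (𝒢.nuTensor_nonneg hB hb hr g.2⁻¹) (e ⊗ₜ c)
    (mulRightFst a (ξ : A ⊗[ℂ] A))
  rw [𝒢.nuTensor_mulRightFst ha, 𝒢.fpPhiR_mul_inlM hu hX, mul_assoc, mul_assoc, hua,
    star_mulRightFst_mul] at h
  have h1 := 𝒢.nuTensor_mulLeft_mulRightFst ha (FP.starM ξ * ξ)
  -- The product ξ^*ξ is again matched, and its class is the square of Δ(b)(u ⊗ 1); this gives the
  -- second factor of the inequality.
  have h2 : FP.mkQ E E (FP.starM ξ * ξ) = star (FP.mkQ E E ξ) * FP.mkQ E E ξ := rfl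
  rw [h2, 𝒢.fpPhi_star_mul_self hu hX] at h1
  have h3 : ((FP.starM ξ * ξ : matched E E) : A ⊗[ℂ] A) = star (ξ : A ⊗[ℂ] A) * ξ := rfl
  rw [h3] at h1
  rw [h1] at h
  have h4 : 𝒢.nu (star a * (star u * (E.r (𝒢.φ.toFun (star b * b))).lft u) * a) =
      𝒢.μ.toFun (act g.1⁻¹ (𝒢.φ.toFun (star b * b)) * 𝒢.φ.toFun (star a * a)) := by
    rw [← mul_assoc, ← star_mul, hua, mul_assoc, ← Mult.lft_mul, hua, ← nu_r_rgt, Mult.rgt_mul,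
      E.twist_r _ ha, act_act_inv]
  rw [h4] at h
  rw [mul_assoc]
  simpa using h

/-- Operators on `A` are bounded if they satisfy a Cauchy-Schwarz type estimate. -/
lemma exists_extend (R : A →ₗ[ℂ] A) {K : ℝ} (hK : 0 ≤ K)
    (h : ∀ y, (‖𝒢.Lam (R y)‖ ^ 2) ^ 2 ≤ K * ‖𝒢.Lam (R y)‖ ^ 2 * ‖𝒢.Lam y‖ ^ 2) :
    ∃ T : 𝒢.H →L[ℂ] 𝒢.H, ∀ y, T (𝒢.Lam y) = 𝒢.Lam (R y) := by
  refine GNS.exists_extend _ _ R K fun y => ?_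
  have h1 := h y
  change (𝒢.nu _).re ≤ K * (𝒢.nu _).re
  rw [nu_star_mul_self, nu_star_mul_self, Complex.ofReal_re, Complex.ofReal_re]
  rcases (sq_nonneg ‖𝒢.Lam (R y)‖).eq_or_lt with h0 | h0
  · rw [← h0]; positivity
  · refine le_of_mul_le_mul_left ?_ h0
    calc _ = (‖𝒢.Lam (R y)‖ ^ 2) ^ 2 := by ring
      _ ≤ _ := h1
      _ = _ := by ring

lemma norm_Lam_sq (x : A) : ‖𝒢.Lam x‖ ^ 2 = (𝒢.nu (star x * x)).re := by
  rw [nu_star_mul_self, Complex.ofReal_re]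

lemma phi_nonneg (q : A) (c : B) : 0 ≤ 𝒢.μ.toFun (star c * (𝒢.φ.toFun (star q * q) * c)) := by
  simpa using 𝒢.posMatrix_phi (fun _ : Unit => q) fun _ => c

lemma psi_nonneg (q : A) (c : B) : 0 ≤ 𝒢.μ.toFun (star c * (𝒢.ψ.toFun (star q * q) * c)) := by
  simpa using 𝒢.posMatrix_psi (fun _ : Unit => q) fun _ => c

end MeasuredHopf

end KeyInequality

/-! ### Boundedness of left multiplication and convolution, and the two representations. -/

section BoundedOperators

variable {Γ B : Type*} [Group Γ] [NonUnitalCommRing B] [StarRing B] [Module ℂ B]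
variable {act : Γ →* (B ≃⋆ₐ[ℂ] B)}
variable {A : Type*} [NonUnitalRing A] [StarRing A] [Module ℂ A]
    [IsScalarTower ℂ A A] [SMulCommClass ℂ A A] [StarModule ℂ A]
variable [IsScalarTower ℂ B B] [SMulCommClass ℂ B B] [StarModule ℂ B]
variable {E : EvAlg act A}


namespace MeasuredHopf

variable (𝒢 : MeasuredHopf E)

lemma star_phi_self (hB : HasLocalUnits B) (b : A) :
    star (𝒢.φ.toFun (star b * b)) = 𝒢.φ.toFun (star b * b) := by
  rw [← 𝒢.phi_star hB, star_mul, star_star]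

lemma star_psi_self (hB : HasLocalUnits B) (b : A) :
    star (𝒢.ψ.toFun (star b * b)) = 𝒢.ψ.toFun (star b * b) := by
  rw [← 𝒢.psi_star hB, star_mul, star_star]

/-- Left multiplication by `∑ s(φ(c^* b₂)) b₁` is bounded on homogeneous elements. -/
lemma exists_norm_phiR_mul_le (hB : HasLocalUnits B) (hb : 𝒢.μ.IsBounded)
    (hr : 𝒢.μ.HasModularRoot) (c b : A) :
    ∃ K : ℝ, 0 ≤ K ∧ ∀ g, ∀ a ∈ E.gr g,
      ‖𝒢.Lam (𝒢.phiR (star c) b * a)‖ ^ 2 ≤ K * ‖𝒢.Lam a‖ ^ 2 := by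
  obtain ⟨K₁, h1, hK₁⟩ := Weight.exists_twist_bound hb hB hr (𝒢.star_phi_self hB c)
  obtain ⟨K₂, h2, hK₂⟩ := Weight.exists_twist_bound hb hB hr (𝒢.star_phi_self hB b)
  refine ⟨K₁ * K₂, mul_nonneg h1 h2, fun g a ha => ?_⟩
  set x := 𝒢.phiR (star c) b * a with hx
  -- With e = x the left side is ‖x‖⁴, and one factor ‖x‖² on the right cancels.
  have h := 𝒢.norm_nu_phiR_sq_le hB hb hr ha x c b
  have h3 := hK₁ g.2⁻¹ _ (𝒢.psi_nonneg x)
  have h4 := hK₂ g.1⁻¹ _ (𝒢.phi_nonneg a)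
  rw [← nu_eq_psi, ← norm_Lam_sq] at h3
  rw [← nu_eq_phi, ← norm_Lam_sq] at h4
  rw [mul_assoc, ← hx, nu_star_mul_self, Complex.norm_real, Real.norm_of_nonneg (sq_nonneg _)] at h
  have h5 : (‖𝒢.Lam x‖ ^ 2) ^ 2 ≤ ‖𝒢.Lam x‖ ^ 2 * (K₁ * K₂ * ‖𝒢.Lam a‖ ^ 2) := by
    -- The bounds of the two factors can be multiplied because the first factor is non-negative,
    -- being the square of x ⊗ c under `nuTensor`.
    by_cases h6 : 0 ≤ (𝒢.μ.toFun (act g.2⁻¹ (𝒢.φ.toFun (star c * c)) *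
      𝒢.ψ.toFun (star x * x))).re
    · calc _ ≤ _ := h
        _ ≤ _ := mul_le_mul_of_nonneg_left h4 h6
        _ ≤ _ := mul_le_mul_of_nonneg_right h3 (mul_nonneg h2 (sq_nonneg _))
        _ = _ := by ring
    · exfalso
      refine h6 ?_
      have := 𝒢.nuTensor_nonneg hB hb hr g.2⁻¹ (x ⊗ₜ c)
      simpa using (Complex.nonneg_iff.1 this).1
  rcases (sq_nonneg ‖𝒢.Lam x‖).eq_or_lt with h0 | h0
  · rw [← h0]; positivity
  · exact le_of_mul_le_mul_left (by rwa [sq] at h5) h0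

lemma exists_homogeneous_sum (E : EvAlg act A) (a : A) :
    ∃ f : Γ × Γ →₀ A, (∀ g, f g ∈ E.gr g) ∧ a = ∑ g ∈ f.support, f g := by
  have ha : a ∈ ⨆ g, E.gr g := by rw [E.iSup_gr]; trivial
  obtain ⟨f, hf, rfl⟩ := (Submodule.mem_iSup_iff_exists_finsupp _ _).1 ha
  exact ⟨f, hf, rfl⟩

/-- Homogeneous elements of different degrees are orthogonal. -/
lemma norm_Lam_sum_sq (h : Γ × Γ) {f : Γ × Γ → A} (hf : ∀ g, f g ∈ E.gr (h * g))
    (s : Finset (Γ × Γ)) : ‖𝒢.Lam (∑ g ∈ s, f g)‖ ^ 2 = ∑ g ∈ s, ‖𝒢.Lam (f g)‖ ^ 2 := by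
  classical
  rw [norm_Lam_sq, star_sum, Finset.sum_mul_sum, map_sum, Complex.re_sum]
  refine Finset.sum_congr rfl fun g hg => ?_
  rw [map_sum, Finset.sum_eq_single g, norm_Lam_sq]
  · intro k _ hk
    refine 𝒢.nu_eq_zero (E.mul_mem (E.star_mem (hf g)) (hf k)) fun h1 => hk ?_
    exact (mul_left_cancel (inv_mul_eq_one.1 h1)).symm
  · exact fun h1 => absurd hg h1

/-- Left multiplication by a homogeneous x maps components of different degrees to components of
different degrees. Both sums are orthogonal, so a bound that is uniform on the components holds on
A. -/
lemma exists_mulOp_of_homogeneous {h : Γ × Γ} {x : A} (hx : x ∈ E.gr h) {K : ℝ}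
    (hK : ∀ g, ∀ a ∈ E.gr g, ‖𝒢.Lam (x * a)‖ ^ 2 ≤ K * ‖𝒢.Lam a‖ ^ 2) :
    ∃ T : 𝒢.H →L[ℂ] 𝒢.H, ∀ y, T (𝒢.Lam y) = 𝒢.Lam (x * y) := by
  refine GNS.exists_extend _ _ (LinearMap.mulLeft ℂ x) K fun a => ?_
  change (𝒢.nu (star (x * a) * (x * a))).re ≤ K * (𝒢.nu _).re
  rw [← norm_Lam_sq, ← norm_Lam_sq]
  obtain ⟨f, hf, rfl⟩ := exists_homogeneous_sum E a
  rw [Finset.mul_sum, 𝒢.norm_Lam_sum_sq h fun g => E.mul_mem hx (hf g),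
    𝒢.norm_Lam_sum_sq 1 (fun g => by simpa using hf g), Finset.mul_sum]
  exact Finset.sum_le_sum fun g _ => hK g _ (hf g)

/-- Left multiplication by any element of `A` is bounded. -/
lemma exists_mulOp (hB : HasLocalUnits B) (hb : 𝒢.μ.IsBounded) (hr : 𝒢.μ.HasModularRoot)
    (x : A) : ∃ T : 𝒢.H →L[ℂ] 𝒢.H, ∀ y, T (𝒢.Lam y) = 𝒢.Lam (x * y) := by
  have hz : ∃ T : 𝒢.H →L[ℂ] 𝒢.H, ∀ y, T (𝒢.Lam y) = 𝒢.Lam (0 * y) := ⟨0, fun y => by simp⟩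
  have hadd : ∀ x x', (∃ T : 𝒢.H →L[ℂ] 𝒢.H, ∀ y, T (𝒢.Lam y) = 𝒢.Lam (x * y)) →
      (∃ T : 𝒢.H →L[ℂ] 𝒢.H, ∀ y, T (𝒢.Lam y) = 𝒢.Lam (x' * y)) →
      ∃ T : 𝒢.H →L[ℂ] 𝒢.H, ∀ y, T (𝒢.Lam y) = 𝒢.Lam ((x + x') * y) := by
    rintro x x' ⟨T, hT⟩ ⟨T', hT'⟩
    exact ⟨T + T', fun y => by
      rw [add_apply, hT, hT', ← map_add, add_mul]⟩
  have hx : x ∈ Submodule.span ℂ {z | ∃ c b, z = 𝒢.phiR c b} := by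
    rw [𝒢.span_phiR]; trivial
  refine Submodule.span_induction ?_ hz (fun x x' _ _ h h' => hadd x x' h h') ?_ hx
  · rintro _ ⟨c, b, rfl⟩
    -- Slices of homogeneous elements are homogeneous, as the orthogonality argument requires.
    refine E.hinduction (p := fun c => ∃ T : 𝒢.H →L[ℂ] 𝒢.H, ∀ y,
      T (𝒢.Lam y) = 𝒢.Lam (𝒢.phiR c b * y)) (by simpa using hz)
      (fun c c' h h' => by simpa using hadd _ _ h h') (fun α c hc => ?_) c
    refine E.hinduction (p := fun b => ∃ T : 𝒢.H →L[ℂ] 𝒢.H, ∀ y,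
      T (𝒢.Lam y) = 𝒢.Lam (𝒢.phiR c b * y)) (by simpa using hz)
      (fun b b' h h' => by simpa using hadd _ _ h h') (fun β b hb' => ?_) b
    obtain ⟨K, -, hK⟩ := 𝒢.exists_norm_phiR_mul_le hB hb hr (star c) b
    rw [star_star] at hK
    exact 𝒢.exists_mulOp_of_homogeneous (𝒢.phiR_mem hc hb') hK
  · rintro z x _ ⟨T, hT⟩
    exact ⟨z • T, fun y => by
      rw [smul_apply, hT, ← map_smul, smul_mul_assoc]⟩

/-- ν vanishes off degree e, so only the component of b of degree e contributes. A partner of degree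
e is homogeneous, as the key inequality demands, and carries no twist. -/
lemma exists_nu_mul_comm_of_mem {u : A} (hu : u ∈ E.gr 1) :
    ∃ b ∈ E.gr 1, ∀ t, 𝒢.nu (u * t) = 𝒢.nu (t * b) := by
  obtain ⟨b, hb⟩ := 𝒢.exists_nu_mul_comm u
  obtain ⟨f, hf, rfl⟩ := exists_homogeneous_sum E b
  refine ⟨f 1, hf 1, fun t => ?_⟩
  refine E.hinduction (p := fun t => 𝒢.nu (u * t) = 𝒢.nu (t * f 1)) (by simp)
    (fun x y hx hy => by simp only [mul_add, add_mul, map_add, hx, hy]) (fun g t ht => ?_) t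
  by_cases hg : g = 1
  · subst hg
    classical
    rw [hb, Finset.mul_sum, map_sum]
    refine Finset.sum_eq_single 1 (fun k _ hk => 𝒢.nu_eq_zero (E.mul_mem ht (hf k))
      (by simpa using hk)) fun h1 => ?_
    rw [Finsupp.notMem_support_iff.1 h1, mul_zero, map_zero]
  · rw [𝒢.nu_eq_zero (E.mul_mem hu ht) (by simpa using hg),
      𝒢.nu_eq_zero (E.mul_mem ht (hf 1)) (by simpa using hg)]

/-- Convolution with any element of the dual algebra is bounded. -/
lemma exists_convOp (hB : HasLocalUnits B) (hb : 𝒢.μ.IsBounded) (hr : 𝒢.μ.HasModularRoot)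
    (w : A) : ∃ T : 𝒢.H →L[ℂ] 𝒢.H, ∀ y, T (𝒢.Lam y) = 𝒢.Lam (𝒢.psiR w y) := by
  -- The unit u creates a factor on the left of w, which the modular property carries to the right
  -- as b.
  obtain ⟨u, hu, huw⟩ := E.unit1 w
  obtain ⟨b, hbm, hub⟩ := 𝒢.exists_nu_mul_comm_of_mem hu
  obtain ⟨K₁, h1, hK₁⟩ := Weight.exists_twist_bound hb hB hr (𝒢.star_psi_self hB (star w))
  obtain ⟨K₂, h2, hK₂⟩ := Weight.exists_twist_bound hb hB hr (𝒢.star_phi_self hB b)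
  refine 𝒢.exists_extend (𝒢.psiR w) (mul_nonneg h1 h2) fun y => ?_
  set e := 𝒢.psiR w y with he
  have h := 𝒢.norm_nu_phiR_sq_le hB hb hr hbm (star w) e y
  have h3 := hK₁ 1 _ (𝒢.phi_nonneg e)
  have h4 := hK₂ 1 _ (𝒢.phi_nonneg y)
  rw [← nu_eq_phi, ← norm_Lam_sq, act_one_apply, mul_comm] at h3
  rw [← nu_eq_phi, ← norm_Lam_sq, act_one_apply, mul_comm] at h4
  -- ν(w `phiR (e^*) y` b) = ν(uw `phiR (e^*) y`) = ν(e^* `psiR w y`) = ν(e^*e).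
  have h5 : 𝒢.nu (star (star w) * 𝒢.phiR (star e) y * b) = 𝒢.nu (star e * e) := by
    rw [star_star, ← hub, ← mul_assoc, huw, nu_mul_phiR]
  simp only [Prod.snd_one, Prod.fst_one, inv_one, act_one_apply] at h
  rw [h5, nu_star_mul_self, Complex.norm_real, Real.norm_of_nonneg (sq_nonneg _)] at h
  have h6 : 0 ≤ (𝒢.μ.toFun (𝒢.φ.toFun (star e * e) * 𝒢.ψ.toFun (star (star w) * star w))).re := by
    have := 𝒢.nuTensor_nonneg hB hb hr 1 (star w ⊗ₜ e)
    rw [TensorProduct.star_tmul, Algebra.TensorProduct.tmul_mul_tmul, nuTensor_tmul,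
      act_one_apply] at this
    exact (Complex.nonneg_iff.1 this).1
  calc _ ≤ _ := h
    _ ≤ _ := mul_le_mul_of_nonneg_left h4 h6
    _ ≤ _ := mul_le_mul_of_nonneg_right h3 (mul_nonneg h2 (sq_nonneg _))
    _ = _ := by ring

lemma clm_ext {S T : 𝒢.H →L[ℂ] 𝒢.H} (h : ∀ x, S (𝒢.Lam x) = T (𝒢.Lam x)) : S = T :=
  GNS.clm_ext _ _ h

lemma star_eq_of_inner {S T : 𝒢.H →L[ℂ] 𝒢.H}
    (h : ∀ x y, inner ℂ (𝒢.Lam x) (S (𝒢.Lam y)) = inner ℂ (T (𝒢.Lam x)) (𝒢.Lam y)) :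
    S = star T := by
  refine 𝒢.clm_ext fun y => ?_
  refine (GNS.denseRange_lam 𝒢.nu 𝒢.nu_nonneg).eq_of_inner_right (𝕜 := ℂ) fun x => ?_
  rw [ContinuousLinearMap.star_eq_adjoint, ContinuousLinearMap.adjoint_inner_right]
  exact h x y

/-- The left regular representation of `A`. -/
theorem exists_leftRegular (hB : HasLocalUnits B) (hb : 𝒢.μ.IsBounded)
    (hr : 𝒢.μ.HasModularRoot) :
    ∃ π : A →⋆ₙₐ[ℂ] (𝒢.H →L[ℂ] 𝒢.H), ∀ x y, π x (𝒢.Lam y) = 𝒢.Lam (x * y) := by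
  choose T hT using 𝒢.exists_mulOp hB hb hr
  refine ⟨{ toFun := T, map_smul' := fun z x => ?_, map_zero' := ?_, map_add' := fun x x' => ?_,
            map_mul' := fun x x' => ?_, map_star' := fun x => ?_ }, hT⟩
  · exact 𝒢.clm_ext fun y => by
      rw [hT, MonoidHom.id_apply, smul_apply, hT, smul_mul_assoc, map_smul]
  · exact 𝒢.clm_ext fun y => by rw [hT, zero_mul, map_zero, zero_apply]
  · exact 𝒢.clm_ext fun y => by
      rw [hT, add_apply, hT, hT, add_mul, map_add]
  · exact 𝒢.clm_ext fun y => by rw [hT, mul_apply_eq_comp, hT, hT, mul_assoc]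
  · exact 𝒢.star_eq_of_inner fun y z => by
      rw [hT, hT, inner_Lam, inner_Lam, star_mul, mul_assoc]

/-- The representation of the dual algebra by convolution. -/
theorem exists_convolution (hB : HasLocalUnits B) (hb : 𝒢.μ.IsBounded)
    (hr : 𝒢.μ.HasModularRoot) :
    ∃ ρ : 𝒢.Dual →ₗ[ℂ] (𝒢.H →L[ℂ] 𝒢.H),
      (∀ ω υ, ρ (ω * υ) = ρ ω * ρ υ) ∧ (∀ ω, ρ (star ω) = star (ρ ω)) ∧
      ∀ ω y, ρ ω (𝒢.Lam y) = 𝒢.Lam (𝒢.conv y ω) := by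
  choose T hT using 𝒢.exists_convOp hB hb hr
  have hc : ∀ y ω, 𝒢.conv y ω = 𝒢.psiR (𝒢.S.toEquiv (𝒢.fourier.symm ω)) y := fun _ _ => rfl
  -- In terms of inverse Fourier transforms the product of the dual is itself a slice, which reduces
  -- multiplicativity to `psiR_psiR`.
  have hm : ∀ ω υ : 𝒢.Dual, 𝒢.fourier.symm (ω * υ) =
      𝒢.psiR (𝒢.S.toEquiv (𝒢.fourier.symm ω)) (𝒢.fourier.symm υ) := fun ω υ =>
    𝒢.fourier.symm_apply_apply _
  have hs : ∀ ω : 𝒢.Dual, 𝒢.fourier.symm (star ω) =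
      star (𝒢.S.toEquiv (𝒢.fourier.symm ω)) := fun ω => 𝒢.fourier.symm_apply_apply _
  refine ⟨{ toFun := fun ω => T (𝒢.S.toEquiv (𝒢.fourier.symm ω)), map_add' := fun ω υ => ?_,
            map_smul' := fun z ω => ?_ }, fun ω υ => ?_, fun ω => ?_, fun ω y => ?_⟩
  · exact 𝒢.clm_ext fun y => by
      rw [hT, add_apply, hT, hT, map_add, map_add, map_add,
        LinearMap.add_apply, map_add]
  · exact 𝒢.clm_ext fun y => by
      rw [hT, RingHom.id_apply, smul_apply, hT, map_smul, map_smul, map_smul,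
        LinearMap.smul_apply, map_smul]
  · change T _ = T _ * T _
    exact 𝒢.clm_ext fun y => by rw [hT, mul_apply_eq_comp, hT, hT, hm, 𝒢.psiR_psiR hB]
  · change T _ = star (T _)
    exact 𝒢.star_eq_of_inner fun y z => by
      rw [hT, hT, inner_Lam, inner_Lam, hs, 𝒢.nu_star_mul_psiR hB, 𝒢.S_star_S hB, star_star]
  · change T _ _ = _
    rw [hT, hc]

end MeasuredHopf

end BoundedOperators

end DynQG

end

theorem mainTheorem7
    {Γ B A : Type*} [Group Γ]
    [NonUnitalCommRing B] [StarRing B] [Module ℂ B]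
    [IsScalarTower ℂ B B] [SMulCommClass ℂ B B] [StarModule ℂ B]
    [NonUnitalRing A] [StarRing A] [Module ℂ A]
    [IsScalarTower ℂ A A] [SMulCommClass ℂ A A] [StarModule ℂ A]
    (act : Γ →* (B ≃⋆ₐ[ℂ] B)) (hB : DynQG.HasLocalUnits B)
    (E : DynQG.EvAlg act A) (𝒢 : DynQG.MeasuredHopf E)
    (hA2 : 𝒢.μ.IsBounded) (hA3 : 𝒢.μ.HasModularRoot) :
    (∃ π : A →⋆ₙₐ[ℂ] (𝒢.H →L[ℂ] 𝒢.H), ∀ x y, π x (𝒢.Lam y) = 𝒢.Lam (x * y)) ∧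
    (∃ ρ : 𝒢.Dual →ₗ[ℂ] (𝒢.H →L[ℂ] 𝒢.H),
      (∀ ω υ, ρ (ω * υ) = ρ ω * ρ υ) ∧ (∀ ω, ρ (star ω) = star (ρ ω)) ∧
      ∀ ω y, ρ ω (𝒢.Lam y) = 𝒢.Lam (𝒢.conv y ω)) :=
  ⟨𝒢.exists_leftRegular hB hA2 hA3, 𝒢.exists_convolution hB hA2 hA3⟩
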